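/- Let $G=\mathrm{PSL}_2(\mathbb C)$ act on $\mathbb P^1=\mathbb P^1(\mathbb C)$ by Möbius transformations, let $\|g\|$ be the operator norm on $\mathbb C^2$ of a representative of $g\in G$ in $\mathrm{SL}_2(\mathbb C)$, and let $\omega_{\rm FS}=\frac{i}{2\pi}\frac{dz\wedge d\bar z}{(1+|z|^2)^2}$ be the Fubini–Study form. Let $W^{1,2}$ be the space of real-valued $h\in L^1(\mathbb P^1,\omega_{\rm FS})$ whose distributional derivative $\partial h$ is a $(1,0)$-form with $L^2$ coefficients, with $$\|h\|_{W^{1,2}}=\Big|\int_{\mathbb P^1}h\,\omega_{\rm FS}\Big|+\|\partial h\|_{L^2},\qquad \|\partial h\|_{L^2}=\Big(\int_{\mathbb P^1} i\,\partial h\wedge\overline{\partial h}\Big)^{1/2}.$$ For a (Borel) probability measure $\mu$ on $G$ and $n\ge 0$ let $\mu^{*n}$ be its $n$-th convolution power ($\mu^{*0}=\delta_{\rm id}$), and let $$(f_\mu^n)^*h(x)=\int_G h(g\cdot x)\,d\mu^{*n}(g).$$ The measure $\mu$ is called non-elementary if no non-empty finite subset of $\mathbb P^1$ is preserved by all elements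 of $\operatorname{supp}\mu$ and the semigroup generated by $\operatorname{supp}\mu$ is not relatively compact in $G$. A probability measure $\nu$ on $\mathbb P^1$ is $\mu$-stationary if $\mu*\nu=\nu$, where $\mu*\nu$ is the image of $\mu\otimes\nu$ under $(g,x)\mapsto g\cdot x$. A set $E\subset\mathbb P^1$ is polar if $E\subset\{u=-\infty\}$ for some quasi-subharmonic function $u:\mathbb P^1\to[-\infty,\infty)$, that is, a function $u\not\equiv-\infty$ which is locally the sum of a subharmonic function and a smooth function. **Theorem.** Let $\mu$ be a non-elementary probability measure on $G=\mathrm{PSL}_2(\mathbb C)$ with finite first moment, i.e. $\int_G\log\|g\|\,d\mu(g)<+\infty$. Then $\mu$ admits a stationary probability measure $\nu$ on $\mathbb P^1$ that extends to a continuous linear functional $h\mapsto\langle\nu,h\rangle$ on $W^{1,2}$ (so $\langle\nu,h\rangle=\int h\,d\nu$ whenever $h\in W^{1,2}$ is continuous), with the following properties. 1. There are constants $A>0$ and $0<\lambda<1$ such that for every $n\ge0$ and every $h\in W^{1,2}$ the integral defining $(f_\mu^n)^*h(x)$ converges absolutely for $\omega_{\rm FS}$-almost every $x$, the function $(f_\mu^n)^*h-\langle\nu,h\rangle$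 belongs to $W^{1,2}$, and $$\big\|(f_\mu^n)^*h-\langle\nu,h\rangle\big\|_{W^{1,2}}\le A\,\|\partial h\|_{L^2}\,\lambda^n .$$ 2. There is a constant $A'>0$ such that $|\langle\nu,h\rangle|\le A'\,\|h\|_{W^{1,2}}$ for every $h\in W^{1,2}$. Moreover, $\nu(E)=0$ for every polar set $E\subset\mathbb P^1$. -/

import Mathlib

open MeasureTheory Set Filter Topology
open scoped LinearAlgebra.Projectivization MatrixGroups ENNReal ContDiff

noncomputable section

namespace RandomProducts

/-! ### The projective line -/

/-- The complex projective line, as the space of lines of `ℂ²`. Mathlib's action of `PSL(2, ℂ)` on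
it is the action by Möbius transformations. -/
abbrev P1 : Type := ℙ ℂ (Fin 2 → ℂ)

/-- The quotient topology from `ℂ² \ {0}`. -/
instance instTopologicalSpaceP1 : TopologicalSpace P1 :=
  TopologicalSpace.coinduced (fun v : {v : Fin 2 → ℂ // v ≠ 0} => Projectivization.mk ℂ v.1 v.2)
    inferInstance

/-- The Borel sigma-algebra of the projective line. -/
instance instMeasurableSpaceP1 : MeasurableSpace P1 := borel P1

instance instBorelSpaceP1 : BorelSpace P1 := ⟨rfl⟩

/-- Homogeneous coordinates `[z : 1]` and `[1 : z]`. -/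
def chartVec : Fin 2 → ℂ → Fin 2 → ℂ
  | 0, z => ![z, 1]
  | 1, z => ![1, z]

theorem chartVec_ne_zero (i : Fin 2) (z : ℂ) : chartVec i z ≠ 0 := by
  intro h
  fin_cases i
  · simpa [chartVec] using congrFun h 1
  · simpa [chartVec] using congrFun h 0

/-- The two standard affine parametrizations `z ↦ [z : 1]` and `z ↦ [1 : z]` of the projective
line. Each of them misses exactly one point, and they are related by `z ↦ 1 / z`. -/
def chart (i : Fin 2) (z : ℂ) : P1 := Projectivization.mk ℂ (chartVec i z) (chartVec_ne_zero i z)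

theorem continuous_chart (i : Fin 2) : Continuous (chart i) := by
  have h1 : Continuous fun z : ℂ =>
      (⟨chartVec i z, chartVec_ne_zero i z⟩ : {v : Fin 2 → ℂ // v ≠ 0}) := by
    refine Continuous.subtype_mk ?_ _
    fin_cases i
    · exact continuous_pi fun j => by fin_cases j <;> simp [chartVec] <;> fun_prop
    · exact continuous_pi fun j => by fin_cases j <;> simp [chartVec] <;> fun_prop
  exact (continuous_coinduced_rng (f := fun v : {v : Fin 2 → ℂ // v ≠ 0} =>
    Projectivization.mk ℂ v.1 v.2)).comp h1

theorem chart_one_eq {z : ℂ} (hz : z ≠ 0) : chart 1 z = chart 0 z⁻¹ := by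
  refine (Projectivization.mk_eq_mk_iff' ℂ _ _ _ _).2 ⟨z, ?_⟩
  ext j
  fin_cases j <;> simp [chartVec, hz]

/-- The density of the Fubini-Study form `(i / 2π) dz ∧ dz̄ / (1 + |z|²)²` in an affine coordinate
with respect to Lebesgue measure, where `i dz ∧ dz̄ = 2 dx ∧ dy`. -/
def fubiniStudyDensity (z : ℂ) : ℝ≥0∞ := ENNReal.ofReal (1 / (Real.pi * (1 + ‖z‖ ^ 2) ^ 2))

/-- The Fubini-Study area form, as a (probability) measure on the projective line. -/
def fubiniStudy : Measure P1 := (volume.withDensity fubiniStudyDensity).map (chart 0)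

/-! ### The Sobolev space -/

/-- The Wirtinger derivative `∂φ/∂z = (∂φ/∂x - i ∂φ/∂y) / 2`. -/
def wirtinger (φ : ℂ → ℂ) (z : ℂ) : ℂ :=
  (fderiv ℝ φ z 1 - Complex.I * fderiv ℝ φ z Complex.I) / 2

/-- `g` is the derivative `∂u/∂z` of the locally integrable function `u` on the complex plane, in
the sense of distributions. -/
def HasWeakWirtinger (u : ℂ → ℝ) (g : ℂ → ℂ) : Prop :=
  LocallyIntegrable u ∧ LocallyIntegrable g ∧
    ∀ φ : ℂ → ℂ, ContDiff ℝ ∞ φ → HasCompactSupport φ →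
      ∫ z, (u z : ℂ) * wirtinger φ z = -∫ z, g z * φ z

/-- The distributional form `∂h` on the projective line has `L²` coefficients and is equal to
`g i dz` in the `i`-th affine coordinate. Each affine coordinate covers all but one point, so
that "`L²` coefficients" means `g i ∈ L²(ℂ)` for the Lebesgue measure. -/
def HasDel (h : P1 → ℝ) (g : Fin 2 → ℂ → ℂ) : Prop :=
  ∀ i, MemLp (g i) 2 volume ∧ HasWeakWirtinger (fun z => h (chart i z)) (g i)

/-- `h` is an integrable function on the projective line such that `∂h` is in `L²`. -/
def MemW12 (h : P1 → ℝ) : Prop := Integrable h fubiniStudy ∧ ∃ g, HasDel h g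

open Classical in
/-- The norm `‖∂h‖ = (∫ i ∂h ∧ conj ∂h)^(1/2)`. If `∂h = g dz` in the affine coordinate `z`, then
`i ∂h ∧ conj ∂h = |g|² i dz ∧ dz̄ = 2 |g|² dx ∧ dy`. -/
def delNorm (h : P1 → ℝ) : ℝ :=
  if H : ∃ g, HasDel h g then Real.sqrt (2 * ∫ z, ‖H.choose 0 z‖ ^ 2) else 0

/-- The Sobolev norm `|∫ h ω_FS| + ‖∂h‖`. -/
def sobolevNorm (h : P1 → ℝ) : ℝ := |∫ x, h x ∂fubiniStudy| + delNorm h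

theorem HasWeakWirtinger.ae_eq {u : ℂ → ℝ} {g g' : ℂ → ℂ} (h : HasWeakWirtinger u g)
    (h' : HasWeakWirtinger u g') : g =ᵐ[volume] g' := by
  have key : ∀ᵐ z : ℂ, (g - g') z = 0 := by
    refine ae_eq_zero_of_integral_contDiff_smul_eq_zero (h.2.1.sub h'.2.1) fun φ hφ hc => ?_
    have hφ' : ContDiff ℝ ∞ fun z => (φ z : ℂ) := Complex.ofRealCLM.contDiff.comp hφ
    have hc' : HasCompactSupport fun z => (φ z : ℂ) := hc.comp_left (g := Complex.ofReal) rfl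
    have e := (h.2.2 _ hφ' hc').symm.trans (h'.2.2 _ hφ' hc')
    have i1 := h.2.1.integrable_smul_left_of_hasCompactSupport hφ.continuous hc
    have i2 := h'.2.1.integrable_smul_left_of_hasCompactSupport hφ.continuous hc
    simp only [Pi.sub_apply, smul_sub]
    rw [integral_sub i1 i2, sub_eq_zero]
    simpa [mul_comm] using e
  filter_upwards [key] with z hz
  exact sub_eq_zero.1 hz

/-- The norm `‖∂h‖` does not depend on the choices. -/
theorem HasDel.delNorm_eq {h : P1 → ℝ} {g : Fin 2 → ℂ → ℂ} (hg : HasDel h g) :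
    delNorm h = Real.sqrt (2 * ∫ z, ‖g 0 z‖ ^ 2) := by
  have H : ∃ g, HasDel h g := ⟨g, hg⟩
  have e : ∫ z, ‖H.choose 0 z‖ ^ 2 = ∫ z, ‖g 0 z‖ ^ 2 := by
    refine integral_congr_ae ?_
    filter_upwards [(H.choose_spec 0).2.ae_eq (hg 0).2] with z hz
    rw [hz]
  rw [delNorm, dif_pos H, e]

theorem ae_chart (i : Fin 2) {p : P1 → Prop} (hp : ∀ᵐ x ∂fubiniStudy, p x) :
    ∀ᵐ z : ℂ, p (chart i z) := by
  have h0 : ∀ᵐ z : ℂ, p (chart 0 z) := by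
    have h1 := ae_of_ae_map (continuous_chart 0).measurable.aemeasurable hp
    have hm : Measurable fubiniStudyDensity := by unfold fubiniStudyDensity; fun_prop
    filter_upwards [(ae_withDensity_iff hm).1 h1] with z hz
    refine hz (ne_of_gt (ENNReal.ofReal_pos.2 ?_))
    positivity
  fin_cases i
  · exact h0
  · have hinv : volume ((fun z : ℂ => z⁻¹) '' ({z | ¬ p (chart 0 z)} \ {0})) = 0 := by
      refine addHaar_image_eq_zero_of_differentiableOn_of_addHaar_eq_zero volume ?_ ?_
      · intro z hz
        exact ((differentiableAt_inv (𝕜 := ℂ) hz.2).restrictScalars ℝ).differentiableWithinAt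
      · exact measure_mono_null sdiff_subset h0
    have hne : ∀ᵐ z : ℂ, z ≠ 0 := by simp [ae_iff]
    have hinv' : ∀ᵐ z : ℂ, z ∉ (fun z : ℂ => z⁻¹) '' ({z | ¬ p (chart 0 z)} \ {0}) :=
      measure_eq_zero_iff_ae_notMem.1 hinv
    filter_upwards [hinv', hne] with z hz hz0
    by_contra hcon
    refine hz ⟨z⁻¹, ⟨?_, by simpa using hz0⟩, inv_inv z⟩
    simpa [chart_one_eq hz0] using hcon

theorem HasDel.congr {h h' : P1 → ℝ} {g : Fin 2 → ℂ → ℂ} (hg : HasDel h g)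
    (e : h =ᵐ[fubiniStudy] h') : HasDel h' g := by
  intro i
  obtain ⟨h1, h2, h3, h4⟩ := hg i
  have e' : (fun z => h (chart i z)) =ᵐ[volume] fun z => h' (chart i z) := ae_chart i e
  refine ⟨h1, (locallyIntegrable_congr e').1 h2, h3, fun φ hφ hc => ?_⟩
  rw [← h4 φ hφ hc]
  refine integral_congr_ae ?_
  filter_upwards [e'] with z hz
  rw [hz]

theorem continuous_wirtinger {φ : ℂ → ℂ} (hφ : ContDiff ℝ ∞ φ) : Continuous (wirtinger φ) := by
  have := hφ.continuous_fderiv (by simp)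
  unfold wirtinger
  fun_prop

theorem hasCompactSupport_wirtinger {φ : ℂ → ℂ} (hc : HasCompactSupport φ) :
    HasCompactSupport (wirtinger φ) :=
  (hc.fderiv ℝ).comp_left (g := fun L : ℂ →L[ℝ] ℂ => (L 1 - Complex.I * L Complex.I) / 2)
    (by simp)

theorem HasDel.add {h h' : P1 → ℝ} {g g' : Fin 2 → ℂ → ℂ} (hg : HasDel h g) (hg' : HasDel h' g') :
    HasDel (h + h') (g + g') := by
  intro i
  obtain ⟨h1, h2, h3, h4⟩ := hg i
  obtain ⟨h1', h2', h3', h4'⟩ := hg' i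
  refine ⟨h1.add h1', h2.add h2', h3.add h3', fun φ hφ hc => ?_⟩
  have a1 := h2.integrable_smul_right_of_hasCompactSupport
    (continuous_wirtinger hφ) (hasCompactSupport_wirtinger hc)
  have a2 := h2'.integrable_smul_right_of_hasCompactSupport
    (continuous_wirtinger hφ) (hasCompactSupport_wirtinger hc)
  have a3 := h3.integrable_smul_right_of_hasCompactSupport hφ.continuous hc
  have a4 := h3'.integrable_smul_right_of_hasCompactSupport hφ.continuous hc
  simp only [Complex.real_smul, smul_eq_mul] at a1 a2 a3 a4
  simp only [Pi.add_apply, Complex.ofReal_add, add_mul]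
  rw [integral_add a1 a2, integral_add a3 a4, h4 φ hφ hc, h4' φ hφ hc]
  ring

theorem HasDel.smul (c : ℝ) {h : P1 → ℝ} {g : Fin 2 → ℂ → ℂ} (hg : HasDel h g) :
    HasDel (c • h) (fun i z => (c : ℂ) * g i z) := by
  intro i
  obtain ⟨h1, h2, h3, h4⟩ := hg i
  refine ⟨h1.const_mul _, h2.smul c, ?_, fun φ hφ hc => ?_⟩
  · exact h3.smul (c : ℂ)
  · simp only [Pi.smul_apply, smul_eq_mul, Complex.ofReal_mul, mul_assoc, integral_const_mul]
    rw [h4 φ hφ hc]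
    ring

theorem hasDel_zero : HasDel 0 0 := by
  intro i
  refine ⟨MemLp.zero, locallyIntegrable_zero, locallyIntegrable_zero, fun φ _ _ => ?_⟩
  simp

/-- The Sobolev space `W^{1,2}` of the projective line: the (classes of) real-valued `L¹` functions
`h` such that `∂h` is in `L²`. -/
def W12 : Submodule ℝ (Lp ℝ 1 fubiniStudy) where
  carrier := {h | MemW12 h}
  add_mem' := by
    rintro a b ⟨_, g, hg⟩ ⟨_, g', hg'⟩
    exact ⟨L1.integrable_coeFn _, _, (hg.add hg').congr (Lp.coeFn_add a b).symm⟩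
  zero_mem' := ⟨L1.integrable_coeFn _, _, hasDel_zero.congr (Lp.coeFn_zero ℝ 1 fubiniStudy).symm⟩
  smul_mem' := by
    rintro c a ⟨_, g, hg⟩
    exact ⟨L1.integrable_coeFn _, _, (hg.smul c).congr (Lp.coeFn_smul c a).symm⟩

/-! ### Measures on `PSL(2, ℂ)` -/

/-- The operator norm of a matrix for the standard Hermitian norm of `ℂ²`. -/
def matNorm (A : Matrix (Fin 2) (Fin 2) ℂ) : ℝ := ‖Matrix.toEuclideanCLM (𝕜 := ℂ) A‖

theorem matNorm_mul_center (A c : SL(2, ℂ)) (hc : c ∈ Subgroup.center SL(2, ℂ)) :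
    matNorm (A * c : SL(2, ℂ)).1 = matNorm A.1 := by
  obtain ⟨r, hr, hrc⟩ := Matrix.SpecialLinearGroup.mem_center_iff.1 hc
  have hr1 : ‖r‖ = 1 := by
    have : ‖r‖ ^ 2 = 1 := by rw [← norm_pow]; simpa using congrArg norm hr
    exact (pow_eq_one_iff_of_nonneg (norm_nonneg r) two_ne_zero).1 this
  have e : (A * c : SL(2, ℂ)).1 = r • A.1 := by
    rw [Matrix.SpecialLinearGroup.coe_mul, ← hrc]
    ext i j
    fin_cases i <;> fin_cases j <;> simp [mul_comm]
  rw [matNorm, matNorm, e, map_smul, norm_smul, hr1, one_mul]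

/-- The operator norm `‖g‖` of an element of `PSL(2, ℂ)`: that of any of its representatives. -/
def opNorm : PSL(2, ℂ) → ℝ :=
  Quotient.lift (fun A : SL(2, ℂ) => matNorm A.1) fun A B hAB => by
    have h : A⁻¹ * B ∈ Subgroup.center SL(2, ℂ) := QuotientGroup.leftRel_apply.1 hAB
    simpa using (matNorm_mul_center A _ h).symm

/-- `μ` is non-elementary: no non-empty finite subset of the projective line is preserved by all
elements of the support of `μ`, and the semigroup generated by the support of `μ` is not
relatively compact in `PSL(2, ℂ)`. -/
def IsNonElementary [MeasurableSpace PSL(2, ℂ)] (μ : Measure PSL(2, ℂ)) : Prop :=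
  (¬ ∃ F : Set P1, F.Finite ∧ F.Nonempty ∧ ∀ g ∈ μ.support, ∀ x ∈ F, g • x ∈ F) ∧
    ¬ IsCompact (closure (Subsemigroup.closure μ.support : Set PSL(2, ℂ)))

/-- `∫ log ‖g‖ dμ(g) < ∞` (note that `‖g‖ ≥ 1`). -/
def HasFiniteFirstMoment [MeasurableSpace PSL(2, ℂ)] (μ : Measure PSL(2, ℂ)) : Prop :=
  ∫⁻ g, ENNReal.ofReal (Real.log (opNorm g)) ∂μ < ⊤

/-- The convolution power `μ^{*n}`: the law of a product of `n` independent elements of law `μ`. -/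
def convPow [MeasurableSpace PSL(2, ℂ)] (μ : Measure PSL(2, ℂ)) : ℕ → Measure PSL(2, ℂ)
  | 0 => Measure.dirac 1
  | n + 1 => μ.mconv (convPow μ n)

/-- The action `(f_μ^n)^* h (x) = ∫ h(g x) dμ^{*n}(g)` of the `n`-th iterate of the transfer
operator. -/
def transfer [MeasurableSpace PSL(2, ℂ)] (μ : Measure PSL(2, ℂ)) (n : ℕ) (h : P1 → ℝ) (x : P1) :
    ℝ :=
  ∫ g, h (g • x) ∂(convPow μ n)

/-- `ν` is `μ`-stationary: the image `μ * ν` of `μ ⊗ ν` by `(g, x) ↦ g x` is `ν`. -/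
def IsStationary [MeasurableSpace PSL(2, ℂ)] (μ : Measure PSL(2, ℂ)) (ν : Measure P1) : Prop :=
  (μ.prod ν).map (fun p : PSL(2, ℂ) × P1 => p.1 • p.2) = ν

/-! ### Polar sets -/

/-- The mean of an extended real-valued function `v`, bounded from above, on the circle of center
`c` and radius `r`: the mean of its positive part minus the mean of its negative part. -/
def circleMean (v : ℂ → EReal) (c : ℂ) (r : ℝ) : EReal :=
  ((∫⁻ θ in Ioc 0 (2 * Real.pi), (v (circleMap c r θ)).toENNReal / ENNReal.ofReal (2 * Real.pi) :
      ℝ≥0∞) : EReal) -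
    ((∫⁻ θ in Ioc 0 (2 * Real.pi), (-v (circleMap c r θ)).toENNReal /
      ENNReal.ofReal (2 * Real.pi) : ℝ≥0∞) : EReal)

/-- `v` is a subharmonic function with values in `[-∞, ∞)` on the open set `U`; here `v = -∞` is
allowed. -/
def IsSubharmonicOn (v : ℂ → EReal) (U : Set ℂ) : Prop :=
  UpperSemicontinuousOn v U ∧ (∀ z ∈ U, v z ≠ ⊤) ∧
    ∀ z ∈ U, ∀ r : ℝ, 0 < r → Metric.closedBall z r ⊆ U → v z ≤ circleMean v z r

/-- `u` is quasi-subharmonic on the projective line: it is not identically `-∞` and it is locally,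
in affine coordinates, the difference of a subharmonic function and a smooth function. -/
def IsQuasiSubharmonic (u : P1 → EReal) : Prop :=
  (∃ x, u x ≠ ⊥) ∧ ∀ (i : Fin 2) (z : ℂ), ∃ U : Set ℂ, IsOpen U ∧ z ∈ U ∧
    ∃ s : ℂ → ℝ, ContDiffOn ℝ ∞ s U ∧
      IsSubharmonicOn (fun w => u (chart i w) + ((s w : ℝ) : EReal)) U

/-- `E` is polar: it is contained in `{u = -∞}` for some quasi-subharmonic function `u`. -/
def IsPolar (E : Set P1) : Prop := ∃ u : P1 → EReal, IsQuasiSubharmonic u ∧ E ⊆ {x | u x = ⊥}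

end RandomProducts

end

/-! The engine is the conformal invariance of the L² norm of (1,0)-forms in complex dimension one:
the pull-back of `φ dz` by g has coefficient φ(gz) g'(z), and |g'|² is the real Jacobian of g. So G
acts isometrically on L² forms, and on ∂h the transfer operator acts as an average P of isometries
(`formAvg`).

Spectral gap. The variance identity `lintegral_formAvg_variance` says that the norm lost by P is the
mean square distance between g^*φ and Pφ. If the norms of φ_j = P^j φ do not drop over many steps,
then g^*φ_j is close to φ_{j+1} for most j and g, so the probability measures obtained by summing
|φ_j|² over j and normalizing are nearly invariant. A weak limit on the compact space `P1` is
invariant under the whole support of μ (`exists_almost_invariant`, `exists_contraction`). This is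
impossible (`not_exists_invariant`): an invariant measure with atoms gives a finite invariant set,
and one without atoms forces the semigroup to be bounded, since a divergent sequence of Möbius maps
pushes almost everything to one point. Hence some power of P halves the squared norm, and ∂ of the
iterates decays geometrically.

From forms to functions. The constants, invisible to ∂, remain to be controlled. The Poincaré
inequality (`exists_poincare`) bounds oscillation, and `exists_mean_smul_sub_le` shows that the mean
of h ∘ g differs from that of h by at most C (1 + log ‖g‖) ‖∂h‖. The logarithm comes from extracting
square roots in the polar decomposition; it is why a first moment suffices. The means of the
iterates of h are then Cauchy with geometric increments, and their limit is the functional L. A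
Cesàro limit of the laws μ^{*j} * ω_FS is stationary and represents L on continuous functions.

Polar sets. Let p = C - v be superharmonic and nonnegative near a point, not identically infinite.
Testing superharmonicity against χ² / (1 + p) bounds the energy of χ log(1 + p), although p itself
may have infinite energy. Mollifications of p exceed any M on a compact set K where p = ∞, so
boundedness of ν on W^{1,2} bounds log(1 + M) ν(K) independently of M, and ν(K) = 0. -/

noncomputable section
namespace RandomProducts

/-! ### Topology of the projective line and of `PSL(2, ℂ)` -/

/-- The projection from nonzero vectors to the projective line. -/
def toP1 (v : {v : Fin 2 → ℂ // v ≠ 0}) : P1 := Projectivization.mk ℂ v.1 v.2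

/-- Proportionality in ℂ² is the vanishing of one determinant. In this polynomial form the diagonal
is visibly closed, and equalities of points become algebra. -/
theorem toP1_eq_iff (v w : {v : Fin 2 → ℂ // v ≠ 0}) :
    toP1 v = toP1 w ↔ v.1 0 * w.1 1 = v.1 1 * w.1 0 := by
  obtain ⟨v, hv⟩ := v
  obtain ⟨w, hw⟩ := w
  unfold toP1
  rw [Projectivization.mk_eq_mk_iff']
  constructor
  · rintro ⟨a, rfl⟩
    simp; ring
  · intro h
    simp only at h
    by_cases h0 : w 0 = 0
    · have h1 : w 1 ≠ 0 := fun h1 => hw (by ext j; fin_cases j <;> simp [h0, h1])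
      refine ⟨v 1 / w 1, ?_⟩
      ext j
      fin_cases j
      · simp only [h0, mul_zero, mul_eq_zero, h1, or_false] at h
        simp [h0, h]
      · simp [h1]
    · refine ⟨v 0 / w 0, ?_⟩
      ext j
      fin_cases j
      · simp [h0]
      · simp; field_simp; linear_combination h

theorem isOpenQuotientMap_toP1 : IsOpenQuotientMap toP1 := by
  have hq : IsQuotientMap toP1 :=
    ⟨⟨rfl⟩, fun x => ⟨⟨x.rep, x.rep_nonzero⟩, x.mk_rep⟩⟩
  refine ⟨hq.surjective, hq.continuous, fun U hU => ?_⟩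
  rw [← hq.isOpen_preimage]
  have : toP1 ⁻¹' (toP1 '' U) = ⋃ a : ℂˣ, (fun v : {v : Fin 2 → ℂ // v ≠ 0} =>
      (⟨(a : ℂ) • v.1, smul_ne_zero a.ne_zero v.2⟩ : {v : Fin 2 → ℂ // v ≠ 0})) ⁻¹' U := by
    ext v
    simp only [mem_preimage, mem_image, mem_iUnion]
    constructor
    · rintro ⟨w, hw, e⟩
      obtain ⟨a, ha⟩ := (Projectivization.mk_eq_mk_iff ℂ _ _ w.2 v.2).1 e
      refine ⟨a, ?_⟩
      convert hw using 1
      exact Subtype.ext ha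
    · rintro ⟨a, ha⟩
      exact ⟨_, ha, (Projectivization.mk_eq_mk_iff ℂ _ _ _ v.2).2 ⟨a, rfl⟩⟩
  rw [this]
  refine isOpen_iUnion fun a => hU.preimage ?_
  have h : Continuous fun v : {v : Fin 2 → ℂ // v ≠ 0} => (a : ℂ) • v.1 :=
    continuous_pi fun j => continuous_const.mul ((continuous_apply j).comp continuous_subtype_val)
  exact h.subtype_mk _

instance : SecondCountableTopology P1 :=
  isOpenQuotientMap_toP1.isQuotientMap.secondCountableTopology isOpenQuotientMap_toP1.isOpenMap

instance : T2Space P1 := by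
  rw [t2Space_iff_of_isOpenQuotientMap isOpenQuotientMap_toP1]
  simp only [toP1_eq_iff]
  have h (i : Fin 2) : Continuous fun v : {v : Fin 2 → ℂ // v ≠ 0} => v.1 i :=
    (continuous_apply i).comp continuous_subtype_val
  exact isClosed_eq (((h 0).comp continuous_fst).mul ((h 1).comp continuous_snd))
    (((h 1).comp continuous_fst).mul ((h 0).comp continuous_snd))

instance : CompactSpace P1 := by
  have hK : IsCompact (Metric.sphere (0 : Fin 2 → ℂ) 1) := isCompact_sphere _ _
  have hne : ∀ v : Metric.sphere (0 : Fin 2 → ℂ) 1, v.1 ≠ 0 := fun v h => by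
    have := v.2
    simp [h] at this
  have : CompactSpace (Metric.sphere (0 : Fin 2 → ℂ) 1) := isCompact_iff_compactSpace.1 hK
  let f : Metric.sphere (0 : Fin 2 → ℂ) 1 → P1 := fun v => toP1 ⟨v.1, hne v⟩
  have hf : Continuous f := isOpenQuotientMap_toP1.continuous.comp
    (continuous_subtype_val.subtype_mk _)
  have hs : Function.Surjective f := by
    intro x
    obtain ⟨v, rfl⟩ := isOpenQuotientMap_toP1.surjective x
    have hv : ‖v.1‖ ≠ 0 := norm_ne_zero_iff.2 v.2
    refine ⟨⟨((‖v.1‖⁻¹ : ℝ) : ℂ) • v.1, by simp [norm_smul, hv]⟩, ?_⟩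
    simp only [f]
    rw [toP1_eq_iff]
    simp; ring
  exact hs.compactSpace hf

/-- Needed for polar sets: the interior of {u = -∞} will turn out to be clopen. -/
instance : ConnectedSpace P1 := by
  have h : IsConnected ({0}ᶜ : Set (Fin 2 → ℂ)) :=
    isConnected_compl_singleton_of_one_lt_rank (by
      rw [← Module.finrank_eq_rank]
      have : Module.finrank ℝ (Fin 2 → ℂ) = 4 := by
        rw [Module.finrank_pi_fintype]; simp
      rw [this]; norm_num) 0
  have : ConnectedSpace {v : Fin 2 → ℂ // v ≠ 0} := isConnected_iff_connectedSpace.1 h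
  exact isOpenQuotientMap_toP1.surjective.connectedSpace isOpenQuotientMap_toP1.continuous

instance : TopologicalSpace.MetrizableSpace P1 :=
  TopologicalSpace.metrizableSpace_of_t3_secondCountable P1

instance : SecondCountableTopology SL(2, ℂ) :=
  have : SecondCountableTopology (Matrix (Fin 2) (Fin 2) ℂ) :=
    inferInstanceAs (SecondCountableTopology (Fin 2 → Fin 2 → ℂ))
  Topology.IsEmbedding.subtypeVal.secondCountableTopology

instance : SecondCountableTopology PSL(2, ℂ) :=
  inferInstanceAs (SecondCountableTopology (SL(2, ℂ) ⧸ Subgroup.center SL(2, ℂ)))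

/-- The projection from `SL(2, ℂ)` to `PSL(2, ℂ)`. -/
def toPSL (A : SL(2, ℂ)) : PSL(2, ℂ) := QuotientGroup.mk A

theorem toPSL_mul (A B : SL(2, ℂ)) : toPSL (A * B) = toPSL A * toPSL B := rfl

theorem isOpenQuotientMap_toPSL : IsOpenQuotientMap toPSL :=
  QuotientGroup.isOpenQuotientMap_mk

theorem toPSL_smul_toP1 (A : SL(2, ℂ)) (v : {v : Fin 2 → ℂ // v ≠ 0})
    (h : A.1.mulVec v.1 ≠ 0) : toPSL A • toP1 v = toP1 ⟨A.1.mulVec v.1, h⟩ := rfl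

theorem SL_mulVec_ne_zero (A : SL(2, ℂ)) {v : Fin 2 → ℂ} (hv : v ≠ 0) : A.1.mulVec v ≠ 0 := by
  intro h
  apply hv
  have : (A⁻¹ * A).1.mulVec v = 0 := by
    rw [Matrix.SpecialLinearGroup.coe_mul, ← Matrix.mulVec_mulVec, h, Matrix.mulVec_zero]
  simpa using this

theorem continuous_SL_entry (i j : Fin 2) : Continuous fun A : SL(2, ℂ) => A.1 i j :=
  (continuous_subtype_val (p := fun A : Matrix (Fin 2) (Fin 2) ℂ => A.det = 1)).matrix_elem i j

instance : ContinuousSMul PSL(2, ℂ) P1 := by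
  refine ⟨?_⟩
  have hq := (isOpenQuotientMap_toPSL.prodMap isOpenQuotientMap_toP1).isQuotientMap
  rw [hq.continuous_iff]
  have : Continuous fun p : SL(2, ℂ) × {v : Fin 2 → ℂ // v ≠ 0} =>
      (⟨p.1.1.mulVec p.2.1, SL_mulVec_ne_zero p.1 p.2.2⟩ : {v : Fin 2 → ℂ // v ≠ 0}) := by
    refine Continuous.subtype_mk ?_ _
    refine Continuous.matrix_mulVec ?_ (by fun_prop)
    exact (continuous_subtype_val (p := fun A : Matrix (Fin 2) (Fin 2) ℂ => A.det = 1)).comp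
      continuous_fst
  exact isOpenQuotientMap_toP1.continuous.comp this

/-! ### The operator norm -/

theorem opNorm_toPSL (A : SL(2, ℂ)) : opNorm (toPSL A) = matNorm A.1 := rfl

theorem continuous_matNorm : Continuous matNorm := by
  unfold matNorm
  have : Continuous fun A : Matrix (Fin 2) (Fin 2) ℂ => Matrix.toEuclideanCLM (𝕜 := ℂ) A :=
    LinearMap.continuous_of_finiteDimensional
      (AlgHomClass.toAlgHom (R := ℂ) (Matrix.toEuclideanCLM (𝕜 := ℂ) (n := Fin 2))).toLinearMap
  exact this.norm

theorem continuous_opNorm : Continuous opNorm := by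
  rw [isOpenQuotientMap_toPSL.isQuotientMap.continuous_iff]
  exact continuous_matNorm.comp continuous_subtype_val

theorem matNorm_mul_le (A B : Matrix (Fin 2) (Fin 2) ℂ) :
    matNorm (A * B) ≤ matNorm A * matNorm B := by
  unfold matNorm
  rw [map_mul]
  exact norm_mul_le _ _

theorem matNorm_one : matNorm 1 = 1 := by
  unfold matNorm
  rw [map_one]
  exact norm_one

theorem matNorm_star_mul_self (A : Matrix (Fin 2) (Fin 2) ℂ) :
    matNorm (star A * A) = matNorm A ^ 2 := by
  unfold matNorm
  rw [map_mul, map_star, sq]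
  exact CStarRing.norm_star_mul_self (E := EuclideanSpace ℂ (Fin 2) →L[ℂ] EuclideanSpace ℂ (Fin 2))

theorem matNorm_smul (c : ℂ) (A : Matrix (Fin 2) (Fin 2) ℂ) :
    matNorm (c • A) = ‖c‖ * matNorm A := by
  unfold matNorm
  rw [map_smul, norm_smul]

theorem norm_sq_mulVec_le (A : Matrix (Fin 2) (Fin 2) ℂ) (v : Fin 2 → ℂ) :
    ‖A.mulVec v 0‖ ^ 2 + ‖A.mulVec v 1‖ ^ 2 ≤ matNorm A ^ 2 * (‖v 0‖ ^ 2 + ‖v 1‖ ^ 2) := by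
  have h := (Matrix.toEuclideanCLM (𝕜 := ℂ) A).le_opNorm (WithLp.toLp 2 v)
  have h2 := pow_le_pow_left₀ (norm_nonneg _) h 2
  rw [mul_pow, EuclideanSpace.norm_sq_eq, EuclideanSpace.norm_sq_eq] at h2
  simpa [Fin.sum_univ_two, matNorm] using h2

theorem norm_entry_le (A : Matrix (Fin 2) (Fin 2) ℂ) (i j : Fin 2) : ‖A i j‖ ≤ matNorm A := by
  have h := norm_sq_mulVec_le A (Pi.single j 1)
  have h1 : ‖(Pi.single j 1 : Fin 2 → ℂ) 0‖ ^ 2 + ‖(Pi.single j 1 : Fin 2 → ℂ) 1‖ ^ 2 = 1 := by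
    fin_cases j <;> simp
  rw [h1, mul_one, Matrix.mulVec_single_one] at h
  have h0 : 0 ≤ matNorm A := norm_nonneg _
  refine le_of_sq_le_sq ?_ h0
  refine le_trans ?_ h
  fin_cases i
  · simp [Matrix.col]
  · simp [Matrix.col]

/-- Each column has norm at most ‖A‖, and 1 = |ad - bc| is at most half the sum of the squares of
the entries, hence at most ‖A‖². -/
theorem one_le_matNorm (A : SL(2, ℂ)) : 1 ≤ matNorm A.1 := by
  by_contra! hlt
  have h0 : 0 ≤ matNorm A.1 := norm_nonneg _
  have hdet : A.1 0 0 * A.1 1 1 - A.1 0 1 * A.1 1 0 = 1 := by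
    rw [← Matrix.det_fin_two]; exact A.2
  have hn : (1 : ℝ) ≤ ‖A.1 0 0‖ * ‖A.1 1 1‖ + ‖A.1 0 1‖ * ‖A.1 1 0‖ := by
    calc (1 : ℝ) = ‖A.1 0 0 * A.1 1 1 - A.1 0 1 * A.1 1 0‖ := by rw [hdet]; simp
      _ ≤ _ := by
        refine (norm_sub_le _ _).trans ?_
        rw [norm_mul, norm_mul]
  have c0 := norm_sq_mulVec_le A.1 ![1, 0]
  have c1 := norm_sq_mulVec_le A.1 ![0, 1]
  simp [Matrix.mulVec, dotProduct, Fin.sum_univ_two] at c0 c1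
  nlinarith [sq_nonneg (‖A.1 0 0‖ - ‖A.1 1 1‖), sq_nonneg (‖A.1 0 1‖ - ‖A.1 1 0‖)]

theorem one_le_opNorm (g : PSL(2, ℂ)) : 1 ≤ opNorm g := by
  obtain ⟨A, rfl⟩ := isOpenQuotientMap_toPSL.surjective g
  exact one_le_matNorm A

theorem opNorm_mul_le (g g' : PSL(2, ℂ)) : opNorm (g * g') ≤ opNorm g * opNorm g' := by
  obtain ⟨A, rfl⟩ := isOpenQuotientMap_toPSL.surjective g
  obtain ⟨B, rfl⟩ := isOpenQuotientMap_toPSL.surjective g'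
  exact matNorm_mul_le A.1 B.1


/-! ### Möbius transformations in the affine coordinate -/

/-- The numerator `a z + b`. -/
def mnum (A : SL(2, ℂ)) (z : ℂ) : ℂ := A.1 0 0 * z + A.1 0 1

/-- The denominator `c z + d`. -/
def mden (A : SL(2, ℂ)) (z : ℂ) : ℂ := A.1 1 0 * z + A.1 1 1

/-- The Möbius transformation `z ↦ (a z + b) / (c z + d)`. -/
def mobSL (A : SL(2, ℂ)) (z : ℂ) : ℂ := mnum A z / mden A z

theorem SL_det (A : SL(2, ℂ)) : A.1 0 0 * A.1 1 1 - A.1 0 1 * A.1 1 0 = 1 := by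
  rw [← Matrix.det_fin_two]; exact A.2

theorem SL_mul_entry (A B : SL(2, ℂ)) (i j : Fin 2) :
    (A * B).1 i j = A.1 i 0 * B.1 0 j + A.1 i 1 * B.1 1 j := by
  rw [Matrix.SpecialLinearGroup.coe_mul, Matrix.mul_apply, Fin.sum_univ_two]

theorem mulVec_chartVec_zero (A : SL(2, ℂ)) (z : ℂ) :
    A.1.mulVec (chartVec 0 z) = ![mnum A z, mden A z] := by
  ext j
  fin_cases j <;> simp [chartVec, mnum, mden, Matrix.mulVec, dotProduct, Fin.sum_univ_two]

theorem toP1_zero_mk (z : ℂ) : chart 0 z = toP1 ⟨chartVec 0 z, chartVec_ne_zero 0 z⟩ := rfl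

theorem smul_chart_zero (A : SL(2, ℂ)) {z : ℂ} (hz : mden A z ≠ 0) :
    toPSL A • chart 0 z = chart 0 (mobSL A z) := by
  rw [toP1_zero_mk, toP1_zero_mk, toPSL_smul_toP1 _ _ (SL_mulVec_ne_zero A (chartVec_ne_zero 0 z)),
    toP1_eq_iff]
  simp only [mulVec_chartVec_zero]
  simp [chartVec, mobSL]
  field_simp

/-- The representative `i (0 1; 1 0)` of the exchange of the two affine coordinates. -/
def swapSL : SL(2, ℂ) := ⟨!![0, Complex.I; Complex.I, 0], by simp [Matrix.det_fin_two]⟩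

theorem swapSL_entry : swapSL.1 0 0 = 0 ∧ swapSL.1 0 1 = Complex.I ∧ swapSL.1 1 0 = Complex.I ∧
    swapSL.1 1 1 = 0 := ⟨rfl, rfl, rfl, rfl⟩

theorem swapSL_smul_chart (z : ℂ) : toPSL swapSL • chart 0 z = chart 1 z := by
  rw [toP1_zero_mk, toPSL_smul_toP1 _ _ (SL_mulVec_ne_zero swapSL (chartVec_ne_zero 0 z))]
  have : chart 1 z = toP1 ⟨chartVec 1 z, chartVec_ne_zero 1 z⟩ := rfl
  rw [this, toP1_eq_iff]
  simp only [mulVec_chartVec_zero]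
  simp [chartVec, mnum, mden, swapSL]

/-- The square in `SL(2, ℂ)` is -1, so this holds only modulo the center. -/
theorem swapSL_mul_self : toPSL swapSL * toPSL swapSL = 1 := by
  rw [← toPSL_mul]
  refine (QuotientGroup.eq_one_iff _).2 ?_
  rw [Matrix.SpecialLinearGroup.mem_center_iff]
  refine ⟨-1, by simp, ?_⟩
  ext i j
  have h := SL_mul_entry swapSL swapSL i j
  obtain ⟨h0, h1, h2, h3⟩ := swapSL_entry
  fin_cases i <;> fin_cases j <;> (simp [h0, h1, h2, h3] at h ⊢; exact h.symm)

theorem swapSL_smul_chart_one (z : ℂ) : toPSL swapSL • chart 1 z = chart 0 z := by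
  rw [← swapSL_smul_chart, smul_smul, swapSL_mul_self, one_smul]

theorem mnum_swap_mul (A : SL(2, ℂ)) (z : ℂ) :
    mnum (swapSL * A) z = Complex.I * mden A z ∧ mden (swapSL * A) z = Complex.I * mnum A z := by
  obtain ⟨h0, h1, h2, h3⟩ := swapSL_entry
  simp only [mnum, mden, SL_mul_entry, h0, h1, h2, h3]
  constructor <;> ring

theorem mnum_mul (A B : SL(2, ℂ)) (z : ℂ) :
    mnum (A * B) z = A.1 0 0 * mnum B z + A.1 0 1 * mden B z ∧
    mden (A * B) z = A.1 1 0 * mnum B z + A.1 1 1 * mden B z := by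
  simp only [mnum, mden, SL_mul_entry]
  constructor <;> ring

theorem mden_mul (A B : SL(2, ℂ)) {z : ℂ} (hz : mden B z ≠ 0) :
    mden (A * B) z = mden A (mobSL B z) * mden B z := by
  rw [(mnum_mul A B z).2, mden.eq_def A, mobSL]
  field_simp

theorem mobSL_mul (A B : SL(2, ℂ)) {z : ℂ} (hz : mden B z ≠ 0) :
    mobSL (A * B) z = mobSL A (mobSL B z) := by
  have h : mnum (A * B) z = mnum A (mobSL B z) * mden B z := by
    rw [(mnum_mul A B z).1, mnum.eq_def A, mobSL]
    field_simp
  rw [mobSL, h, mden_mul A B hz, mul_div_mul_right _ _ hz]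
  rfl

theorem mden_one (z : ℂ) : mden 1 z = 1 := by simp [mden]
theorem mobSL_one (z : ℂ) : mobSL 1 z = z := by simp [mobSL, mden, mnum]

theorem mden_inv_mobSL (A : SL(2, ℂ)) {z : ℂ} (hz : mden A z ≠ 0) :
    mden A⁻¹ (mobSL A z) * mden A z = 1 := by
  rw [← mden_mul _ _ hz, inv_mul_cancel, mden_one]

theorem mden_inv_mobSL_ne (A : SL(2, ℂ)) {z : ℂ} (hz : mden A z ≠ 0) :
    mden A⁻¹ (mobSL A z) ≠ 0 := left_ne_zero_of_mul_eq_one (mden_inv_mobSL A hz)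

theorem mobSL_inv_mobSL (A : SL(2, ℂ)) {z : ℂ} (hz : mden A z ≠ 0) :
    mobSL A⁻¹ (mobSL A z) = z := by
  rw [← mobSL_mul _ _ hz, inv_mul_cancel, mobSL_one]

theorem hasDerivAt_mobSL (A : SL(2, ℂ)) {z : ℂ} (hz : mden A z ≠ 0) :
    HasDerivAt (mobSL A) ((mden A z ^ 2)⁻¹) z := by
  have h1 : HasDerivAt (fun z => A.1 0 0 * z + A.1 0 1) (A.1 0 0) z := by
    simpa using ((hasDerivAt_id z).const_mul (A.1 0 0)).add_const (A.1 0 1)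
  have h2 : HasDerivAt (fun z => A.1 1 0 * z + A.1 1 1) (A.1 1 0) z := by
    simpa using ((hasDerivAt_id z).const_mul (A.1 1 0)).add_const (A.1 1 1)
  refine (h1.div h2 hz).congr_deriv ?_
  symm
  rw [inv_eq_one_div]
  congr 1
  linear_combination -(SL_det A)

theorem continuous_mden (A : SL(2, ℂ)) : Continuous (mden A) := by unfold mden; fun_prop
theorem continuous_mnum (A : SL(2, ℂ)) : Continuous (mnum A) := by unfold mnum; fun_prop

theorem isOpen_mden (A : SL(2, ℂ)) : IsOpen {z | mden A z ≠ 0} :=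
  isOpen_ne_fun (continuous_mden A) continuous_const

theorem finite_mden_eq_zero (A : SL(2, ℂ)) : {z | mden A z = 0}.Finite := by
  refine Set.Subsingleton.finite fun z hz w hw => ?_
  simp only [mem_ofPred_eq, mden] at hz hw
  have h : A.1 1 0 ≠ 0 := by
    intro h
    have := SL_det A
    simp only [h, zero_mul, zero_add] at hz
    simp [h, hz] at this
  exact mul_left_cancel₀ h (by linear_combination hz - hw)

theorem ae_mden (A : SL(2, ℂ)) : ∀ᵐ z : ℂ, mden A z ≠ 0 :=
  measure_eq_zero_iff_ae_notMem.1 ((finite_mden_eq_zero A).measure_zero volume)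

theorem measurable_mobSL (A : SL(2, ℂ)) : Measurable (mobSL A) :=
  (continuous_mnum A).measurable.div (continuous_mden A).measurable

theorem image_mobSL (A : SL(2, ℂ)) : mobSL A '' {z | mden A z ≠ 0} = {w | mden A⁻¹ w ≠ 0} := by
  ext w
  constructor
  · rintro ⟨z, hz, rfl⟩
    exact mden_inv_mobSL_ne A hz
  · intro hw
    refine ⟨mobSL A⁻¹ w, ?_, ?_⟩
    · simpa using mden_inv_mobSL_ne A⁻¹ hw
    · simpa using mobSL_inv_mobSL A⁻¹ hw

theorem injOn_mobSL (A : SL(2, ℂ)) : InjOn (mobSL A) {z | mden A z ≠ 0} := by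
  intro z hz w hw h
  rw [← mobSL_inv_mobSL A hz, h, mobSL_inv_mobSL A hw]

theorem det_smulRight_complex (c : ℂ) :
    ((ContinuousLinearMap.toSpanSingleton ℂ c).restrictScalars ℝ : ℂ →L[ℝ] ℂ).det = ‖c‖ ^ 2 := by
  have : ((ContinuousLinearMap.toSpanSingleton ℂ c).restrictScalars ℝ : ℂ →L[ℝ] ℂ).det =
      LinearMap.det (Algebra.lmul ℝ ℂ c : ℂ →ₗ[ℝ] ℂ) := by
    rw [ContinuousLinearMap.det]
    congr 1
    ext <;> simp [mul_comm]
  rw [this, ← Algebra.norm_apply, Algebra.norm_complex_apply, Complex.normSq_eq_norm_sq]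

/-- Change of variables for a Möbius transformation. -/
theorem lintegral_mobSL (A : SL(2, ℂ)) (f : ℂ → ℝ≥0∞) :
    ∫⁻ z, ENNReal.ofReal (‖mden A z‖ ^ 4)⁻¹ * f (mobSL A z) = ∫⁻ w, f w := by
  have hU := isOpen_mden A
  have h := lintegral_image_eq_lintegral_abs_det_fderiv_mul volume hU.measurableSet
    (f := mobSL A) (f' := fun z =>
      (ContinuousLinearMap.toSpanSingleton ℂ ((mden A z ^ 2)⁻¹)).restrictScalars ℝ)
    (fun z hz => by
      have := (hasDerivAt_mobSL A hz).hasFDerivAt.restrictScalars ℝ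
      exact this.hasFDerivWithinAt) (injOn_mobSL A) f
  rw [image_mobSL] at h
  have hc (B : SL(2, ℂ)) : ({z | mden B z ≠ 0} : Set ℂ) =ᵐ[volume] univ :=
    eventuallyEq_univ.2 (ae_mden B)
  rw [setLIntegral_congr (hc _), setLIntegral_congr (hc _), Measure.restrict_univ] at h
  rw [h]
  refine lintegral_congr fun z => ?_
  congr 2
  rw [det_smulRight_complex]
  simp [norm_pow, norm_inv, ← pow_mul]

theorem map_mobSL (A : SL(2, ℂ)) :
    (volume.withDensity fun z => ENNReal.ofReal (‖mden A z‖ ^ 4)⁻¹).map (mobSL A) = volume := by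
  have hm : Measurable fun z => ENNReal.ofReal (‖mden A z‖ ^ 4)⁻¹ := by
    have := (continuous_mden A).measurable
    fun_prop
  ext s hs
  rw [Measure.map_apply (measurable_mobSL A) hs,
    withDensity_apply _ (measurable_mobSL A hs), ← lintegral_indicator (measurable_mobSL A hs)]
  have := lintegral_mobSL A (s.indicator 1)
  rw [lintegral_indicator_one hs] at this
  rw [← this]
  refine lintegral_congr fun z => ?_
  by_cases h : mobSL A z ∈ s <;> simp [indicator, h]

theorem ae_mobSL (A : SL(2, ℂ)) {p : ℂ → Prop} (h : ∀ᵐ w, p w) : ∀ᵐ z, p (mobSL A z) := by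
  have hm : Measurable fun z => ENNReal.ofReal (‖mden A z‖ ^ 4)⁻¹ := by
    have := (continuous_mden A).measurable
    fun_prop
  rw [← map_mobSL A] at h
  have h1 := (ae_withDensity_iff hm).1 (ae_of_ae_map (measurable_mobSL A).aemeasurable h)
  filter_upwards [h1, ae_mden A] with z hz hz'
  refine hz (ne_of_gt (ENNReal.ofReal_pos.2 ?_))
  positivity

theorem integral_mobSL {E : Type*} [NormedAddCommGroup E] [NormedSpace ℝ E] (A : SL(2, ℂ))
    (f : ℂ → E) : ∫ z, (‖mden A z‖ ^ 4)⁻¹ • f (mobSL A z) = ∫ w, f w := by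
  have hU := isOpen_mden A
  have h := integral_image_eq_integral_abs_det_fderiv_smul volume hU.measurableSet
    (f := mobSL A) (f' := fun z =>
      (ContinuousLinearMap.toSpanSingleton ℂ ((mden A z ^ 2)⁻¹)).restrictScalars ℝ)
    (fun z hz => by
      have := (hasDerivAt_mobSL A hz).hasFDerivAt.restrictScalars ℝ
      exact this.hasFDerivWithinAt) (injOn_mobSL A) f
  rw [image_mobSL] at h
  have hc (B : SL(2, ℂ)) : ({z | mden B z ≠ 0} : Set ℂ) =ᵐ[volume] univ :=
    eventuallyEq_univ.2 (ae_mden B)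
  rw [setIntegral_congr_set (hc _), setIntegral_congr_set (hc _), Measure.restrict_univ] at h
  rw [h]
  refine integral_congr_ae (.of_forall fun z => ?_)
  simp only
  rw [det_smulRight_complex]
  simp [norm_pow, norm_inv, ← pow_mul]

/-! ### Möbius transformations of classes -/

/-- The Möbius transformation of a class in `PSL(2, ℂ)`. -/
def mob (g : PSL(2, ℂ)) : ℂ → ℂ := mobSL (Quotient.out g)

/-- The derivative `1 / (c z + d) ^ 2` of a Möbius transformation. -/
def mobDeriv (g : PSL(2, ℂ)) (z : ℂ) : ℂ := (mden (Quotient.out g) z ^ 2)⁻¹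

theorem exists_toPSL_eq_iff {A B : SL(2, ℂ)} (h : toPSL A = toPSL B) : ∃ r : ℂ, r ^ 2 = 1 ∧
    A.1 = r • B.1 := by
  have h : B⁻¹ * A ∈ Subgroup.center SL(2, ℂ) := QuotientGroup.eq.1 h.symm
  obtain ⟨r, hr, hrc⟩ := Matrix.SpecialLinearGroup.mem_center_iff.1 h
  refine ⟨r, by simpa using hr, ?_⟩
  have : A = B * (B⁻¹ * A) := by group
  rw [this, Matrix.SpecialLinearGroup.coe_mul, ← hrc]
  ext i j
  fin_cases i <;> fin_cases j <;> simp [mul_comm]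

theorem toPSL_out (g : PSL(2, ℂ)) : toPSL (Quotient.out g) = g := Quotient.out_eq g

theorem mob_toPSL (A : SL(2, ℂ)) : mob (toPSL A) = mobSL A := by
  obtain ⟨r, hr, h⟩ := exists_toPSL_eq_iff (toPSL_out (toPSL A))
  have hr0 : r ≠ 0 := by rintro rfl; simp at hr
  ext z
  simp only [mob, mobSL, mnum, mden, h, Matrix.smul_apply, smul_eq_mul, mul_assoc, ← mul_add]
  rw [mul_div_mul_left _ _ hr0]

theorem mobDeriv_toPSL (A : SL(2, ℂ)) (z : ℂ) : mobDeriv (toPSL A) z = (mden A z ^ 2)⁻¹ := by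
  obtain ⟨r, hr, h⟩ := exists_toPSL_eq_iff (toPSL_out (toPSL A))
  simp only [mobDeriv, mden, h, Matrix.smul_apply, smul_eq_mul, mul_assoc, ← mul_add]
  rw [mul_pow, hr, one_mul]

/-- `Quotient.out` carries no measurability. But (cz + d)² is insensitive to the sign of the
representative, so it descends to a continuous function; the inverse is taken only afterwards. -/
theorem measurable_mobDeriv [MeasurableSpace PSL(2, ℂ)] [BorelSpace PSL(2, ℂ)] :
    Measurable fun p : PSL(2, ℂ) × ℂ => mobDeriv p.1 p.2 := by
  have hq := (isOpenQuotientMap_toPSL.prodMap (IsOpenQuotientMap.id (X := ℂ))).isQuotientMap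
  have hc : Continuous fun p : PSL(2, ℂ) × ℂ => (mobDeriv p.1 p.2)⁻¹ := by
    rw [hq.continuous_iff]
    have : (fun p : PSL(2, ℂ) × ℂ => (mobDeriv p.1 p.2)⁻¹) ∘ Prod.map toPSL id =
        fun p => mden p.1 p.2 ^ 2 := by
      ext p
      simp [mobDeriv_toPSL]
    rw [this]
    have h := continuous_SL_entry
    unfold mden
    exact ((((h 1 0).comp continuous_fst).mul continuous_snd).add
      ((h 1 1).comp continuous_fst)).pow 2
  have h := hc.measurable.inv
  have e : (fun p : PSL(2, ℂ) × ℂ => (mobDeriv p.1 p.2)⁻¹)⁻¹ = fun p => mobDeriv p.1 p.2 := by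
    ext p; simp
  rwa [e] at h

theorem measurable_mob [MeasurableSpace PSL(2, ℂ)] [BorelSpace PSL(2, ℂ)] :
    Measurable fun p : PSL(2, ℂ) × ℂ => mob p.1 p.2 := by
  have hq := (isOpenQuotientMap_toPSL.prodMap (IsOpenQuotientMap.id (X := ℂ))).isQuotientMap
  -- The product (az + b)(cz + d) ignores the sign of the representative, unlike its factors.
  -- Multiplied by 1 / (cz + d)² it recovers the Möbius map, also at the pole, where both sides are
  -- 0 by convention.
  have hc : Continuous fun p : PSL(2, ℂ) × ℂ =>
      mnum (Quotient.out p.1) p.2 * mden (Quotient.out p.1) p.2 := by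
    rw [hq.continuous_iff]
    have : (fun p : PSL(2, ℂ) × ℂ => mnum (Quotient.out p.1) p.2 * mden (Quotient.out p.1) p.2) ∘
        Prod.map toPSL id = fun p => mnum p.1 p.2 * mden p.1 p.2 := by
      ext p
      obtain ⟨r, hr, h⟩ := exists_toPSL_eq_iff (toPSL_out (toPSL p.1))
      simp only [Function.comp_apply, Prod.map_fst, Prod.map_snd, id_eq, mnum, mden, h,
        Matrix.smul_apply, smul_eq_mul]
      linear_combination ((p.1.1 0 0 * p.2 + p.1.1 0 1) * (p.1.1 1 0 * p.2 + p.1.1 1 1)) * hr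
    rw [this]
    have h := continuous_SL_entry
    unfold mnum mden
    exact ((((h 0 0).comp continuous_fst).mul continuous_snd).add
      ((h 0 1).comp continuous_fst)).mul ((((h 1 0).comp continuous_fst).mul continuous_snd).add
      ((h 1 1).comp continuous_fst))
  have h := hc.measurable.mul measurable_mobDeriv
  convert! h using 1
  ext p
  simp only [mob, mobDeriv, mobSL, Pi.mul_apply]
  by_cases h : mden (Quotient.out p.1) p.2 = 0
  · simp [h]
  · field_simp

theorem measurable_mob_const (g : PSL(2, ℂ)) : Measurable (mob g) := measurable_mobSL _

theorem measurable_mobDeriv_const (g : PSL(2, ℂ)) : Measurable (mobDeriv g) :=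
  ((continuous_mden _).measurable.pow_const 2).inv

theorem ae_mobDeriv_ne_zero (g : PSL(2, ℂ)) : ∀ᵐ z, mobDeriv g z ≠ 0 := by
  filter_upwards [ae_mden (Quotient.out g)] with z hz
  simpa [mobDeriv] using hz

theorem smul_chart_mob (g : PSL(2, ℂ)) {z : ℂ} (hz : mobDeriv g z ≠ 0) :
    g • chart 0 z = chart 0 (mob g z) := by
  conv_lhs => rw [← toPSL_out g]
  exact smul_chart_zero _ (by simpa [mobDeriv] using hz)

theorem mob_mul (g g' : PSL(2, ℂ)) {z : ℂ} (hz : mobDeriv g' z ≠ 0) :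
    mob (g * g') z = mob g (mob g' z) := by
  conv_lhs => rw [← toPSL_out g, ← toPSL_out g', ← toPSL_mul, mob_toPSL]
  exact mobSL_mul _ _ (by simpa [mobDeriv] using hz)

theorem mobDeriv_mul (g g' : PSL(2, ℂ)) {z : ℂ} (hz : mobDeriv g' z ≠ 0) :
    mobDeriv (g * g') z = mobDeriv g (mob g' z) * mobDeriv g' z := by
  conv_lhs => rw [← toPSL_out g, ← toPSL_out g', ← toPSL_mul, mobDeriv_toPSL,
    mden_mul _ _ (by simpa [mobDeriv] using hz : mden (Quotient.out g') z ≠ 0)]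
  rw [mul_pow, mul_inv]; rfl

theorem ae_mob (g : PSL(2, ℂ)) {p : ℂ → Prop} (h : ∀ᵐ w, p w) : ∀ᵐ z, p (mob g z) := ae_mobSL _ h

theorem lintegral_mob (g : PSL(2, ℂ)) (f : ℂ → ℝ≥0∞) :
    ∫⁻ z, ‖mobDeriv g z‖ₑ ^ 2 * f (mob g z) = ∫⁻ w, f w := by
  rw [← lintegral_mobSL (Quotient.out g) f]
  refine lintegral_congr fun z => ?_
  congr 1
  rw [mobDeriv, ← ofReal_norm, ← ENNReal.ofReal_pow (norm_nonneg _)]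
  simp [← pow_mul]

theorem integral_mob {E : Type*} [NormedAddCommGroup E] [NormedSpace ℝ E] (g : PSL(2, ℂ))
    (f : ℂ → E) : ∫ z, ‖mobDeriv g z‖ ^ 2 • f (mob g z) = ∫ w, f w := by
  rw [← integral_mobSL (Quotient.out g) f]
  refine integral_congr_ae (.of_forall fun z => ?_)
  simp only
  congr 1
  simp [mobDeriv, ← pow_mul]


/-! ### Pull-back of `(1, 0)`-forms -/

/-- The coefficient of the pull-back of the form `φ dz` by a Möbius transformation. -/
def pullBack (g : PSL(2, ℂ)) (φ : ℂ → ℂ) (z : ℂ) : ℂ := φ (mob g z) * mobDeriv g z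

theorem pullBack_mul (g g' : PSL(2, ℂ)) (φ : ℂ → ℂ) {z : ℂ} (hz : mobDeriv g' z ≠ 0) :
    pullBack (g * g') φ z = pullBack g' (pullBack g φ) z := by
  simp only [pullBack, mob_mul g g' hz, mobDeriv_mul g g' hz, mul_assoc]

/-- Conformal invariance: |g'|² is at once the factor produced by the form and the Jacobian of the
change of variables. -/
theorem lintegral_pullBack (g : PSL(2, ℂ)) (φ : ℂ → ℂ) :
    ∫⁻ z, ‖pullBack g φ z‖ₑ ^ 2 = ∫⁻ z, ‖φ z‖ₑ ^ 2 := by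
  rw [← lintegral_mob g fun z => ‖φ z‖ₑ ^ 2]
  refine lintegral_congr fun z => ?_
  rw [pullBack, enorm_mul, mul_pow, mul_comm]

theorem quasiMeasurePreserving_mob (g : PSL(2, ℂ)) :
    Measure.QuasiMeasurePreserving (mob g) volume volume := by
  refine ⟨measurable_mob_const g, ?_⟩
  refine Measure.AbsolutelyContinuous.mk fun s hs h0 => ?_
  rw [Measure.map_apply (measurable_mob_const g) hs]
  exact measure_eq_zero_iff_ae_notMem.2 (ae_mob g (measure_eq_zero_iff_ae_notMem.1 h0))

theorem memLp_two_iff {α : Type*} [MeasurableSpace α] {m : Measure α} {φ : α → ℂ}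
    (h : AEStronglyMeasurable φ m) : MemLp φ 2 m ↔ ∫⁻ z, ‖φ z‖ₑ ^ 2 ∂m < ⊤ := by
  rw [MemLp, and_iff_right h, eLpNorm_lt_top_iff_lintegral_rpow_enorm_lt_top (by simp) (by simp)]
  simp

theorem memLp_pullBack (g : PSL(2, ℂ)) {φ : ℂ → ℂ} (h : MemLp φ 2 volume) :
    MemLp (pullBack g φ) 2 volume := by
  have hm : AEStronglyMeasurable (pullBack g φ) volume :=
    (h.1.comp_quasiMeasurePreserving (quasiMeasurePreserving_mob g)).mul
      (measurable_mobDeriv_const g).aestronglyMeasurable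
  rw [memLp_two_iff hm, lintegral_pullBack]
  exact (memLp_two_iff h.1).1 h

/-! ### Change of variables in weak derivatives -/

/-- The complex linear part of a real linear map. -/
def linPart (L : ℂ →L[ℝ] ℂ) : ℂ := (L 1 - Complex.I * L Complex.I) / 2

theorem wirtinger_eq (φ : ℂ → ℂ) (z : ℂ) : wirtinger φ z = linPart (fderiv ℝ φ z) := rfl

theorem real_linear_apply (L : ℂ →L[ℝ] ℂ) (c : ℂ) : L c = c.re * L 1 + c.im * L Complex.I := by
  have : c = c.re • (1 : ℂ) + c.im • Complex.I := by
    simp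
  conv_lhs => rw [this, map_add, map_smul, map_smul]
  simp

theorem linPart_comp_mul (L : ℂ →L[ℝ] ℂ) (c : ℂ) :
    (L c - Complex.I * L (Complex.I * c)) / 2 = linPart L * c := by
  rw [real_linear_apply L c, real_linear_apply L (Complex.I * c), linPart]
  have h1 : (Complex.I * c).re = -c.im := by simp
  have h2 : (Complex.I * c).im = c.re := by simp
  rw [h1, h2]
  nth_rewrite 5 [← Complex.re_add_im c]
  push_cast
  linear_combination (c.im * L Complex.I / 2) * Complex.I_sq

/-- The conjugate of a holomorphic function is killed by ∂, so the product rule leaves a single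
term. -/
theorem wirtinger_comp_mul_conj {φ G d : ℂ → ℂ} {w G' d' : ℂ} (hφ : DifferentiableAt ℝ φ (G w))
    (hG : HasDerivAt G G' w) (hd : HasDerivAt d d' w) :
    wirtinger (fun w => φ (G w) * (starRingEnd ℂ) (d w)) w =
      wirtinger φ (G w) * G' * (starRingEnd ℂ) (d w) := by
  have h1 := hφ.hasFDerivAt.comp w (hG.hasFDerivAt.restrictScalars ℝ)
  have h2 : HasFDerivAt (fun w => (starRingEnd ℂ) (d w)) _ w :=
    (Complex.conjCLE : ℂ →L[ℝ] ℂ).hasFDerivAt.comp w (hd.hasFDerivAt.restrictScalars ℝ)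
  have h3 : HasFDerivAt (fun w => φ (G w) * (starRingEnd ℂ) (d w)) _ w := h1.mul h2
  rw [wirtinger, h3.fderiv]
  have e := linPart_comp_mul (fderiv ℝ φ (G w)) G'
  rw [wirtinger_eq]
  simp
  linear_combination (starRingEnd ℂ (d w)) * e + (φ (G w) * (starRingEnd ℂ d') / 2) * Complex.I_sq

theorem wirtinger_zero_of_eventually {φ : ℂ → ℂ} {z : ℂ} (h : φ =ᶠ[𝓝 z] 0) : wirtinger φ z = 0 := by
  rw [wirtinger, h.fderiv_eq]
  simp

/-- The test function is transported by the inverse map G with an extra factor conj(G'). This factor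
is antiholomorphic, so it passes through ∂ and completes G' to |G'|², the Jacobian needed to change
variables back. -/
theorem hasWeakWirtinger_change (A : SL(2, ℂ)) {u : ℂ → ℝ} {g : ℂ → ℂ} (h : HasWeakWirtinger u g)
    {φ : ℂ → ℂ} (hφ : ContDiff ℝ ∞ φ) (hc : HasCompactSupport φ)
    (hs : tsupport φ ⊆ {z | mden A z ≠ 0}) :
    ∫ z, (u (mobSL A z) : ℂ) * wirtinger φ z = -∫ z, g (mobSL A z) * (mden A z ^ 2)⁻¹ * φ z := by
  set ψ : ℂ → ℂ := fun w => φ (mobSL A⁻¹ w) * (starRingEnd ℂ) ((mden A⁻¹ w ^ 2)⁻¹) with hψ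
  have hF : ContinuousOn (mobSL A) (tsupport φ) := fun z hz =>
    (hasDerivAt_mobSL A (hs hz)).continuousAt.continuousWithinAt
  have hK : IsCompact (mobSL A '' tsupport φ) := hc.isCompact.image_of_continuousOn hF
  have hKV : mobSL A '' tsupport φ ⊆ {w | mden A⁻¹ w ≠ 0} := by
    rw [← image_mobSL]; exact image_mono hs
  -- At the pole of the inverse map, 0⁻¹ = 0 makes ψ vanish. Since the image of the support is
  -- compact and avoids that pole, ψ is smooth on the whole plane.
  have hzero : ∀ w, w ∉ mobSL A '' tsupport φ → ψ w = 0 := by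
    intro w hw
    by_cases hd : mden A⁻¹ w = 0
    · simp [hψ, hd]
    · have : mobSL A⁻¹ w ∉ tsupport φ := fun hmem => hw ⟨_, hmem, by
        simpa using mobSL_inv_mobSL A⁻¹ hd⟩
      simp [hψ, image_eq_zero_of_notMem_tsupport this]
  have hzero' : ∀ w, w ∉ mobSL A '' tsupport φ → ψ =ᶠ[𝓝 w] 0 := fun w hw => by
    filter_upwards [hK.isClosed.isOpen_compl.mem_nhds hw] with w' hw' using hzero w' hw'
  have hG : ∀ w, mden A⁻¹ w ≠ 0 → HasDerivAt (mobSL A⁻¹) ((mden A⁻¹ w ^ 2)⁻¹) w :=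
    fun w hw => hasDerivAt_mobSL _ hw
  have hD : ∀ w, mden A⁻¹ w ≠ 0 → ContDiffAt ℂ ∞ (fun w => (mden A⁻¹ w ^ 2)⁻¹) w := by
    intro w hw
    refine ContDiffAt.inv ?_ (pow_ne_zero 2 hw)
    unfold mden
    fun_prop
  have hGs : ∀ w, mden A⁻¹ w ≠ 0 → ContDiffAt ℂ ∞ (mobSL A⁻¹) w := by
    intro w hw
    unfold mobSL
    refine ContDiffAt.div ?_ ?_ hw
    · change ContDiffAt ℂ ∞ (fun z => A⁻¹.1 0 0 * z + A⁻¹.1 0 1) w; fun_prop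
    · change ContDiffAt ℂ ∞ (fun z => A⁻¹.1 1 0 * z + A⁻¹.1 1 1) w; fun_prop
  have hψs : ContDiff ℝ ∞ ψ := by
    rw [contDiff_iff_contDiffAt]
    intro w
    by_cases hd : mden A⁻¹ w = 0
    · exact contDiffAt_const.congr_of_eventuallyEq (hzero' w fun hw => hKV hw hd)
    · exact (hφ.contDiffAt.comp w ((hGs w hd).restrict_scalars ℝ)).mul
        ((Complex.conjCLE : ℂ →L[ℝ] ℂ).contDiff.contDiffAt.comp w ((hD w hd).restrict_scalars ℝ))
  have hψc : HasCompactSupport ψ := HasCompactSupport.intro hK hzero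
  have hw : ∀ w, wirtinger ψ w = ((‖mden A⁻¹ w‖ ^ 4)⁻¹ : ℝ) • wirtinger φ (mobSL A⁻¹ w) := by
    intro w
    by_cases hd : mden A⁻¹ w = 0
    · rw [wirtinger_zero_of_eventually (hzero' w fun hw => hKV hw hd)]
      simp [hd]
    · rw [hψ, wirtinger_comp_mul_conj (hφ.differentiable (by simp)).differentiableAt (hG w hd)
        ((hD w hd).differentiableAt (by simp)).hasDerivAt, mul_assoc, Complex.mul_conj,
        Complex.normSq_eq_norm_sq, Complex.real_smul, mul_comm]
      simp [← pow_mul]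
  have key := h.2.2 ψ hψs hψc
  rw [← integral_mobSL A⁻¹ (fun z => (u (mobSL A z) : ℂ) * wirtinger φ z),
    ← integral_mobSL A⁻¹ (fun z => g (mobSL A z) * (mden A z ^ 2)⁻¹ * φ z)]
  convert key using 1
  · refine integral_congr_ae ?_
    filter_upwards [ae_mden A⁻¹] with w hd
    have e : mobSL A (mobSL A⁻¹ w) = w := by simpa using mobSL_inv_mobSL A⁻¹ hd
    rw [hw, e]
    simp; ring
  · congr 1
    refine integral_congr_ae ?_
    filter_upwards [ae_mden A⁻¹] with w hd
    have e : mobSL A (mobSL A⁻¹ w) = w := by simpa using mobSL_inv_mobSL A⁻¹ hd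
    have e2 : mden A (mobSL A⁻¹ w) * mden A⁻¹ w = 1 := by simpa using mden_inv_mobSL A⁻¹ hd
    have e3 : mden A (mobSL A⁻¹ w) = (mden A⁻¹ w)⁻¹ := eq_inv_of_mul_eq_one_left e2
    simp only [hψ]
    rw [e, e3]
    have e4 : ((‖mden A⁻¹ w‖ ^ 4 : ℝ) : ℂ) = mden A⁻¹ w ^ 2 * starRingEnd ℂ (mden A⁻¹ w) ^ 2 := by
      rw [← mul_pow, Complex.mul_conj, Complex.normSq_eq_norm_sq]
      push_cast; ring
    have hd' : starRingEnd ℂ (mden A⁻¹ w) ≠ 0 := by simpa using hd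
    rw [Complex.real_smul, Complex.ofReal_inv, e4, map_inv₀, map_pow]
    field_simp

theorem wirtinger_add {φ ψ : ℂ → ℂ} (hφ : ContDiff ℝ ∞ φ) (hψ : ContDiff ℝ ∞ ψ) (z : ℂ) :
    wirtinger (fun z => φ z + ψ z) z = wirtinger φ z + wirtinger ψ z := by
  have h1 := (hφ.differentiable (by simp)).differentiableAt (x := z)
  have h2 := (hψ.differentiable (by simp)).differentiableAt (x := z)
  rw [wirtinger, fderiv_fun_add h1 h2, wirtinger, wirtinger]
  simp; ring

theorem mobDeriv_swap (z : ℂ) : mobDeriv (toPSL swapSL) z ≠ 0 ↔ z ≠ 0 := by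
  obtain ⟨h0, h1, h2, h3⟩ := swapSL_entry
  simp [mobDeriv_toPSL, mden, h2, h3]

theorem chart_one_eq_mob {z : ℂ} (hz : z ≠ 0) : chart 1 z = chart 0 (mob (toPSL swapSL) z) := by
  rw [← smul_chart_mob _ ((mobDeriv_swap z).2 hz), swapSL_smul_chart]

/-- The coefficients of `∂h` in the two affine coordinates determine each other. -/
theorem HasDel.one_eq {h : P1 → ℝ} {g : Fin 2 → ℂ → ℂ} (hd : HasDel h g) :
    g 1 =ᵐ[volume] pullBack (toPSL swapSL) (g 0) := by
  have hL := memLp_pullBack (toPSL swapSL) (hd 0).1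
  have hli := hL.locallyIntegrable (by norm_num)
  have hU : IsOpen {z : ℂ | z ≠ 0} := isOpen_ne
  -- Away from 0 both coefficients are weak derivatives of the same function, as seen by test
  -- functions supported there; the point 0 is negligible.
  have key : ∀ᵐ z : ℂ, z ∈ {z : ℂ | z ≠ 0} → (g 1 - pullBack (toPSL swapSL) (g 0)) z = 0 := by
    refine hU.ae_eq_zero_of_integral_contDiff_smul_eq_zero
      (((hd 1).2.2.1.sub hli).locallyIntegrableOn _) fun φ hφ hc hs => ?_
    have hφ' : ContDiff ℝ ∞ fun z => (φ z : ℂ) := Complex.ofRealCLM.contDiff.comp hφ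
    have hc' : HasCompactSupport fun z => (φ z : ℂ) := hc.comp_left (g := Complex.ofReal) rfl
    have hs' : tsupport (fun z => (φ z : ℂ)) ⊆ {z | mden swapSL z ≠ 0} := by
      have e : tsupport (fun z => (φ z : ℂ)) = tsupport φ := by
        unfold tsupport
        congr 1
        ext z; simp
      rw [e]
      refine hs.trans fun z hz => ?_
      obtain ⟨h0, h1, h2, h3⟩ := swapSL_entry
      simpa [mden, h2, h3] using hz
    have e1 := hasWeakWirtinger_change swapSL (hd 0).2 hφ' hc' hs'
    have e2 := (hd 1).2.2.2 _ hφ' hc'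
    have e3 : ∫ z, (h (chart 0 (mobSL swapSL z)) : ℂ) * wirtinger (fun z => (φ z : ℂ)) z =
        ∫ z, (h (chart 1 z) : ℂ) * wirtinger (fun z => (φ z : ℂ)) z := by
      refine integral_congr_ae ?_
      have hne : ∀ᵐ z : ℂ, z ≠ 0 := by simp [ae_iff]
      filter_upwards [hne] with z hz
      rw [chart_one_eq_mob hz, mob_toPSL]
    have i1 := (hd 1).2.2.1.integrable_smul_left_of_hasCompactSupport hφ.continuous hc
    have i2 := hli.integrable_smul_left_of_hasCompactSupport hφ.continuous hc
    simp only [Pi.sub_apply, smul_sub]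
    rw [integral_sub i1 i2, sub_eq_zero]
    have e4 := neg_injective (e2.symm.trans (e3.symm.trans e1))
    simpa [mul_comm, pullBack, mob_toPSL, mobDeriv_toPSL] using e4
  have hne : ∀ᵐ z : ℂ, z ≠ 0 := by simp [ae_iff]
  filter_upwards [key, hne] with z hz hz0
  exact sub_eq_zero.1 (hz hz0)

/-- A smooth cut-off which isolates the pole of a Möbius transformation from its zero. -/
theorem exists_cutoff (A : SL(2, ℂ)) : ∃ χ : ℂ → ℝ, ContDiff ℝ ∞ χ ∧
    tsupport χ ⊆ {z | mnum A z ≠ 0} ∧ tsupport (fun z => 1 - χ z) ⊆ {z | mden A z ≠ 0} := by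
  by_cases hp : ∃ p, mden A p = 0
  · obtain ⟨p, hp⟩ := hp
    have hn : mnum A p ≠ 0 := by
      intro hn
      have := SL_det A
      rw [mden] at hp
      rw [mnum] at hn
      exact one_ne_zero (α := ℂ) (by linear_combination A.1 0 0 * hp - A.1 1 0 * hn - this)
    have ho : IsOpen {z | mnum A z ≠ 0} := isOpen_ne_fun (continuous_mnum A) continuous_const
    obtain ⟨r, hr, hball⟩ := Metric.isOpen_iff.1 ho p hn
    let f : ContDiffBump p := ⟨r / 4, r / 2, by positivity, by linarith⟩
    refine ⟨f, f.contDiff, ?_, ?_⟩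
    · rw [f.tsupport_eq]
      exact (Metric.closedBall_subset_ball (by simp only [f]; linarith)).trans hball
    · intro z hz hz0
      have hzp : z = p := by
        have hc : A.1 1 0 ≠ 0 := by
          intro h
          have := SL_det A
          rw [mden] at hp
          simp only [h, zero_mul, zero_add] at hp
          simp [h, hp] at this
        rw [mden] at hz0 hp
        exact mul_left_cancel₀ hc (by linear_combination hz0 - hp)
      subst hzp
      rw [tsupport] at hz
      have h0 : Metric.ball z (r / 4) ∈ 𝓝 z := Metric.ball_mem_nhds _ (by positivity)
      obtain ⟨w, hw1, hw2⟩ := mem_closure_iff_nhds.1 hz _ h0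
      apply hw2
      have : f w = 1 := f.one_of_mem_closedBall (Metric.ball_subset_closedBall hw1)
      simp [this]
  · push Not at hp
    exact ⟨fun _ => 0, contDiff_const, by simp [tsupport], fun z _ => hp z⟩

/-- The chain rule for Möbius transformations. -/
theorem HasDel.hasWeakWirtinger_smul {h : P1 → ℝ} {g : Fin 2 → ℂ → ℂ} (hd : HasDel h g)
    (γ : PSL(2, ℂ)) (hli : LocallyIntegrable fun z => h (γ • chart 0 z)) :
    HasWeakWirtinger (fun z => h (γ • chart 0 z)) (pullBack γ (g 0)) := by
  have hL := memLp_pullBack γ (hd 0).1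
  have hli' := hL.locallyIntegrable (by norm_num)
  refine ⟨hli, hli', fun φ hφ hc => ?_⟩
  obtain ⟨A, rfl⟩ := isOpenQuotientMap_toPSL.surjective γ
  obtain ⟨χ, hχ, hχ1, hχ2⟩ := exists_cutoff A
  have hχ' : ContDiff ℝ ∞ fun z => (χ z : ℂ) := Complex.ofRealCLM.contDiff.comp hχ
  -- Splitting of the test function: φ1 is supported where az + b ≠ 0, so that the image is read in
  -- the second coordinate; φ2 is supported away from the pole, so that the first coordinate is
  -- regular. The change of variables applies to each piece.
  set φ1 : ℂ → ℂ := fun z => χ z * φ z with hφ1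
  set φ2 : ℂ → ℂ := fun z => (1 - χ z : ℝ) * φ z with hφ2
  have c1 : ContDiff ℝ ∞ φ1 := hχ'.mul hφ
  have c2 : ContDiff ℝ ∞ φ2 := by
    have : ContDiff ℝ ∞ fun z => ((1 - χ z : ℝ) : ℂ) :=
      Complex.ofRealCLM.contDiff.comp (contDiff_const.sub hχ)
    exact this.mul hφ
  have s1 : HasCompactSupport φ1 := hc.mul_left
  have s2 : HasCompactSupport φ2 := hc.mul_left
  have t1 : tsupport φ1 ⊆ tsupport χ := by
    refine closure_mono fun z hz => ?_
    simp only [hφ1, Function.mem_support, ne_eq, mul_eq_zero, not_or] at hz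
    simpa using hz.1
  have t2 : tsupport φ2 ⊆ tsupport (fun z => 1 - χ z) := by
    refine closure_mono fun z hz => ?_
    simp only [hφ2, Function.mem_support, ne_eq, mul_eq_zero, not_or] at hz
    simpa [-Complex.ofReal_sub] using hz.1
  have hsum : ∀ z, wirtinger φ z = wirtinger φ1 z + wirtinger φ2 z := by
    intro z
    rw [← wirtinger_add c1 c2]
    congr 1
    ext z
    simp [hφ1, hφ2]; ring
  have hsum' : ∀ z, φ z = φ1 z + φ2 z := by
    intro z
    simp [hφ1, hφ2]; ring
  have e2 := hasWeakWirtinger_change A (hd 0).2 c2 s2 (t2.trans hχ2)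
  have e1 := hasWeakWirtinger_change (swapSL * A) (hd 1).2 c1 s1 (t1.trans fun z hz => by
    have := hχ1 hz
    simpa [(mnum_swap_mul A z).2] using this)
  have f2 : ∫ z, (h (toPSL A • chart 0 z) : ℂ) * wirtinger φ2 z =
      -∫ z, pullBack (toPSL A) (g 0) z * φ2 z := by
    simp only [pullBack, mob_toPSL, mobDeriv_toPSL]
    rw [← e2]
    refine integral_congr_ae ?_
    filter_upwards [ae_mden A] with z hz
    rw [smul_chart_zero A hz]
  have f1 : ∫ z, (h (toPSL A • chart 0 z) : ℂ) * wirtinger φ1 z =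
      -∫ z, pullBack (toPSL A) (g 0) z * φ1 z := by
    have a1 : ∫ z, (h (toPSL A • chart 0 z) : ℂ) * wirtinger φ1 z =
        ∫ z, (h (chart 1 (mobSL (swapSL * A) z)) : ℂ) * wirtinger φ1 z := by
      refine integral_congr_ae ?_
      filter_upwards [ae_mden (swapSL * A)] with z hz
      rw [← swapSL_smul_chart, ← smul_chart_zero _ hz, toPSL_mul, smul_smul, ← mul_assoc,
        swapSL_mul_self, one_mul]
    rw [a1, e1]
    congr 1
    refine integral_congr_ae ?_
    have b1 := ae_mob (toPSL (swapSL * A)) hd.one_eq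
    filter_upwards [b1, ae_mobDeriv_ne_zero (toPSL (swapSL * A))] with z hz hz'
    rw [mob_toPSL] at hz
    rw [hz]
    congr 1
    have := pullBack_mul (toPSL swapSL) (toPSL (swapSL * A)) (g 0) hz'
    rw [toPSL_mul, ← mul_assoc, swapSL_mul_self, one_mul] at this
    rw [this, ← toPSL_mul]
    conv_rhs => rw [pullBack, mob_toPSL, mobDeriv_toPSL]
  have i (ψ : ℂ → ℂ) (hψ : ContDiff ℝ ∞ ψ) (hcψ : HasCompactSupport ψ) :
      Integrable fun z => (h (toPSL A • chart 0 z) : ℂ) * wirtinger ψ z := by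
    simpa using hli.integrable_smul_right_of_hasCompactSupport
      (continuous_wirtinger hψ) (hasCompactSupport_wirtinger hcψ)
  have j (ψ : ℂ → ℂ) (hψ : ContDiff ℝ ∞ ψ) (hcψ : HasCompactSupport ψ) :
      Integrable fun z => pullBack (toPSL A) (g 0) z * ψ z := by
    simpa using hli'.integrable_smul_right_of_hasCompactSupport hψ.continuous hcψ
  simp only [hsum, hsum', mul_add]
  rw [integral_add (i _ c1 s1) (i _ c2 s2), integral_add (j _ c1 s1) (j _ c2 s2), f1, f2]
  ring


/-! ### The Fubini-Study measure -/

theorem measurable_fubiniStudyDensity : Measurable fubiniStudyDensity := by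
  unfold fubiniStudyDensity; fun_prop

theorem measurable_chart (i : Fin 2) : Measurable (chart i) := (continuous_chart i).measurable

theorem lintegral_fubiniStudy {F : P1 → ℝ≥0∞} (hF : Measurable F) :
    ∫⁻ x, F x ∂fubiniStudy = ∫⁻ z, fubiniStudyDensity z * F (chart 0 z) := by
  rw [fubiniStudy, lintegral_map hF (measurable_chart 0),
    lintegral_withDensity_eq_lintegral_mul _ measurable_fubiniStudyDensity (g := fun z => F (chart 0 z))
      (hF.comp (measurable_chart 0))]
  rfl

instance : IsProbabilityMeasure fubiniStudy := by
  refine ⟨?_⟩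
  have h1 := lintegral_fubiniStudy (F := fun _ => 1) measurable_const
  rw [lintegral_one] at h1
  rw [h1]
  simp only [mul_one]
  have hint : Integrable fun z : ℂ => (Real.pi * (1 + ‖z‖ ^ 2) ^ 2)⁻¹ := by
    have h := (integrable_one_add_norm (μ := (volume : Measure ℂ)) (r := 4)
      (by rw [Complex.finrank_real_complex]; norm_num)).const_mul (4 : ℝ)
    refine h.mono' (by fun_prop) (.of_forall fun z => ?_)
    have h0 : 0 ≤ ‖z‖ := norm_nonneg z
    rw [Real.norm_of_nonneg (by positivity), Real.rpow_neg (by positivity)]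
    have : ((1 + ‖z‖) ^ (4 : ℝ) : ℝ) = (1 + ‖z‖) ^ (4 : ℕ) := by norm_cast
    rw [this, ← div_eq_mul_inv, inv_eq_one_div, div_le_div_iff₀ (by positivity) (by positivity)]
    have hpi : 1 ≤ Real.pi := by linarith [Real.pi_gt_three]
    have : (1 + ‖z‖) ^ 2 ≤ 2 * (1 + ‖z‖ ^ 2) := by nlinarith [sq_nonneg (1 - ‖z‖)]
    calc 1 * (1 + ‖z‖) ^ 4 = ((1 + ‖z‖) ^ 2) ^ 2 := by ring
      _ ≤ (2 * (1 + ‖z‖ ^ 2)) ^ 2 := by gcongr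
      _ = 4 * (1 * (1 + ‖z‖ ^ 2) ^ 2) := by ring
      _ ≤ 4 * (Real.pi * (1 + ‖z‖ ^ 2) ^ 2) := by gcongr
  have e : ∫⁻ z, fubiniStudyDensity z =
      ENNReal.ofReal (∫ z : ℂ, (Real.pi * (1 + ‖z‖ ^ 2) ^ 2)⁻¹) := by
    rw [ofReal_integral_eq_lintegral_ofReal hint (.of_forall fun z => by positivity)]
    simp [fubiniStudyDensity]
  rw [e, ← Complex.integral_comp_polarCoord_symm]
  have e2 : ∫ p in polarCoord.target, p.1 • (Real.pi * (1 + ‖Complex.polarCoord.symm p‖ ^ 2) ^ 2)⁻¹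
      = ∫ p in Ioi (0 : ℝ) ×ˢ Ioo (-Real.pi) Real.pi,
        (p.1 * (Real.pi * (1 + p.1 ^ 2) ^ 2)⁻¹) * (1 : ℝ) := by
    refine setIntegral_congr_fun polarCoord.open_target.measurableSet fun p hp => ?_
    simp
  rw [e2, Measure.volume_eq_prod, setIntegral_prod_mul (f := fun r : ℝ => r * (Real.pi * (1 + r ^ 2) ^ 2)⁻¹)
    (g := fun _ => (1 : ℝ))]
  have e3 : ∫ r in Ioi (0 : ℝ), r * (Real.pi * (1 + r ^ 2) ^ 2)⁻¹ = 0 - (-(2 * Real.pi)⁻¹) := by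
    have e4 : -(2 * Real.pi)⁻¹ = (fun r : ℝ => -(2 * Real.pi * (1 + r ^ 2))⁻¹) 0 := by simp
    rw [e4]
    refine integral_Ioi_of_hasDerivAt_of_nonneg' (g := fun r : ℝ => -(2 * Real.pi * (1 + r ^ 2))⁻¹)
      (g' := fun r : ℝ => r * (Real.pi * (1 + r ^ 2) ^ 2)⁻¹) (a := 0) (l := 0) ?_ ?_ ?_
    · intro r _
      have h : HasDerivAt (fun r : ℝ => 2 * Real.pi * (1 + r ^ 2)) (2 * Real.pi * (2 * r)) r := by
        simpa using (((hasDerivAt_id r).pow 2).const_add 1).const_mul (2 * Real.pi)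
      have h2 := (h.inv (by positivity)).neg
      refine h2.congr_deriv ?_
      have := Real.pi_pos
      field_simp
    · intro r hr
      have : 0 < r := hr
      positivity
    · rw [show (0 : ℝ) = -0 by simp]
      refine Tendsto.neg (tendsto_inv_atTop_zero.comp ?_)
      refine Tendsto.const_mul_atTop (by positivity) ?_
      exact tendsto_atTop_add_const_left _ _ (tendsto_pow_atTop two_ne_zero)
  rw [e3]
  simp only [integral_const, smul_eq_mul, mul_one]
  have := Real.pi_pos
  rw [measureReal_restrict_apply MeasurableSet.univ, univ_inter, Measure.real, Real.volume_Ioo,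
    ENNReal.toReal_ofReal (by linarith)]
  rw [ENNReal.ofReal_eq_one]
  field_simp
  ring

theorem norm_sq_mnum_add (A : SL(2, ℂ)) (z : ℂ) :
    ‖mnum A z‖ ^ 2 + ‖mden A z‖ ^ 2 ≤ matNorm A.1 ^ 2 * (1 + ‖z‖ ^ 2) := by
  have h := norm_sq_mulVec_le A.1 (chartVec 0 z)
  rw [mulVec_chartVec_zero] at h
  simpa [chartVec, add_comm] using h

/-- With v = (z, 1), the density at z is 1 / (π ‖v‖⁴), while after the change of variables the
right-hand side carries 1 / (π ‖Av‖⁴); the inequality is ‖Av‖ ≤ ‖A‖ ‖v‖. -/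
theorem lintegral_smul_le (g : PSL(2, ℂ)) {F : P1 → ℝ≥0∞} (hF : Measurable F) :
    ∫⁻ x, F (g • x) ∂fubiniStudy ≤ ENNReal.ofReal (opNorm g ^ 4) * ∫⁻ x, F x ∂fubiniStudy := by
  obtain ⟨A, rfl⟩ := isOpenQuotientMap_toPSL.surjective g
  rw [lintegral_fubiniStudy hF,
    lintegral_fubiniStudy (F := fun x => F (toPSL A • x))
      (hF.comp (continuous_const_smul (toPSL A)).measurable),
    ← lintegral_mobSL A fun z => fubiniStudyDensity z * F (chart 0 z),
    ← lintegral_const_mul' _ _ ENNReal.ofReal_ne_top]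
  refine lintegral_mono_ae ?_
  filter_upwards [ae_mden A] with z hz
  rw [smul_chart_zero A hz, ← mul_assoc, ← mul_assoc, opNorm_toPSL]
  gcongr
  rw [fubiniStudyDensity, fubiniStudyDensity, mul_assoc,
    ← ENNReal.ofReal_mul (by have := one_le_matNorm A; positivity),
    ← ENNReal.ofReal_mul (by positivity)]
  refine ENNReal.ofReal_le_ofReal ?_
  have h := norm_sq_mnum_add A z
  have hd : 0 < ‖mden A z‖ := norm_pos_iff.2 hz
  rw [mobSL, norm_div]
  have e : (‖mden A z‖ ^ 4)⁻¹ * (1 / (Real.pi * (1 + (‖mnum A z‖ / ‖mden A z‖) ^ 2) ^ 2)) =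
      1 / (Real.pi * (‖mnum A z‖ ^ 2 + ‖mden A z‖ ^ 2) ^ 2) := by
    field_simp
    ring
  have hpi := Real.pi_pos
  rw [e, mul_one_div, div_le_div_iff₀ (by positivity) (by positivity), one_mul]
  calc Real.pi * (‖mnum A z‖ ^ 2 + ‖mden A z‖ ^ 2) ^ 2
      ≤ Real.pi * (matNorm A.1 ^ 2 * (1 + ‖z‖ ^ 2)) ^ 2 := by gcongr
    _ = _ := by ring

theorem map_smul_fubiniStudy_le (g : PSL(2, ℂ)) :
    fubiniStudy.map (g • ·) ≤ ENNReal.ofReal (opNorm g ^ 4) • fubiniStudy := by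
  have hm : Measurable fun x : P1 => g • x := (continuous_const_smul g).measurable
  refine Measure.le_iff.2 fun s hs => ?_
  have h := lintegral_smul_le g (F := s.indicator 1) (measurable_one.indicator hs)
  rw [lintegral_indicator_one hs] at h
  rw [Measure.map_apply hm hs, ← lintegral_indicator_one (hm hs)]
  exact h

theorem quasiMeasurePreserving_smul (g : PSL(2, ℂ)) :
    Measure.QuasiMeasurePreserving (fun x : P1 => g • x) fubiniStudy fubiniStudy :=
  ⟨(continuous_const_smul g).measurable,
    (Measure.absolutelyContinuous_of_le (map_smul_fubiniStudy_le g)).trans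
      (Measure.smul_absolutelyContinuous)⟩

theorem integrable_comp_smul {h : P1 → ℝ} (hh : Integrable h fubiniStudy) (g : PSL(2, ℂ)) :
    Integrable (fun x => h (g • x)) fubiniStudy := by
  have h1 : Integrable h (fubiniStudy.map (g • ·)) :=
    (hh.smul_measure (ENNReal.ofReal_ne_top (r := opNorm g ^ 4))).mono_measure
      (map_smul_fubiniStudy_le g)
  exact h1.comp_measurable (continuous_const_smul g).measurable

theorem locallyIntegrable_chart_zero {h : P1 → ℝ} (hh : Integrable h fubiniStudy) :
    LocallyIntegrable fun z => h (chart 0 z) := by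
  have h1 : Integrable (fun z => h (chart 0 z)) (volume.withDensity fubiniStudyDensity) :=
    hh.comp_measurable (measurable_chart 0)
  refine fun z => ⟨Metric.ball z 1, Metric.ball_mem_nhds z one_pos, ?_⟩
  set R := ‖z‖ + 1
  have hpi := Real.pi_pos
  refine (h1.smul_measure (ENNReal.ofReal_ne_top (r := Real.pi * (1 + R ^ 2) ^ 2))).mono_measure ?_
  refine Measure.le_iff.2 fun s hs => ?_
  rw [Measure.restrict_apply hs, Measure.smul_apply, withDensity_apply _ hs, smul_eq_mul,
    ← lintegral_const_mul' _ _ ENNReal.ofReal_ne_top]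
  calc volume (s ∩ Metric.ball z 1) = ∫⁻ _ in s ∩ Metric.ball z 1, 1 := by simp
    _ ≤ ∫⁻ w in s ∩ Metric.ball z 1,
        ENNReal.ofReal (Real.pi * (1 + R ^ 2) ^ 2) * fubiniStudyDensity w := by
      refine setLIntegral_mono' (hs.inter Metric.isOpen_ball.measurableSet) fun w hw => ?_
      have hw' : ‖w‖ ≤ R := by
        have := hw.2
        rw [Metric.mem_ball, dist_eq_norm] at this
        have := norm_sub_norm_le w z
        simp only [R]; linarith
      rw [fubiniStudyDensity, ← ENNReal.ofReal_mul (by positivity), ← ENNReal.ofReal_one]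
      refine ENNReal.ofReal_le_ofReal ?_
      rw [mul_one_div, le_div_iff₀ (by positivity), one_mul]
      gcongr
    _ ≤ _ := lintegral_mono_set inter_subset_left

theorem locallyIntegrable_smul_chart {h : P1 → ℝ} (hh : Integrable h fubiniStudy)
    (g : PSL(2, ℂ)) : LocallyIntegrable fun z => h (g • chart 0 z) :=
  locallyIntegrable_chart_zero (integrable_comp_smul hh g)

/-- To be in the Sobolev space can be checked on one affine coordinate and its exchange. -/
theorem hasDel_of_swap {h : P1 → ℝ} {g0 g1 : ℂ → ℂ} (h0 : HasWeakWirtinger (fun z => h (chart 0 z)) g0)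
    (h1 : HasWeakWirtinger (fun z => h (toPSL swapSL • chart 0 z)) g1) (m0 : MemLp g0 2 volume)
    (m1 : MemLp g1 2 volume) : HasDel h ![g0, g1] := by
  intro i
  fin_cases i
  · exact ⟨m0, h0⟩
  · refine ⟨m1, ?_⟩
    simpa only [swapSL_smul_chart] using! h1

theorem HasDel.comp_smul {h : P1 → ℝ} {g : Fin 2 → ℂ → ℂ} (hh : Integrable h fubiniStudy)
    (hd : HasDel h g) (γ : PSL(2, ℂ)) : HasDel (fun x => h (γ • x))
      ![pullBack γ (g 0), pullBack (γ * toPSL swapSL) (g 0)] := by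
  refine hasDel_of_swap (hd.hasWeakWirtinger_smul γ (locallyIntegrable_smul_chart hh γ)) ?_
    (memLp_pullBack _ (hd 0).1) (memLp_pullBack _ (hd 0).1)
  simp only [smul_smul]
  exact hd.hasWeakWirtinger_smul _ (locallyIntegrable_smul_chart hh _)

theorem integral_norm_sq_eq {φ : ℂ → ℂ} (hφ : AEStronglyMeasurable φ volume) :
    ∫ z, ‖φ z‖ ^ 2 = (∫⁻ z, ‖φ z‖ₑ ^ 2).toReal := by
  rw [integral_eq_lintegral_of_nonneg_ae (f := fun z => ‖φ z‖ ^ 2)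
    (.of_forall fun z => by positivity) (hφ.norm.pow 2)]
  congr 1
  refine lintegral_congr fun z => ?_
  rw [ENNReal.ofReal_pow (norm_nonneg _), ofReal_norm]

theorem integral_norm_sq_pullBack (g : PSL(2, ℂ)) (φ : ℂ → ℂ) (hφ : MemLp φ 2 volume) :
    ∫ z, ‖pullBack g φ z‖ ^ 2 = ∫ z, ‖φ z‖ ^ 2 := by
  rw [integral_norm_sq_eq (memLp_pullBack g hφ).1, integral_norm_sq_eq hφ.1, lintegral_pullBack]

theorem memW12_comp_smul {h : P1 → ℝ} (hh : MemW12 h) (γ : PSL(2, ℂ)) :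
    MemW12 fun x => h (γ • x) := by
  obtain ⟨hi, g, hd⟩ := hh
  exact ⟨integrable_comp_smul hi γ, _, hd.comp_smul hi γ⟩

theorem delNorm_comp_smul {h : P1 → ℝ} (hh : MemW12 h) (γ : PSL(2, ℂ)) :
    delNorm (fun x => h (γ • x)) = delNorm h := by
  obtain ⟨hi, g, hd⟩ := hh
  rw [hd.delNorm_eq, (hd.comp_smul hi γ).delNorm_eq]
  simp only [Matrix.cons_val_zero]
  rw [integral_norm_sq_pullBack γ _ (hd 0).1]

theorem delNorm_nonneg (h : P1 → ℝ) : 0 ≤ delNorm h := by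
  unfold delNorm
  split_ifs
  · exact Real.sqrt_nonneg _
  · exact le_rfl


/-! ### The Poincaré inequality -/

/-- Since u is real, du(a) = 2 Re(g a): the complex weak derivative contains all the real ones. -/
theorem HasWeakWirtinger.integral_mul_fderiv {u : ℂ → ℝ} {g : ℂ → ℂ} (h : HasWeakWirtinger u g)
    {φ : ℂ → ℝ} (hφ : ContDiff ℝ ∞ φ) (hc : HasCompactSupport φ) (a : ℂ) :
    ∫ t, u t * fderiv ℝ φ t a = -∫ t, 2 * (g t * a).re * φ t := by
  have hφ' : ContDiff ℝ ∞ fun z => (φ z : ℂ) := Complex.ofRealCLM.contDiff.comp hφ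
  have hc' : HasCompactSupport fun z => (φ z : ℂ) := hc.comp_left (g := Complex.ofReal) rfl
  have e := h.2.2 _ hφ' hc'
  have i1 : Integrable fun z => (u z : ℂ) * wirtinger (fun z => (φ z : ℂ)) z := by
    simpa using h.1.integrable_smul_right_of_hasCompactSupport
      (continuous_wirtinger hφ') (hasCompactSupport_wirtinger hc')
  have i2 : Integrable fun z => g z * (φ z : ℂ) := by
    simpa using h.2.1.integrable_smul_right_of_hasCompactSupport hφ'.continuous hc'
  have e2 := congrArg (fun w : ℂ => (2 * a * w).re) e
  simp only [mul_neg, Complex.neg_re] at e2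
  rw [← integral_const_mul, ← integral_const_mul] at e2
  have r1 := integral_re (i1.const_mul (2 * a))
  have r2 := integral_re (i2.const_mul (2 * a))
  simp only [RCLike.re_eq_complex_re] at r1 r2
  rw [← r1, ← r2] at e2
  convert e2 using 1
  · refine integral_congr_ae (.of_forall fun z => ?_)
    have hd : HasFDerivAt (fun z => (φ z : ℂ)) (Complex.ofRealCLM.comp (fderiv ℝ φ z)) z :=
      Complex.ofRealCLM.hasFDerivAt.comp z ((hφ.differentiable (by simp)) z).hasFDerivAt
    have ha : fderiv ℝ φ z a = a.re * fderiv ℝ φ z 1 + a.im * fderiv ℝ φ z Complex.I := by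
      have : a = a.re • (1 : ℂ) + a.im • Complex.I := by simp
      conv_lhs => rw [this, map_add, map_smul, map_smul]
      simp
    simp only [wirtinger, hd.fderiv, ha]
    simp
    ring
  · congr 1
    refine integral_congr_ae (.of_forall fun z => ?_)
    simp
    ring

/-- The convolution of a function on the plane with a kernel. -/
def mollify (ρ : ℂ → ℝ) (u : ℂ → ℝ) : ℂ → ℝ := convolution u ρ (ContinuousLinearMap.mul ℝ ℝ) volume

theorem mollify_apply (ρ u : ℂ → ℝ) (x : ℂ) : mollify ρ u x = ∫ t, u t * ρ (x - t) := rfl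

theorem contDiff_mollify {ρ u : ℂ → ℝ} (hρ : ContDiff ℝ ∞ ρ) (hc : HasCompactSupport ρ)
    (hu : LocallyIntegrable u) : ContDiff ℝ ∞ (mollify ρ u) :=
  hc.contDiff_convolution_right (n := ⊤) _ hu hρ

theorem fderiv_mollify {ρ u : ℂ → ℝ} (hρ : ContDiff ℝ ∞ ρ) (hc : HasCompactSupport ρ)
    (hu : LocallyIntegrable u) (x a : ℂ) :
    fderiv ℝ (mollify ρ u) x a = ∫ t, u t * fderiv ℝ ρ (x - t) a := by
  have h := hc.hasFDerivAt_convolution_right (ContinuousLinearMap.mul ℝ ℝ) hu (hρ.of_le (by simp)) x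
  rw [mollify, h.fderiv, convolution_precompR_apply _ hu (hc.fderiv ℝ)
    (hρ.continuous_fderiv (by simp))]
  rfl

theorem HasWeakWirtinger.fderiv_mollify {u : ℂ → ℝ} {g : ℂ → ℂ} (h : HasWeakWirtinger u g)
    {ρ : ℂ → ℝ} (hρ : ContDiff ℝ ∞ ρ) (hc : HasCompactSupport ρ) (x a : ℂ) :
    fderiv ℝ (mollify ρ u) x a = ∫ t, 2 * (g t * a).re * ρ (x - t) := by
  rw [RandomProducts.fderiv_mollify hρ hc h.1]
  have e := h.integral_mul_fderiv (φ := fun t => ρ (x - t)) (by fun_prop)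
    (hc.comp_homeomorph (Homeomorph.subLeft x)) a
  rw [← neg_eq_iff_eq_neg, ← integral_neg] at e
  rw [← e]
  refine integral_congr_ae (.of_forall fun t => ?_)
  have hd : HasFDerivAt (fun t => ρ (x - t)) _ t :=
    ((hρ.differentiable (by simp)) (x - t)).hasFDerivAt.comp t ((hasFDerivAt_id t).const_sub x)
  simp [hd.fderiv]

/-- The increment is the integral of the derivative along the segment from x to x + a. By convexity
the points x + ta stay in S, and for each t the translation by ta preserves Lebesgue measure. -/
theorem lintegral_sub_le_of_contDiff {v : ℂ → ℝ} (hv : ContDiff ℝ 1 v) {S : Set ℂ}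
    (hS : Convex ℝ S) (hm : MeasurableSet S) (a : ℂ) :
    ∫⁻ x in {x | x ∈ S ∧ x + a ∈ S}, ‖v (x + a) - v x‖ₑ ≤ ∫⁻ x in S, ‖fderiv ℝ v x a‖ₑ := by
  have hcont : Continuous (fderiv ℝ v) := hv.continuous_fderiv (by simp)
  have hT : MeasurableSet {x | x ∈ S ∧ x + a ∈ S} :=
    hm.inter (measurable_add_const a hm)
  set F : ℂ → ℝ≥0∞ := fun x => ‖fderiv ℝ v x a‖ₑ with hF
  have hFc : Continuous F := by
    have : Continuous fun x => fderiv ℝ v x a := by fun_prop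
    exact this.enorm
  have h1 : ∀ x, ‖v (x + a) - v x‖ₑ ≤ ∫⁻ t in Ioc (0 : ℝ) 1, F (x + t * a) := by
    intro x
    have hd : ∀ t : ℝ, HasDerivAt (fun t : ℝ => v (x + t * a)) (fderiv ℝ v (x + t * a) a) t := by
      intro t
      have h2 : HasDerivAt (fun t : ℝ => x + (t : ℂ) * a) a t := by
        simpa using ((Complex.ofRealCLM.hasDerivAt (x := t)).mul_const a).const_add x
      exact ((hv.differentiable (by simp)) _).hasFDerivAt.comp_hasDerivAt t h2
    have h3 := intervalIntegral.integral_eq_sub_of_hasDerivAt (a := 0) (b := 1)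
      (fun t _ => hd t) (Continuous.intervalIntegrable (by fun_prop) _ _)
    simp only [Complex.ofReal_one, one_mul, Complex.ofReal_zero, zero_mul, add_zero] at h3
    rw [← h3, intervalIntegral.integral_of_le zero_le_one]
    exact enorm_integral_le_lintegral_enorm _
  calc ∫⁻ x in {x | x ∈ S ∧ x + a ∈ S}, ‖v (x + a) - v x‖ₑ
      ≤ ∫⁻ x in {x | x ∈ S ∧ x + a ∈ S}, ∫⁻ t in Ioc (0 : ℝ) 1, F (x + t * a) :=
        lintegral_mono h1
    _ = ∫⁻ t in Ioc (0 : ℝ) 1, ∫⁻ x in {x | x ∈ S ∧ x + a ∈ S}, F (x + t * a) := by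
        refine lintegral_lintegral_swap ?_
        have : Continuous fun p : ℂ × ℝ => F (p.1 + p.2 * a) := by fun_prop
        exact this.measurable.aemeasurable
    _ ≤ ∫⁻ _ in Ioc (0 : ℝ) 1, ∫⁻ x in S, F x := by
        refine setLIntegral_mono' measurableSet_Ioc fun t ht => ?_
        rw [← lintegral_indicator hm, ← lintegral_add_right_eq_self (S.indicator F) ((t : ℂ) * a),
          ← lintegral_indicator hT]
        refine lintegral_mono fun x => ?_
        by_cases hx : x ∈ {x | x ∈ S ∧ x + a ∈ S}
        · have : x + t * a ∈ S := by
            have := hS.add_smul_mem hx.1 hx.2 ⟨ht.1.le, ht.2⟩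
            simpa using this
          rw [indicator_of_mem hx, indicator_of_mem this]
        · rw [indicator_of_notMem hx]; exact zero_le
    _ = _ := by simp

/-- Young's inequality for a kernel of integral 1. A kernel supported in the unit disc enlarges the
radius from 2 to 3. -/
theorem lintegral_mollify_le {u : ℂ → ℝ} {g : ℂ → ℂ} (h : HasWeakWirtinger u g)
    (ρ : ContDiffBump (0 : ℂ)) (hρ : ρ.rOut ≤ 1) (a : ℂ) :
    ∫⁻ x in Metric.ball (0 : ℂ) 2, ‖fderiv ℝ (mollify (ρ.normed volume) u) x a‖ₑ ≤
      2 * ‖a‖ₑ * ∫⁻ t in Metric.ball (0 : ℂ) 3, ‖g t‖ₑ := by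
  have hgm : AEMeasurable (fun t => ‖g t‖ₑ) volume := h.2.1.aestronglyMeasurable.enorm
  set r : ℂ → ℝ≥0∞ := fun x => ‖ρ.normed volume x‖ₑ with hr
  have hrm : Measurable r := ρ.continuous_normed.measurable.enorm
  have hr1 : ∫⁻ x, r x = 1 := by
    have := ρ.integral_normed (μ := volume)
    rw [← ofReal_integral_norm_eq_lintegral_enorm ρ.integrable_normed]
    simp [abs_of_nonneg (ρ.nonneg_normed _), this]
  have hpt : ∀ x, ‖fderiv ℝ (mollify (ρ.normed volume) u) x a‖ₑ ≤
      ∫⁻ t, 2 * ‖a‖ₑ * (‖g t‖ₑ * r (x - t)) := by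
    intro x
    rw [h.fderiv_mollify ρ.contDiff_normed ρ.hasCompactSupport_normed]
    refine (enorm_integral_le_lintegral_enorm _).trans (lintegral_mono fun t => ?_)
    rw [enorm_mul, enorm_mul]
    calc ‖(2 : ℝ)‖ₑ * ‖(g t * a).re‖ₑ * r (x - t)
        ≤ 2 * (‖g t‖ₑ * ‖a‖ₑ) * r (x - t) := by
          gcongr
          · simp [Real.enorm_eq_ofReal]
          · rw [← enorm_mul, enorm_le_iff_norm_le]
            exact Complex.abs_re_le_norm _
      _ = _ := by ring
  calc ∫⁻ x in Metric.ball (0 : ℂ) 2, ‖fderiv ℝ (mollify (ρ.normed volume) u) x a‖ₑ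
      ≤ ∫⁻ x in Metric.ball (0 : ℂ) 2, ∫⁻ t, 2 * ‖a‖ₑ * (‖g t‖ₑ * r (x - t)) := lintegral_mono hpt
    _ = ∫⁻ t, ∫⁻ x in Metric.ball (0 : ℂ) 2, 2 * ‖a‖ₑ * (‖g t‖ₑ * r (x - t)) := by
        refine lintegral_lintegral_swap ?_
        have m1 : AEMeasurable (fun p : ℂ × ℂ => ‖g p.2‖ₑ)
            ((volume.restrict (Metric.ball (0 : ℂ) 2)).prod volume) :=
          hgm.comp_quasiMeasurePreserving Measure.quasiMeasurePreserving_snd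
        have m2 : Measurable fun p : ℂ × ℂ => r (p.1 - p.2) :=
          hrm.comp (measurable_fst.sub measurable_snd)
        exact (m1.mul m2.aemeasurable).const_mul _
    _ ≤ ∫⁻ t, (Metric.ball (0 : ℂ) 3).indicator (fun t => 2 * ‖a‖ₑ * ‖g t‖ₑ) t := by
        refine lintegral_mono fun t => ?_
        by_cases ht : t ∈ Metric.ball (0 : ℂ) 3
        · rw [indicator_of_mem ht]
          simp only [← mul_assoc]
          rw [lintegral_const_mul _ (f := fun x => r (x - t)) (hrm.comp (measurable_id.sub_const t))]
          conv_rhs => rw [← mul_one (2 * ‖a‖ₑ * ‖g t‖ₑ)]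
          gcongr
          refine (setLIntegral_le_lintegral _ _).trans ?_
          rw [lintegral_sub_right_eq_self, hr1]
        · rw [indicator_of_notMem ht, nonpos_iff_eq_zero]
          rw [setLIntegral_congr_fun (g := fun _ => 0) Metric.isOpen_ball.measurableSet]
          · simp
          · intro x hx
            have : ρ.normed volume (x - t) = 0 := by
              by_contra hne
              have hmem : x - t ∈ Function.support (ρ.normed volume) := hne
              rw [ρ.support_normed_eq, mem_ball_zero_iff] at hmem
              apply ht
              rw [mem_ball_zero_iff] at hx ⊢
              have := norm_sub_norm_le t x
              rw [norm_sub_rev] at this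
              linarith
            simp [hr, this]
    _ = _ := by
        rw [lintegral_indicator Metric.isOpen_ball.measurableSet,
          lintegral_const_mul' _ _ (ENNReal.mul_ne_top (by simp) (by simp))]

/-- Mollifications converge almost everywhere and satisfy the bound uniformly, so Fatou's lemma
suffices. -/
theorem lintegral_translate_le {u : ℂ → ℝ} {g : ℂ → ℂ} (h : HasWeakWirtinger u g) (a : ℂ) :
    ∫⁻ x in {x | x ∈ Metric.ball (0 : ℂ) 2 ∧ x + a ∈ Metric.ball (0 : ℂ) 2}, ‖u (x + a) - u x‖ₑ ≤
      2 * ‖a‖ₑ * ∫⁻ t in Metric.ball (0 : ℂ) 3, ‖g t‖ₑ := by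
  let ρ : ℕ → ContDiffBump (0 : ℂ) := fun n =>
    ⟨1 / (n + 2) / 2, 1 / (n + 2), by positivity, by
      have : (0 : ℝ) < 1 / (n + 2) := by positivity
      linarith⟩
  have hlim : Tendsto (fun n => (ρ n).rOut) atTop (𝓝 0) := by
    have h1 := tendsto_one_div_add_atTop_nhds_zero_nat (𝕜 := ℝ)
    have h2 := h1.comp (tendsto_add_atTop_nat 1)
    refine h2.congr fun n => ?_
    simp only [Function.comp_apply, ρ]
    push_cast
    ring
  have hae := ContDiffBump.ae_convolution_tendsto_right_of_locallyIntegrable (μ := volume) (K := 2)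
    hlim (.of_forall fun n => by simp only [ρ]; linarith) h.1
  have hconv : ∀ᵐ x, Tendsto (fun n => mollify ((ρ n).normed volume) u x) atTop (𝓝 (u x)) := by
    filter_upwards [hae] with x hx
    refine hx.congr fun n => ?_
    rw [convolution_eq_swap, mollify_apply]
    simp [mul_comm]
  have hconv' : ∀ᵐ x, Tendsto (fun n => mollify ((ρ n).normed volume) u (x + a)) atTop
      (𝓝 (u (x + a))) :=
    (measurePreserving_add_right volume a).quasiMeasurePreserving.ae hconv
  have hsm : ∀ n, ContDiff ℝ ∞ (mollify ((ρ n).normed volume) u) := fun n =>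
    contDiff_mollify (ρ n).contDiff_normed (ρ n).hasCompactSupport_normed h.1
  have hT : MeasurableSet {x | x ∈ Metric.ball (0 : ℂ) 2 ∧ x + a ∈ Metric.ball (0 : ℂ) 2} :=
    Metric.isOpen_ball.measurableSet.inter
      (measurable_add_const a Metric.isOpen_ball.measurableSet)
  calc ∫⁻ x in {x | x ∈ Metric.ball (0 : ℂ) 2 ∧ x + a ∈ Metric.ball (0 : ℂ) 2}, ‖u (x + a) - u x‖ₑ
      = ∫⁻ x in {x | x ∈ Metric.ball (0 : ℂ) 2 ∧ x + a ∈ Metric.ball (0 : ℂ) 2},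
        liminf (fun n => ‖mollify ((ρ n).normed volume) u (x + a) -
          mollify ((ρ n).normed volume) u x‖ₑ) atTop := by
        refine lintegral_congr_ae (ae_restrict_of_ae ?_)
        filter_upwards [hconv, hconv'] with x h1 h2
        exact ((h2.sub h1).enorm.liminf_eq).symm
    _ ≤ liminf (fun n => ∫⁻ x in {x | x ∈ Metric.ball (0 : ℂ) 2 ∧ x + a ∈ Metric.ball (0 : ℂ) 2},
        ‖mollify ((ρ n).normed volume) u (x + a) - mollify ((ρ n).normed volume) u x‖ₑ) atTop := by
        refine lintegral_liminf_le fun n => ?_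
        have := (hsm n).continuous
        have h2 : Continuous fun x => mollify ((ρ n).normed volume) u (x + a) -
          mollify ((ρ n).normed volume) u x := by fun_prop
        exact h2.enorm.measurable
    _ ≤ _ := by
        refine liminf_le_of_le (by isBoundedDefault) fun b hb => ?_
        obtain ⟨n, hn⟩ := hb.exists
        refine hn.trans ?_
        refine (lintegral_sub_le_of_contDiff ((hsm n).of_le (by simp)) (convex_ball _ _)
          Metric.isOpen_ball.measurableSet a).trans ?_
        refine lintegral_mollify_le h (ρ n) ?_ a
        simp only [ρ]
        rw [div_le_one (by positivity)]
        linarith [n.cast_nonneg (α := ℝ)]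

/-- The Poincaré inequality on a disc. -/
theorem exists_lintegral_disc_le : ∃ C : ℝ≥0∞, C ≠ ⊤ ∧ ∀ (u : ℂ → ℝ) (g : ℂ → ℂ), Measurable u →
    HasWeakWirtinger u g →
    ∫⁻ x in Metric.ball (0 : ℂ) 2, ∫⁻ y in Metric.ball (0 : ℂ) 2, ‖u x - u y‖ₑ ≤
      C * (∫⁻ z, ‖g z‖ₑ ^ 2) ^ (1 / 2 : ℝ) := by
  set B := Metric.ball (0 : ℂ) 2 with hB
  have hBm : MeasurableSet B := Metric.isOpen_ball.measurableSet
  refine ⟨(2 * 4 * volume (Metric.ball (0 : ℂ) 3) ^ (1 / 2 : ℝ)) * volume (Metric.ball (0 : ℂ) 4),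
    ?_, fun u g hu h => ?_⟩
  · refine ENNReal.mul_ne_top (ENNReal.mul_ne_top (by norm_num) ?_) measure_ball_lt_top.ne
    exact ENNReal.rpow_ne_top_of_nonneg (by norm_num) measure_ball_lt_top.ne
  set N := (∫⁻ z, ‖g z‖ₑ ^ 2) ^ (1 / 2 : ℝ) with hN
  have hCS : ∫⁻ t in Metric.ball (0 : ℂ) 3, ‖g t‖ₑ ≤
      volume (Metric.ball (0 : ℂ) 3) ^ (1 / 2 : ℝ) * N := by
    have hgm : AEMeasurable (fun t => ‖g t‖ₑ) (volume.restrict (Metric.ball (0 : ℂ) 3)) :=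
      h.2.1.aestronglyMeasurable.enorm.restrict
    have h1 := ENNReal.lintegral_mul_le_Lp_mul_Lq (volume.restrict (Metric.ball (0 : ℂ) 3))
      Real.HolderConjugate.two_two (f := fun _ => 1) (g := fun t => ‖g t‖ₑ) aemeasurable_const hgm
    simp only [Pi.mul_apply, one_mul, ENNReal.one_rpow, lintegral_one, Measure.restrict_apply_univ]
      at h1
    refine h1.trans ?_
    gcongr
    rw [hN]
    refine ENNReal.rpow_le_rpow ?_ (by norm_num)
    refine (setLIntegral_le_lintegral _ _).trans_eq ?_
    simp
  set G : ℂ → ℂ → ℝ≥0∞ := fun x y => B.indicator 1 x * B.indicator 1 y * ‖u y - u x‖ₑ with hG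
  have hGm : Measurable (Function.uncurry G) := by
    have h1 : Measurable (B.indicator (1 : ℂ → ℝ≥0∞)) := measurable_one.indicator hBm
    exact ((h1.comp measurable_fst).mul (h1.comp measurable_snd)).mul
      ((hu.comp measurable_snd).sub (hu.comp measurable_fst)).enorm
  have e1 : ∫⁻ x in B, ∫⁻ y in B, ‖u x - u y‖ₑ = ∫⁻ x, ∫⁻ y, G x y := by
    rw [← lintegral_indicator hBm]
    refine lintegral_congr fun x => ?_
    by_cases hx : x ∈ B
    · rw [indicator_of_mem hx, ← lintegral_indicator hBm]
      refine lintegral_congr fun y => ?_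
      by_cases hy : y ∈ B
      · simp only [hG, indicator_of_mem hx, indicator_of_mem hy, Pi.one_apply, one_mul]
        rw [← enorm_neg, neg_sub]
      · simp [hG, hy]
    · simp [hG, hx]
  -- With y = x + a, the estimate for translates is integrated over a, which has norm less than 4 as
  -- a difference of two points of the disc of radius 2.
  have e2 : ∫⁻ x, ∫⁻ y, G x y = ∫⁻ a, ∫⁻ x, G x (x + a) := by
    have : ∀ x, ∫⁻ y, G x y = ∫⁻ a, G x (x + a) := fun x =>
      (lintegral_add_left_eq_self (fun y => G x y) x).symm
    simp only [this]
    refine lintegral_lintegral_swap ?_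
    exact (hGm.comp (measurable_fst.prodMk (measurable_fst.add measurable_snd))).aemeasurable
  rw [e1, e2]
  calc ∫⁻ a, ∫⁻ x, G x (x + a) ≤ ∫⁻ a, (Metric.ball (0 : ℂ) 4).indicator
        (fun _ => 2 * 4 * (volume (Metric.ball (0 : ℂ) 3) ^ (1 / 2 : ℝ) * N)) a := by
        refine lintegral_mono fun a => ?_
        by_cases ha : a ∈ Metric.ball (0 : ℂ) 4
        · rw [indicator_of_mem ha]
          have hT : MeasurableSet {x | x ∈ B ∧ x + a ∈ B} := hBm.inter (measurable_add_const a hBm)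
          calc ∫⁻ x, G x (x + a) = ∫⁻ x in {x | x ∈ B ∧ x + a ∈ B}, ‖u (x + a) - u x‖ₑ := by
                rw [← lintegral_indicator hT]
                refine lintegral_congr fun x => ?_
                by_cases hx : x ∈ B
                · by_cases hy : x + a ∈ B
                  · rw [indicator_of_mem (show x ∈ {x | x ∈ B ∧ x + a ∈ B} from ⟨hx, hy⟩)]
                    simp only [hG, indicator_of_mem hx, indicator_of_mem hy, Pi.one_apply, one_mul]
                  · rw [indicator_of_notMem (show x ∉ {x | x ∈ B ∧ x + a ∈ B} from fun h => hy h.2)]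
                    simp only [hG, indicator_of_notMem hy, mul_zero, zero_mul]
                · rw [indicator_of_notMem (show x ∉ {x | x ∈ B ∧ x + a ∈ B} from fun h => hx h.1)]
                  simp only [hG, indicator_of_notMem hx, zero_mul]
            _ ≤ 2 * ‖a‖ₑ * ∫⁻ t in Metric.ball (0 : ℂ) 3, ‖g t‖ₑ := lintegral_translate_le h a
            _ ≤ _ := by
                have : ‖a‖ₑ ≤ 4 := by
                  rw [mem_ball_zero_iff] at ha
                  rw [← ofReal_norm]
                  exact (ENNReal.ofReal_le_ofReal ha.le).trans_eq (by norm_num)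
                gcongr
        · have hz : ∀ x, G x (x + a) = 0 := by
            intro x
            by_cases hx : x ∈ B
            · have hy : x + a ∉ B := by
                intro hy
                apply ha
                rw [hB, mem_ball_zero_iff] at hx hy
                rw [mem_ball_zero_iff]
                have := norm_sub_le (x + a) x
                rw [add_sub_cancel_left] at this
                linarith
              simp only [hG, indicator_of_notMem hy, mul_zero, zero_mul]
            · simp only [hG, indicator_of_notMem hx, zero_mul]
          simp only [hz, lintegral_zero, zero_le]
    _ = _ := by
        rw [lintegral_indicator Metric.isOpen_ball.measurableSet, setLIntegral_const]
        ring


/-! ### Gluing the two coordinate discs -/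

theorem lintegral_chart_swap (w : ℂ → ℝ≥0∞) (F : P1 → ℝ≥0∞) :
    ∫⁻ z, w z * F (chart 0 z) =
      ∫⁻ z : ℂ, ENNReal.ofReal (‖z‖ ^ 4)⁻¹ * (w z⁻¹ * F (chart 1 z)) := by
  rw [← lintegral_mobSL swapSL fun z => w z * F (chart 0 z)]
  refine lintegral_congr_ae ?_
  have hne : ∀ᵐ z : ℂ, z ≠ 0 := by simp [ae_iff]
  filter_upwards [hne] with z hz
  obtain ⟨h0, h1, h2, h3⟩ := swapSL_entry
  have e1 : mden swapSL z = Complex.I * z := by simp [mden, h2, h3]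
  have e2 : mobSL swapSL z = z⁻¹ := by
    rw [mobSL, e1]; simp only [mnum, h0, h1]; field_simp; simp
  rw [e1, e2, chart_one_eq hz]
  simp

/-- Lebesgue measure on the disc of radius `2` of the `i`-th affine coordinate. -/
def discMeasure (i : Fin 2) : Measure P1 :=
  (volume.restrict (Metric.ball (0 : ℂ) 2)).map (chart i)

/-- Lebesgue measure on an annulus in the overlap of the two discs. -/
def annulusMeasure : Measure P1 :=
  (volume.restrict {z : ℂ | 1 / 2 < ‖z‖ ∧ ‖z‖ < 2}).map (chart 0)

theorem lintegral_discMeasure (i : Fin 2) {F : P1 → ℝ≥0∞} (hF : Measurable F) :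
    ∫⁻ x, F x ∂(discMeasure i) = ∫⁻ z in Metric.ball (0 : ℂ) 2, F (chart i z) :=
  lintegral_map hF (measurable_chart i)

instance (i : Fin 2) : IsFiniteMeasure (discMeasure i) := by
  refine ⟨?_⟩
  rw [discMeasure, Measure.map_apply (measurable_chart i) MeasurableSet.univ]
  rw [preimage_univ, Measure.restrict_apply_univ]
  exact measure_ball_lt_top

theorem discMeasure_univ (i : Fin 2) :
    discMeasure i univ = volume (Metric.ball (0 : ℂ) 2) := by
  rw [discMeasure, Measure.map_apply (measurable_chart i) MeasurableSet.univ]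
  simp

theorem measurableSet_annulus : MeasurableSet {z : ℂ | 1 / 2 < ‖z‖ ∧ ‖z‖ < 2} :=
  (measurableSet_lt measurable_const measurable_norm).inter
    (measurableSet_lt measurable_norm measurable_const)

theorem annulus_subset : {z : ℂ | 1 / 2 < ‖z‖ ∧ ‖z‖ < 2} ⊆ Metric.ball (0 : ℂ) 2 := fun z hz => by
  rw [mem_ball_zero_iff]; exact hz.2

theorem annulusMeasure_le_zero : annulusMeasure ≤ discMeasure 0 :=
  Measure.map_mono (Measure.restrict_mono annulus_subset le_rfl) (measurable_chart 0)

instance : IsFiniteMeasure annulusMeasure := isFiniteMeasure_of_le _ annulusMeasure_le_zero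

theorem annulusMeasure_univ_ne_zero : annulusMeasure univ ≠ 0 := by
  rw [annulusMeasure, Measure.map_apply (measurable_chart 0) MeasurableSet.univ]
  simp only [preimage_univ, Measure.restrict_apply_univ]
  refine (IsOpen.measure_pos volume ?_ ⟨1, by norm_num⟩).ne'
  exact (isOpen_lt continuous_const continuous_norm).inter
    (isOpen_lt continuous_norm continuous_const)

/-- The inversion z ↦ 1/z preserves the annulus, and its Jacobian |z|⁻⁴ is at most 2⁴ there. -/
theorem annulusMeasure_le_one : annulusMeasure ≤ (16 : ℝ≥0∞) • discMeasure 1 := by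
  refine Measure.le_iff.2 fun s hs => ?_
  have hF : Measurable (s.indicator (1 : P1 → ℝ≥0∞)) := measurable_one.indicator hs
  rw [Measure.smul_apply, smul_eq_mul, ← lintegral_indicator_one hs, ← lintegral_indicator_one hs,
    lintegral_discMeasure 1 hF, annulusMeasure, lintegral_map hF (measurable_chart 0),
    ← lintegral_indicator measurableSet_annulus, ← lintegral_const_mul' _ _ (by simp),
    ← lintegral_indicator Metric.isOpen_ball.measurableSet]
  have e : ∀ z, {z : ℂ | 1 / 2 < ‖z‖ ∧ ‖z‖ < 2}.indicator
      (fun z => s.indicator (1 : P1 → ℝ≥0∞) (chart 0 z)) z =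
      {z : ℂ | 1 / 2 < ‖z‖ ∧ ‖z‖ < 2}.indicator (1 : ℂ → ℝ≥0∞) z *
        s.indicator (1 : P1 → ℝ≥0∞) (chart 0 z) := by
    intro z
    by_cases hz : z ∈ {z : ℂ | 1 / 2 < ‖z‖ ∧ ‖z‖ < 2}
    · rw [indicator_of_mem hz, indicator_of_mem hz, Pi.one_apply, one_mul]
    · rw [indicator_of_notMem hz, indicator_of_notMem hz, zero_mul]
  rw [lintegral_congr e, lintegral_chart_swap]
  refine lintegral_mono fun z => ?_
  by_cases hz : z⁻¹ ∈ {z : ℂ | 1 / 2 < ‖z‖ ∧ ‖z‖ < 2}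
  · have h1 : 1 / 2 < ‖z‖⁻¹ := by simpa using hz.1
    have h2 : ‖z‖⁻¹ < 2 := by simpa using hz.2
    have h0 : 0 < ‖z‖ := inv_pos.1 (by linarith)
    have h3 : ‖z‖ < 2 := by
      rw [lt_inv_comm₀ (by norm_num) h0] at h1
      simpa using h1
    rw [indicator_of_mem hz, indicator_of_mem (mem_ball_zero_iff.2 h3), Pi.one_apply, one_mul]
    gcongr
    have : ENNReal.ofReal (‖z‖ ^ 4)⁻¹ ≤ ENNReal.ofReal 16 := by
      refine ENNReal.ofReal_le_ofReal ?_
      rw [← inv_pow]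
      calc ‖z‖⁻¹ ^ 4 ≤ 2 ^ 4 := by gcongr
        _ = 16 := by norm_num
    simpa using this
  · rw [indicator_of_notMem hz, zero_mul, mul_zero]
    exact zero_le

theorem fubiniStudyDensity_le_one (z : ℂ) : fubiniStudyDensity z ≤ 1 := by
  rw [fubiniStudyDensity, ENNReal.ofReal_le_one]
  have := Real.pi_gt_three
  rw [div_le_one (by positivity)]
  nlinarith [sq_nonneg ‖z‖, sq_nonneg (‖z‖ ^ 2)]

theorem fubiniStudyDensity_inv {z : ℂ} (hz : z ≠ 0) :
    ENNReal.ofReal (‖z‖ ^ 4)⁻¹ * fubiniStudyDensity z⁻¹ = fubiniStudyDensity z := by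
  have h0 : 0 < ‖z‖ := norm_pos_iff.2 hz
  have := Real.pi_pos
  rw [fubiniStudyDensity, fubiniStudyDensity, ← ENNReal.ofReal_mul (by positivity), norm_inv]
  congr 1
  field_simp
  ring

/-- The inversion sends the complement of the disc of radius 2 into the disc of radius 1/2 of the
other coordinate. The Fubini-Study density has the same expression in both coordinates and is at
most 1. -/
theorem fubiniStudy_le_disc : fubiniStudy ≤ discMeasure 0 + discMeasure 1 := by
  refine Measure.le_iff.2 fun s hs => ?_
  have hF : Measurable (s.indicator (1 : P1 → ℝ≥0∞)) := measurable_one.indicator hs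
  set F := s.indicator (1 : P1 → ℝ≥0∞) with hFdef
  set B := Metric.ball (0 : ℂ) 2
  have hB : MeasurableSet B := Metric.isOpen_ball.measurableSet
  rw [Measure.add_apply, ← lintegral_indicator_one hs, ← lintegral_indicator_one hs,
    ← lintegral_indicator_one hs, lintegral_discMeasure 1 hF, lintegral_discMeasure 0 hF,
    lintegral_fubiniStudy hF, ← lintegral_add_compl _ hB]
  refine add_le_add ?_ ?_
  · refine lintegral_mono fun z => ?_
    exact (mul_le_mul_left (fubiniStudyDensity_le_one z) _).trans_eq (one_mul _)
  · have e : ∫⁻ z in Bᶜ, fubiniStudyDensity z * F (chart 0 z) =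
        ∫⁻ z, (Bᶜ.indicator fubiniStudyDensity z) * F (chart 0 z) := by
      rw [← lintegral_indicator hB.compl]
      refine lintegral_congr fun z => ?_
      by_cases hz : z ∈ Bᶜ
      · rw [indicator_of_mem hz, indicator_of_mem hz]
      · rw [indicator_of_notMem hz, indicator_of_notMem hz, zero_mul]
    rw [e, lintegral_chart_swap, ← lintegral_indicator hB]
    refine lintegral_mono_ae ?_
    have hne : ∀ᵐ z : ℂ, z ≠ 0 := by simp [ae_iff]
    filter_upwards [hne] with z hz0
    by_cases hz : z⁻¹ ∈ Bᶜ
    · have h1 : 2 ≤ ‖z‖⁻¹ := by simpa [B] using hz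
      have h0 : 0 < ‖z‖ := norm_pos_iff.2 hz0
      have h3 : ‖z‖ < 2 := by
        rw [le_inv_comm₀ (by norm_num) h0] at h1
        linarith
      rw [indicator_of_mem hz, indicator_of_mem (mem_ball_zero_iff.2 h3), ← mul_assoc,
        fubiniStudyDensity_inv hz0]
      exact (mul_le_mul_left (fubiniStudyDensity_le_one z) _).trans_eq (one_mul _)
    · rw [indicator_of_notMem hz, zero_mul, mul_zero]
      exact zero_le

theorem HasDel.lintegral_one_eq {h : P1 → ℝ} {g : Fin 2 → ℂ → ℂ} (hd : HasDel h g) (i : Fin 2) :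
    ∫⁻ z, ‖g i z‖ₑ ^ 2 = ∫⁻ z, ‖g 0 z‖ₑ ^ 2 := by
  fin_cases i
  · rfl
  · rw [← lintegral_pullBack (toPSL swapSL) (g 0)]
    refine lintegral_congr_ae ?_
    filter_upwards [hd.one_eq] with z hz
    simp only [Fin.mk_one, hz]

theorem HasDel.ofReal_delNorm {h : P1 → ℝ} {g : Fin 2 → ℂ → ℂ} (hd : HasDel h g) :
    (∫⁻ z, ‖g 0 z‖ₑ ^ 2) ^ (1 / 2 : ℝ) ≤ ENNReal.ofReal (delNorm h) := by
  have hfin := (memLp_two_iff (hd 0).1.1).1 (hd 0).1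
  rw [hd.delNorm_eq, integral_norm_sq_eq (hd 0).1.1, Real.sqrt_eq_rpow,
    ← ENNReal.ofReal_rpow_of_nonneg (by positivity) (by norm_num)]
  refine ENNReal.rpow_le_rpow ?_ (by norm_num)
  rw [ENNReal.le_ofReal_iff_toReal_le hfin.ne (by positivity)]
  have : 0 ≤ (∫⁻ z, ‖g 0 z‖ₑ ^ 2).toReal := ENNReal.toReal_nonneg
  linarith

/-- Points of different discs are compared through an intermediate point of the overlap: integrating
the triangle inequality over the annulus, whose measure is dominated by both disc measures up to a
factor, leaves integrals over a single disc. -/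
theorem lintegral_disc_cross {E : P1 → P1 → ℝ≥0∞} (hE : Measurable (Function.uncurry E))
    (htri : ∀ x y z, E x y ≤ E x z + E z y) :
    annulusMeasure univ * ∫⁻ x, ∫⁻ y, E x y ∂(discMeasure 1) ∂(discMeasure 0) ≤
      volume (Metric.ball (0 : ℂ) 2) * ∫⁻ x, ∫⁻ y, E x y ∂(discMeasure 0) ∂(discMeasure 0) +
      16 * volume (Metric.ball (0 : ℂ) 2) *
        ∫⁻ x, ∫⁻ y, E x y ∂(discMeasure 1) ∂(discMeasure 1) := by
  have hm1 : ∀ x, Measurable (E x) := fun x => hE.comp measurable_prodMk_left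
  have hm2 : ∀ (m : Measure P1) [SFinite m], Measurable fun x => ∫⁻ y, E x y ∂m := fun m _ =>
    hE.lintegral_prod_right
  have hm3 : ∀ (m : Measure P1) [SFinite m], Measurable fun y => ∫⁻ x, E x y ∂m := fun m _ =>
    hE.lintegral_prod_left
  have step : ∀ x y, annulusMeasure univ * E x y ≤
      ∫⁻ z, E x z ∂annulusMeasure + ∫⁻ z, E z y ∂annulusMeasure := by
    intro x y
    rw [← lintegral_add_left (hm1 x), mul_comm, ← lintegral_const]
    exact lintegral_mono fun z => htri x y z
  calc annulusMeasure univ * ∫⁻ x, ∫⁻ y, E x y ∂(discMeasure 1) ∂(discMeasure 0)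
      = ∫⁻ x, ∫⁻ y, annulusMeasure univ * E x y ∂(discMeasure 1) ∂(discMeasure 0) := by
        rw [← lintegral_const_mul _ (hm2 _)]
        refine lintegral_congr fun x => ?_
        rw [lintegral_const_mul _ (hm1 x)]
    _ ≤ ∫⁻ x, ∫⁻ y, (∫⁻ z, E x z ∂annulusMeasure + ∫⁻ z, E z y ∂annulusMeasure)
          ∂(discMeasure 1) ∂(discMeasure 0) :=
        lintegral_mono fun x => lintegral_mono fun y => step x y
    _ = volume (Metric.ball (0 : ℂ) 2) * ∫⁻ x, ∫⁻ z, E x z ∂annulusMeasure ∂(discMeasure 0) +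
        volume (Metric.ball (0 : ℂ) 2) * ∫⁻ z, ∫⁻ y, E z y ∂(discMeasure 1) ∂annulusMeasure := by
        have : ∀ x, ∫⁻ y, (∫⁻ z, E x z ∂annulusMeasure + ∫⁻ z, E z y ∂annulusMeasure)
            ∂(discMeasure 1) = volume (Metric.ball (0 : ℂ) 2) * ∫⁻ z, E x z ∂annulusMeasure +
            ∫⁻ z, ∫⁻ y, E z y ∂(discMeasure 1) ∂annulusMeasure := by
          intro x
          rw [lintegral_add_left measurable_const, lintegral_const, discMeasure_univ, mul_comm]
          congr 1
          exact lintegral_lintegral_swap (hE.comp measurable_swap).aemeasurable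
        simp only [this]
        rw [lintegral_add_left ((hm2 _).const_mul _), lintegral_const_mul _ (hm2 _),
          lintegral_const, discMeasure_univ]
        ring
    _ ≤ _ := by
        gcongr ?_ + ?_
        · gcongr with x
          exact annulusMeasure_le_zero
        · calc volume (Metric.ball (0 : ℂ) 2) *
                ∫⁻ z, ∫⁻ y, E z y ∂(discMeasure 1) ∂annulusMeasure
              ≤ volume (Metric.ball (0 : ℂ) 2) *
                ∫⁻ z, ∫⁻ y, E z y ∂(discMeasure 1) ∂((16 : ℝ≥0∞) • discMeasure 1) := by
                gcongr
                exact annulusMeasure_le_one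
            _ = _ := by
                rw [lintegral_smul_measure, smul_eq_mul]
                ring

/-- The Poincaré inequality on the projective line. -/
theorem exists_lintegral_sub_le : ∃ C : ℝ, 0 < C ∧ ∀ h : P1 → ℝ, Measurable h → ∀ g, HasDel h g →
    ∫⁻ x, ∫⁻ y, ‖h x - h y‖ₑ ∂fubiniStudy ∂fubiniStudy ≤ ENNReal.ofReal (C * delNorm h) := by
  obtain ⟨C₀, hC₀, hdisc⟩ := exists_lintegral_disc_le
  set b := volume (Metric.ball (0 : ℂ) 2) with hb
  have hbt : b ≠ ⊤ := measure_ball_lt_top.ne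
  set s := annulusMeasure univ with hs
  have hs0 : s ≠ 0 := annulusMeasure_univ_ne_zero
  have hst : s ≠ ⊤ := measure_ne_top _ _
  set K : ℝ≥0∞ := 2 * C₀ + 2 * (s⁻¹ * (b * C₀ + 16 * b * C₀)) with hK
  have hKt : K ≠ ⊤ := by
    have h1 : b * C₀ ≠ ⊤ := ENNReal.mul_ne_top hbt hC₀
    have h2 : 16 * b * C₀ ≠ ⊤ := ENNReal.mul_ne_top (ENNReal.mul_ne_top (by simp) hbt) hC₀
    exact ENNReal.add_ne_top.2 ⟨ENNReal.mul_ne_top (by simp) hC₀,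
      ENNReal.mul_ne_top (by simp) (ENNReal.mul_ne_top (ENNReal.inv_ne_top.2 hs0)
        (ENNReal.add_ne_top.2 ⟨h1, h2⟩))⟩
  refine ⟨K.toReal + 1, by positivity, fun h hm g hd => ?_⟩
  set E : P1 → P1 → ℝ≥0∞ := fun x y => ‖h x - h y‖ₑ with hEdef
  have hE : Measurable (Function.uncurry E) :=
    ((hm.comp measurable_fst).sub (hm.comp measurable_snd)).enorm
  have hm2 : ∀ (m : Measure P1) [SFinite m], Measurable fun x => ∫⁻ y, E x y ∂m := fun m _ =>
    hE.lintegral_prod_right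
  have htri : ∀ x y z, E x y ≤ E x z + E z y := fun x y z => by
    simp only [hEdef]
    rw [← sub_add_sub_cancel (h x) (h z) (h y)]
    exact enorm_add_le _ _
  set N := ENNReal.ofReal (delNorm h)
  have hI : ∀ i, ∫⁻ x, ∫⁻ y, E x y ∂(discMeasure i) ∂(discMeasure i) ≤ C₀ * N := by
    intro i
    rw [lintegral_discMeasure i (hm2 _)]
    calc ∫⁻ z in Metric.ball (0 : ℂ) 2, ∫⁻ y, E (chart i z) y ∂(discMeasure i)
        = ∫⁻ z in Metric.ball (0 : ℂ) 2, ∫⁻ w in Metric.ball (0 : ℂ) 2,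
          ‖h (chart i z) - h (chart i w)‖ₑ := by
          refine lintegral_congr fun z => ?_
          rw [lintegral_discMeasure i (F := E (chart i z)) (hE.comp measurable_prodMk_left)]
      _ ≤ C₀ * (∫⁻ z, ‖g i z‖ₑ ^ 2) ^ (1 / 2 : ℝ) :=
          hdisc _ _ (hm.comp (measurable_chart i)) (hd i).2
      _ ≤ _ := by
          rw [hd.lintegral_one_eq i]
          gcongr
          exact hd.ofReal_delNorm
  have hcross : ∫⁻ x, ∫⁻ y, E x y ∂(discMeasure 1) ∂(discMeasure 0) ≤
      s⁻¹ * (b * C₀ + 16 * b * C₀) * N := by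
    have h1 := lintegral_disc_cross hE htri
    rw [mul_assoc, ← ENNReal.mul_le_iff_le_inv hs0 hst]
    refine h1.trans ?_
    rw [add_mul, mul_assoc b C₀ N, mul_assoc (16 * b) C₀ N]
    gcongr
    · exact hI 0
    · exact hI 1
  have hcross' : ∫⁻ x, ∫⁻ y, E x y ∂(discMeasure 0) ∂(discMeasure 1) =
      ∫⁻ x, ∫⁻ y, E x y ∂(discMeasure 1) ∂(discMeasure 0) := by
    rw [lintegral_lintegral_swap hE.aemeasurable]
    refine lintegral_congr fun x => lintegral_congr fun y => ?_
    simp only [hEdef]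
    rw [← enorm_neg, neg_sub]
  calc ∫⁻ x, ∫⁻ y, E x y ∂fubiniStudy ∂fubiniStudy
      ≤ ∫⁻ x, ∫⁻ y, E x y ∂(discMeasure 0 + discMeasure 1) ∂(discMeasure 0 + discMeasure 1) :=
        lintegral_mono' fubiniStudy_le_disc fun x => lintegral_mono' fubiniStudy_le_disc le_rfl
    _ = (∫⁻ x, ∫⁻ y, E x y ∂(discMeasure 0) ∂(discMeasure 0) +
        ∫⁻ x, ∫⁻ y, E x y ∂(discMeasure 1) ∂(discMeasure 0)) +
        (∫⁻ x, ∫⁻ y, E x y ∂(discMeasure 0) ∂(discMeasure 1) +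
        ∫⁻ x, ∫⁻ y, E x y ∂(discMeasure 1) ∂(discMeasure 1)) := by
        simp only [lintegral_add_measure]
        rw [lintegral_add_left (hm2 _), lintegral_add_left (hm2 _)]
    _ ≤ (C₀ * N + s⁻¹ * (b * C₀ + 16 * b * C₀) * N) +
        (s⁻¹ * (b * C₀ + 16 * b * C₀) * N + C₀ * N) := by
        rw [hcross']
        gcongr
        · exact hI 0
        · exact hI 1
    _ = K * N := by rw [hK]; ring
    _ ≤ _ := by
        rw [ENNReal.ofReal_mul (by positivity)]
        gcongr
        rw [ENNReal.ofReal_add (by positivity) (by norm_num), ENNReal.ofReal_toReal hKt]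
        exact le_self_add

theorem delNorm_congr {h h' : P1 → ℝ} (e : h =ᵐ[fubiniStudy] h') : delNorm h = delNorm h' := by
  by_cases H : ∃ g, HasDel h g
  · obtain ⟨g, hg⟩ := H
    rw [hg.delNorm_eq, (hg.congr e).delNorm_eq]
  · have H' : ¬ ∃ g, HasDel h' g := fun ⟨g, hg⟩ => H ⟨g, hg.congr e.symm⟩
    rw [delNorm, delNorm, dif_neg H, dif_neg H']

theorem MemW12.congr {h h' : P1 → ℝ} (hh : MemW12 h) (e : h =ᵐ[fubiniStudy] h') : MemW12 h' :=
  ⟨hh.1.congr e, hh.2.imp fun _ hg => hg.congr e⟩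

theorem exists_poincare : ∃ C : ℝ, 0 < C ∧ ∀ h : P1 → ℝ, MemW12 h →
    ∫ x, |h x - ∫ y, h y ∂fubiniStudy| ∂fubiniStudy ≤ C * delNorm h := by
  obtain ⟨C, hC, H⟩ := exists_lintegral_sub_le
  refine ⟨C, hC, fun h hh => ?_⟩
  -- Both sides depend only on the class of h, so a measurable representative may be taken.
  wlog hm : Measurable h generalizing h with Hw
  · set h' := hh.1.1.mk h
    have e : h =ᵐ[fubiniStudy] h' := hh.1.1.ae_eq_mk
    have := Hw h' (hh.congr e) hh.1.1.stronglyMeasurable_mk.measurable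
    rw [delNorm_congr e, integral_congr_ae e]
    refine le_trans (le_of_eq ?_) this
    refine integral_congr_ae ?_
    filter_upwards [e] with x hx
    rw [hx]
  obtain ⟨hi, g, hd⟩ := hh
  have h1 := H h hm g hd
  have hint : Integrable (fun x => h x - ∫ y, h y ∂fubiniStudy) fubiniStudy :=
    hi.sub (integrable_const _)
  have h2 : ENNReal.ofReal (∫ x, |h x - ∫ y, h y ∂fubiniStudy| ∂fubiniStudy) ≤
      ENNReal.ofReal (C * delNorm h) := by
    refine le_trans ?_ h1
    simp only [← Real.norm_eq_abs]
    rw [ofReal_integral_norm_eq_lintegral_enorm hint]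
    refine lintegral_mono fun x => ?_
    have : h x - ∫ y, h y ∂fubiniStudy = ∫ y, (h x - h y) ∂fubiniStudy := by
      rw [integral_sub (integrable_const _) hi]
      simp
    rw [this]
    exact enorm_integral_le_lintegral_enorm _
  rwa [ENNReal.ofReal_le_ofReal_iff (mul_nonneg hC.le (delNorm_nonneg h))] at h2


/-! ### Variation of the mean under Möbius transformations -/

/-- Cayley-Hamilton with determinant 1 gives (P + 1)² = (tr P + 2) P, so Q = (P + 1) / √(tr P + 2).
Its trace √(tr P + 2) is again positive, which allows a second square root. -/
theorem exists_sqrt_of_isSelfAdjoint {P : Matrix (Fin 2) (Fin 2) ℂ} (hs : star P = P)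
    (hd : P.det = 1) {t : ℝ} (ht : 0 < t) (htr : P.trace = t) :
    ∃ Q : Matrix (Fin 2) (Fin 2) ℂ, star Q = Q ∧ Q.det = 1 ∧ (∃ s : ℝ, 0 < s ∧ Q.trace = s) ∧
      Q * Q = P := by
  set r : ℝ := Real.sqrt (t + 2) with hr
  have hr0 : 0 < r := Real.sqrt_pos.2 (by linarith)
  have hr2 : (r : ℂ) ^ 2 = t + 2 := by
    have : r ^ 2 = t + 2 := Real.sq_sqrt (by linarith)
    exact_mod_cast this
  have hrc : (r : ℂ) ≠ 0 := by exact_mod_cast hr0.ne'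
  rw [Matrix.det_fin_two] at hd
  rw [Matrix.trace_fin_two] at htr
  refine ⟨(r : ℂ)⁻¹ • (P + 1), ?_, ?_, ⟨r, hr0, ?_⟩, ?_⟩
  · rw [star_smul, star_add, hs, star_one]
    congr 1
    simp
  · rw [Matrix.det_fin_two]
    simp
    field_simp
    rw [hr2]
    linear_combination hd + htr
  · rw [Matrix.trace_fin_two]
    simp
    field_simp
    rw [hr2]
    linear_combination htr
  · rw [smul_mul_smul_comm]
    have : (P + 1) * (P + 1) = ((r : ℂ) ^ 2) • P := by
      rw [hr2]
      ext i j
      fin_cases i <;> fin_cases j <;> simp [Matrix.mul_apply, Fin.sum_univ_two]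
      · linear_combination P 0 0 * htr - hd
      · linear_combination P 0 1 * htr
      · linear_combination P 1 0 * htr
      · linear_combination P 1 1 * htr - hd
    rw [this, smul_smul]
    have : (r : ℂ)⁻¹ * (r : ℂ)⁻¹ * (r : ℂ) ^ 2 = 1 := by field_simp
    rw [this, one_smul]

theorem matNorm_nonneg (A : Matrix (Fin 2) (Fin 2) ℂ) : 0 ≤ matNorm A := norm_nonneg _

/-- A polar decomposition, with a square root of the positive factor. -/
theorem exists_polar (A : SL(2, ℂ)) : ∃ k Q : SL(2, ℂ), A = k * (Q * Q) ∧ matNorm k.1 = 1 ∧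
    matNorm Q.1 ^ 2 = matNorm A.1 := by
  have hA := SL_det A
  set H := star A.1 * A.1 with hH
  have hHs : star H = H := by rw [hH, star_mul, star_star]
  have hHd : H.det = 1 := by
    rw [hH, Matrix.det_mul, A.2, mul_one, Matrix.star_eq_conjTranspose, Matrix.det_conjTranspose,
      A.2, star_one]
  set t : ℝ := ‖A.1 0 0‖ ^ 2 + ‖A.1 0 1‖ ^ 2 + ‖A.1 1 0‖ ^ 2 + ‖A.1 1 1‖ ^ 2 with ht
  have hHt : H.trace = t := by
    rw [Matrix.trace_fin_two, hH, ht]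
    simp only [Matrix.star_eq_conjTranspose, Matrix.mul_apply, Fin.sum_univ_two,
      Matrix.conjTranspose_apply, Complex.star_def, ← Complex.normSq_eq_conj_mul_self]
    simp only [Complex.normSq_eq_norm_sq]
    push_cast; ring
  have ht0 : 0 < t := by
    by_contra! hle
    have h0 : ∀ z : ℂ, ‖z‖ ^ 2 ≤ 0 → z = 0 := fun z hz => by
      have : ‖z‖ ^ 2 = 0 := le_antisymm hz (by positivity)
      simpa using this
    have p1 := sq_nonneg ‖A.1 0 0‖
    have p2 := sq_nonneg ‖A.1 0 1‖
    have p3 := sq_nonneg ‖A.1 1 0‖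
    have p4 := sq_nonneg ‖A.1 1 1‖
    have e1 := h0 (A.1 0 0) (by linarith)
    have e2 := h0 (A.1 0 1) (by linarith)
    simp [e1, e2] at hA
  -- P is a square root of A^*A and Q one of P. The C^*-identity gives ‖P‖ = ‖A‖ and ‖Q‖² = ‖P‖, and
  -- k = A P⁻¹ is unitary.
  obtain ⟨P, hPs, hPd, ⟨s, hs, hPt⟩, hPP⟩ := exists_sqrt_of_isSelfAdjoint hHs hHd ht0 hHt
  obtain ⟨Q, hQs, hQd, -, hQQ⟩ := exists_sqrt_of_isSelfAdjoint hPs hPd hs hPt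
  have nP : matNorm P = matNorm A.1 := by
    have h1 : matNorm P ^ 2 = matNorm A.1 ^ 2 := by
      rw [← matNorm_star_mul_self, ← matNorm_star_mul_self, hPs, hPP]
    exact (sq_eq_sq₀ (matNorm_nonneg _) (matNorm_nonneg _)).1 h1
  have nQ : matNorm Q ^ 2 = matNorm A.1 := by
    rw [← matNorm_star_mul_self, hQs, hQQ, nP]
  set P' : SL(2, ℂ) := ⟨P, hPd⟩
  set Q' : SL(2, ℂ) := ⟨Q, hQd⟩
  have hQP : Q' * Q' = P' := Subtype.ext hQQ
  refine ⟨A * P'⁻¹, Q', by rw [hQP, inv_mul_cancel_right], ?_, nQ⟩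
  have hinv : P * P'⁻¹.1 = 1 := by
    have := congrArg Subtype.val (mul_inv_cancel P')
    rwa [Matrix.SpecialLinearGroup.coe_mul] at this
  have hk : star (A * P'⁻¹).1 * (A * P'⁻¹).1 = 1 := by
    rw [Matrix.SpecialLinearGroup.coe_mul, star_mul]
    calc star P'⁻¹.1 * star A.1 * (A.1 * P'⁻¹.1) = star P'⁻¹.1 * H * P'⁻¹.1 := by
          rw [hH]; simp only [mul_assoc]
      _ = (star P'⁻¹.1 * star P) * (P * P'⁻¹.1) := by
          rw [← hPP, hPs]; simp only [mul_assoc]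
      _ = 1 := by rw [← star_mul, hinv, star_one, one_mul]
  have h1 := matNorm_star_mul_self (A * P'⁻¹).1
  rw [hk, matNorm_one] at h1
  exact (pow_eq_one_iff_of_nonneg (matNorm_nonneg _) two_ne_zero).1 h1.symm

theorem integral_smul_le (g : PSL(2, ℂ)) {F : P1 → ℝ} (hF : Integrable F fubiniStudy)
    (h0 : ∀ x, 0 ≤ F x) :
    ∫ x, F (g • x) ∂fubiniStudy ≤ opNorm g ^ 4 * ∫ x, F x ∂fubiniStudy := by
  have hi : Integrable F (ENNReal.ofReal (opNorm g ^ 4) • fubiniStudy) :=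
    hF.smul_measure ENNReal.ofReal_ne_top
  have h1 := integral_mono_measure (map_smul_fubiniStudy_le g) (.of_forall h0) hi
  rw [integral_map (continuous_const_smul g).measurable.aemeasurable
    (hi.mono_measure (map_smul_fubiniStudy_le g)).1, integral_smul_measure,
    ENNReal.toReal_ofReal (by have := one_le_opNorm g; positivity)] at h1
  simpa using h1

/-- The bound for g' is applied to h ∘ g, which has the same `delNorm` as h; hence the constants
add. -/
theorem mean_smul_sub_le_mul {C : ℝ} (g g' : PSL(2, ℂ)) {c c' : ℝ}
    (H : ∀ h : P1 → ℝ, MemW12 h →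
      |∫ x, h (g • x) ∂fubiniStudy - ∫ x, h x ∂fubiniStudy| ≤ c * C * delNorm h)
    (H' : ∀ h : P1 → ℝ, MemW12 h →
      |∫ x, h (g' • x) ∂fubiniStudy - ∫ x, h x ∂fubiniStudy| ≤ c' * C * delNorm h)
    (h : P1 → ℝ) (hh : MemW12 h) :
    |∫ x, h ((g * g') • x) ∂fubiniStudy - ∫ x, h x ∂fubiniStudy| ≤ (c + c') * C * delNorm h := by
  have h1 := H h hh
  have h2 := H' _ (memW12_comp_smul hh g)
  rw [delNorm_comp_smul hh] at h2
  simp only [smul_smul] at h2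
  calc _ ≤ |∫ x, h ((g * g') • x) ∂fubiniStudy - ∫ x, h (g • x) ∂fubiniStudy| +
        |∫ x, h (g • x) ∂fubiniStudy - ∫ x, h x ∂fubiniStudy| := abs_sub_le _ _ _
    _ ≤ _ := by linarith

/-- For ‖g‖ ≤ 2 the density bound ‖g‖⁴ and the Poincaré inequality suffice. In general g = kQ² with
k unitary and ‖Q‖² = ‖g‖, and constants add under products: doubling log ‖g‖ about doubles the
constant. The density bound alone would grow like ‖g‖⁴, out of reach of a first moment. -/
theorem exists_mean_smul_sub_le : ∃ C : ℝ, 0 < C ∧ ∀ (h : P1 → ℝ), MemW12 h → ∀ g : PSL(2, ℂ),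
    |∫ x, h (g • x) ∂fubiniStudy - ∫ x, h x ∂fubiniStudy| ≤
      C * (1 + Real.log (opNorm g)) * delNorm h := by
  obtain ⟨C, hC, H⟩ := exists_poincare
  have small : ∀ g : PSL(2, ℂ), opNorm g ≤ 2 → ∀ h : P1 → ℝ, MemW12 h →
      |∫ x, h (g • x) ∂fubiniStudy - ∫ x, h x ∂fubiniStudy| ≤ 1 * (16 * C) * delNorm h := by
    intro g hg h hh
    set c := ∫ x, h x ∂fubiniStudy
    have hi : Integrable (fun x => |h x - c|) fubiniStudy := (hh.1.sub (integrable_const c)).abs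
    have e : ∫ x, h (g • x) ∂fubiniStudy - c = ∫ x, (h (g • x) - c) ∂fubiniStudy := by
      rw [integral_sub (integrable_comp_smul hh.1 g) (integrable_const c)]
      simp
    have h0 := one_le_opNorm g
    have hnn : 0 ≤ ∫ x, |h x - c| ∂fubiniStudy := integral_nonneg fun x => abs_nonneg _
    rw [e]
    calc |∫ x, (h (g • x) - c) ∂fubiniStudy| ≤ ∫ x, |h (g • x) - c| ∂fubiniStudy :=
          abs_integral_le_integral_abs
      _ ≤ opNorm g ^ 4 * ∫ x, |h x - c| ∂fubiniStudy :=
          integral_smul_le g (F := fun x => |h x - c|) hi fun x => abs_nonneg _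
      _ ≤ 2 ^ 4 * (C * delNorm h) := by
          gcongr
          exact H h hh
      _ = _ := by ring
  -- The factor 2^(j+1) - 1 solves c_0 = 1, c_{j+1} = 1 + 2 c_j: one unit for the unitary factor and
  -- twice c_j for the two copies of Q.
  have ind : ∀ (j : ℕ) (A : SL(2, ℂ)), matNorm A.1 ≤ 2 ^ (2 ^ j) → ∀ h : P1 → ℝ, MemW12 h →
      |∫ x, h (toPSL A • x) ∂fubiniStudy - ∫ x, h x ∂fubiniStudy| ≤
        (2 ^ (j + 1) - 1) * (16 * C) * delNorm h := by
    intro j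
    induction j with
    | zero =>
      intro A hA h hh
      have := small (toPSL A) (by simpa [opNorm_toPSL] using hA) h hh
      norm_num at this ⊢
      exact this
    | succ j ih =>
      intro A hA h hh
      obtain ⟨k, Q, hAQ, hk, hQ⟩ := exists_polar A
      have hQ' : matNorm Q.1 ≤ 2 ^ (2 ^ j) := by
        refine le_of_sq_le_sq ?_ (by positivity)
        rw [hQ, ← pow_mul, ← pow_succ]
        exact hA
      have h1 := mean_smul_sub_le_mul (toPSL k) (toPSL Q * toPSL Q)
        (small (toPSL k) (by rw [opNorm_toPSL, hk]; norm_num))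
        (mean_smul_sub_le_mul _ _ (ih Q hQ') (ih Q hQ')) h hh
      rw [hAQ, toPSL_mul, toPSL_mul]
      refine h1.trans_eq ?_
      ring
  refine ⟨16 * C * 8, by positivity, fun h hh g => ?_⟩
  obtain ⟨A, rfl⟩ := isOpenQuotientMap_toPSL.surjective g
  have hA1 : 1 ≤ matNorm A.1 := one_le_matNorm A
  have hlog : 0 ≤ Real.log (matNorm A.1) := Real.log_nonneg hA1
  have hd := delNorm_nonneg h
  have hex : ∃ j : ℕ, matNorm A.1 ≤ 2 ^ (2 ^ j) := by
    obtain ⟨n, hn⟩ := pow_unbounded_of_one_lt (matNorm A.1) (one_lt_two (α := ℝ))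
    refine ⟨n, hn.le.trans ?_⟩
    gcongr
    · norm_num
    · exact n.lt_two_pow_self.le
  classical
  -- Minimality of j gives 2^(j-1) log 2 < log ‖A‖ when j > 0, so 2^(j+1) is at most a multiple of 1
  -- + log ‖A‖.
  obtain ⟨j, hj, hmin⟩ : ∃ j : ℕ, matNorm A.1 ≤ 2 ^ (2 ^ j) ∧
      ∀ m < j, ¬ matNorm A.1 ≤ 2 ^ (2 ^ m) :=
    ⟨Nat.find hex, Nat.find_spec hex, fun m hm => Nat.find_min hex hm⟩
  have h1 := ind j A hj h hh
  refine h1.trans ?_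
  rw [opNorm_toPSL]
  have key : ((2 : ℝ) ^ (j + 1) - 1) ≤ 8 * (1 + Real.log (matNorm A.1)) := by
    rcases j with _ | j
    · norm_num; linarith
    · have h2 := hmin j (Nat.lt_succ_self j)
      push Not at h2
      have h3 := Real.log_lt_log (by positivity) h2
      rw [Real.log_pow] at h3
      push_cast at h3
      have h4 := Real.log_two_gt_d9
      have h5 : (0 : ℝ) < 2 ^ j := by positivity
      have h6 : (2 : ℝ) ^ (j + 1 + 1) = 4 * 2 ^ j := by ring
      rw [h6]
      nlinarith
  calc _ ≤ (8 * (1 + Real.log (matNorm A.1))) * (16 * C) * delNorm h := by gcongr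
    _ = _ := by ring


/-! ### Averages of forms -/

/-- The square of the `L²` norm, in `[0, ∞]`. -/
def sqNorm (φ : ℂ → ℂ) : ℝ≥0∞ := ∫⁻ z, ‖φ z‖ₑ ^ 2

theorem integral_norm_sq_eq' {α : Type*} [MeasurableSpace α] {m : Measure α} {X : α → ℂ}
    (hX : AEStronglyMeasurable X m) : ∫ z, ‖X z‖ ^ 2 ∂m = (∫⁻ z, ‖X z‖ₑ ^ 2 ∂m).toReal := by
  rw [integral_eq_lintegral_of_nonneg_ae (f := fun z => ‖X z‖ ^ 2)
    (.of_forall fun z => by positivity) (hX.norm.pow 2)]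
  congr 1
  refine lintegral_congr fun z => ?_
  rw [ENNReal.ofReal_pow (norm_nonneg _), ofReal_norm]

/-- Pythagoras: the deviation from the mean is orthogonal to constants. Integrated over z, it
measures exactly the norm lost by an average of isometries. -/
theorem lintegral_variance {α : Type*} [MeasurableSpace α] {m : Measure α} [IsProbabilityMeasure m]
    {X : α → ℂ} (hX : MemLp X 2 m) :
    ∫⁻ a, ‖X a - ∫ b, X b ∂m‖ₑ ^ 2 ∂m + ‖∫ b, X b ∂m‖ₑ ^ 2 = ∫⁻ a, ‖X a‖ₑ ^ 2 ∂m := by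
  set c := ∫ b, X b ∂m with hc
  have hXc : MemLp (fun a => X a - c) 2 m := hX.sub (memLp_const c)
  have hi : Integrable X m := hX.integrable (by norm_num)
  have f1 := (memLp_two_iff hX.1).1 hX
  have f2 := (memLp_two_iff hXc.1).1 hXc
  have i1 : Integrable (fun a => ‖X a‖ ^ 2) m := hX.integrable_norm_pow (by norm_num)
  have i2 : Integrable (fun a => 2 * (starRingEnd ℂ c * X a).re) m :=
    (hi.const_mul (starRingEnd ℂ c)).re.const_mul 2
  have e : ∫ a, ‖X a - c‖ ^ 2 ∂m + ‖c‖ ^ 2 = ∫ a, ‖X a‖ ^ 2 ∂m := by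
    have h1 : ∀ a, ‖X a - c‖ ^ 2 = ‖X a‖ ^ 2 - 2 * (starRingEnd ℂ c * X a).re + ‖c‖ ^ 2 := by
      intro a
      rw [← Complex.normSq_eq_norm_sq, ← Complex.normSq_eq_norm_sq, ← Complex.normSq_eq_norm_sq,
        Complex.normSq_sub, mul_comm (starRingEnd ℂ c)]
      ring
    simp only [h1]
    have i3 : Integrable (fun a => ‖X a‖ ^ 2 - 2 * (starRingEnd ℂ c * X a).re) m := i1.sub i2
    rw [integral_add i3 (integrable_const _), integral_sub i1 i2, integral_const_mul]
    have h2 := integral_re (hi.const_mul (starRingEnd ℂ c))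
    simp only [RCLike.re_eq_complex_re] at h2
    rw [h2, integral_const_mul, ← hc, ← Complex.normSq_eq_conj_mul_self, Complex.ofReal_re,
      Complex.normSq_eq_norm_sq]
    simp
    ring
  rw [integral_norm_sq_eq' hXc.1, integral_norm_sq_eq' hX.1] at e
  rw [← ENNReal.toReal_eq_toReal_iff' (by simp [f2.ne]) f1.ne, ENNReal.toReal_add f2.ne (by simp),
    ← e]
  simp

section

variable [MeasurableSpace PSL(2, ℂ)] [BorelSpace PSL(2, ℂ)]

/-- The average of the pull-backs of a form. -/
def formAvg (m : Measure PSL(2, ℂ)) (φ : ℂ → ℂ) (z : ℂ) : ℂ := ∫ g, pullBack g φ z ∂m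

theorem measurable_mob_swap : Measurable fun q : ℂ × PSL(2, ℂ) => mob q.2 q.1 :=
  Measurable.comp (g := fun p : PSL(2, ℂ) × ℂ => mob p.1 p.2) (f := Prod.swap) measurable_mob
    measurable_swap

theorem measurable_mobDeriv_swap : Measurable fun q : ℂ × PSL(2, ℂ) => mobDeriv q.2 q.1 :=
  Measurable.comp (g := fun p : PSL(2, ℂ) × ℂ => mobDeriv p.1 p.2) (f := Prod.swap)
    measurable_mobDeriv measurable_swap

/-- Each g has at most one pole in the plane. Fubini exchanges the quantifiers, so that the chain
rule can be used under the integral over g. -/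
theorem ae_mobDeriv_prod (m : Measure PSL(2, ℂ)) [SFinite m] :
    ∀ᵐ z, ∀ᵐ g ∂m, mobDeriv g z ≠ 0 := by
  have hm : MeasurableSet {q : ℂ × PSL(2, ℂ) | mobDeriv q.2 q.1 ≠ 0} :=
    (measurable_mobDeriv_swap (measurableSet_singleton 0)).compl
  rw [Measure.ae_ae_comm hm]
  exact .of_forall ae_mobDeriv_ne_zero

theorem quasiMeasurePreserving_mob_prod (m : Measure PSL(2, ℂ)) [SFinite m] :
    Measure.QuasiMeasurePreserving (fun q : ℂ × PSL(2, ℂ) => mob q.2 q.1)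
      (volume.prod m) volume := by
  refine ⟨measurable_mob_swap, Measure.AbsolutelyContinuous.mk fun s hs h0 => ?_⟩
  rw [Measure.map_apply measurable_mob_swap hs,
    Measure.measure_prod_null (measurable_mob_swap hs)]
  have hm : MeasurableSet {q : ℂ × PSL(2, ℂ) | mob q.2 q.1 ∉ s} := (measurable_mob_swap hs).compl
  have h1 : ∀ᵐ z, ∀ᵐ g ∂m, mob g z ∉ s := by
    rw [Measure.ae_ae_comm hm]
    exact .of_forall fun g => ae_mob g (measure_eq_zero_iff_ae_notMem.1 h0)
  filter_upwards [h1] with z hz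
  exact measure_eq_zero_iff_ae_notMem.2 hz

variable (m : Measure PSL(2, ℂ)) [IsProbabilityMeasure m]

theorem aestronglyMeasurable_pullBack {φ : ℂ → ℂ} (hφ : AEStronglyMeasurable φ volume) :
    AEStronglyMeasurable (fun q : ℂ × PSL(2, ℂ) => pullBack q.2 φ q.1) (volume.prod m) :=
  (hφ.comp_quasiMeasurePreserving (quasiMeasurePreserving_mob_prod m)).mul
    measurable_mobDeriv_swap.aestronglyMeasurable

theorem lintegral_lintegral_pullBack {φ : ℂ → ℂ} (hφ : AEStronglyMeasurable φ volume) :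
    ∫⁻ z, ∫⁻ g, ‖pullBack g φ z‖ₑ ^ 2 ∂m = sqNorm φ := by
  rw [lintegral_lintegral_swap (f := fun z g => ‖pullBack g φ z‖ₑ ^ 2)
    ((aestronglyMeasurable_pullBack m hφ).enorm.pow_const 2)]
  simp only [lintegral_pullBack]
  simp [sqNorm]

theorem ae_memLp_pullBack {φ : ℂ → ℂ} (hφ : MemLp φ 2 volume) :
    ∀ᵐ z, MemLp (fun g => pullBack g φ z) 2 m := by
  have h1 := aestronglyMeasurable_pullBack m hφ.1
  have h2 : ∫⁻ z, ∫⁻ g, ‖pullBack g φ z‖ₑ ^ 2 ∂m ≠ ⊤ := by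
    rw [lintegral_lintegral_pullBack m hφ.1]
    exact ((memLp_two_iff hφ.1).1 hφ).ne
  have h3 := ae_lt_top' (AEMeasurable.lintegral_prod_right' (h1.enorm.pow_const 2)) h2
  filter_upwards [h1.prodMk_left, h3] with z hz1 hz2
  exact (memLp_two_iff hz1).2 hz2

theorem aestronglyMeasurable_formAvg {φ : ℂ → ℂ} (hφ : AEStronglyMeasurable φ volume) :
    AEStronglyMeasurable (formAvg m φ) volume :=
  (aestronglyMeasurable_pullBack m hφ).integral_prod_right'

/-- The defect of the contraction property of the averages of forms. -/
theorem lintegral_formAvg_variance {φ : ℂ → ℂ} (hφ : MemLp φ 2 volume) :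
    ∫⁻ g, (∫⁻ z, ‖pullBack g φ z - formAvg m φ z‖ₑ ^ 2) ∂m + sqNorm (formAvg m φ) = sqNorm φ := by
  have h1 := aestronglyMeasurable_pullBack m hφ.1
  have h2 := aestronglyMeasurable_formAvg m hφ.1
  have h3 : AEMeasurable (fun q : ℂ × PSL(2, ℂ) => ‖pullBack q.2 φ q.1 - formAvg m φ q.1‖ₑ ^ 2)
      (volume.prod m) :=
    ((h1.sub (h2.comp_quasiMeasurePreserving Measure.quasiMeasurePreserving_fst)).enorm).pow_const 2
  rw [← lintegral_lintegral_swap (f := fun z g => ‖pullBack g φ z - formAvg m φ z‖ₑ ^ 2) h3, sqNorm,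
    ← lintegral_add_left' (AEMeasurable.lintegral_prod_right' h3),
    ← lintegral_lintegral_pullBack m hφ.1]
  refine lintegral_congr_ae ?_
  filter_upwards [ae_memLp_pullBack m hφ] with z hz
  exact lintegral_variance hz

theorem sqNorm_formAvg_le {φ : ℂ → ℂ} (hφ : MemLp φ 2 volume) :
    sqNorm (formAvg m φ) ≤ sqNorm φ := by
  rw [← lintegral_formAvg_variance m hφ]
  exact le_add_self

theorem memLp_formAvg {φ : ℂ → ℂ} (hφ : MemLp φ 2 volume) : MemLp (formAvg m φ) 2 volume :=
  (memLp_two_iff (aestronglyMeasurable_formAvg m hφ.1)).2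
    ((sqNorm_formAvg_le m hφ).trans_lt ((memLp_two_iff hφ.1).1 hφ))

/-- Pull-back is contravariant: the factor that moves points last acts on forms first. -/
theorem formAvg_mconv (m' : Measure PSL(2, ℂ)) [IsProbabilityMeasure m'] {φ : ℂ → ℂ}
    (hφ : MemLp φ 2 volume) :
    formAvg (m'.mconv m) φ =ᵐ[volume] formAvg m (formAvg m' φ) := by
  filter_upwards [ae_memLp_pullBack (m'.mconv m) hφ, ae_mobDeriv_prod m] with z hz hz'
  have hi := hz.integrable (by norm_num)
  have hmul : Measurable fun p : PSL(2, ℂ) × PSL(2, ℂ) => p.1 * p.2 := measurable_mul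
  have hi' : Integrable (fun p : PSL(2, ℂ) × PSL(2, ℂ) => pullBack (p.1 * p.2) φ z)
      (m'.prod m) := hi.comp_measurable hmul
  rw [formAvg, Measure.mconv, integral_map hmul.aemeasurable hi.1,
    integral_prod_symm _ hi', formAvg]
  refine integral_congr_ae ?_
  filter_upwards [hz'] with g hg
  simp only [pullBack_mul _ g φ hg]
  rw [pullBack, formAvg, ← integral_mul_const]
  rfl

end


/-! ### Subadditivity of log ‖g‖ and domination of test functions -/

theorem log_opNorm_nonneg (g : PSL(2, ℂ)) : 0 ≤ Real.log (opNorm g) :=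
  Real.log_nonneg (one_le_opNorm g)

theorem log_opNorm_mul_le (g g' : PSL(2, ℂ)) :
    Real.log (opNorm (g * g')) ≤ Real.log (opNorm g) + Real.log (opNorm g') := by
  have h1 := one_le_opNorm g
  have h2 := one_le_opNorm g'
  have h3 := one_le_opNorm (g * g')
  rw [← Real.log_mul (by positivity) (by positivity)]
  exact Real.log_le_log (by positivity) (opNorm_mul_le g g')

theorem fubiniStudyDensity_pos (z : ℂ) : 0 < 1 / (Real.pi * (1 + ‖z‖ ^ 2) ^ 2) := by
  have := Real.pi_pos
  positivity

/-- Converts integrability for the Fubini-Study measure into integrability against test functions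
for Lebesgue measure. -/
theorem exists_enorm_le_fubiniStudyDensity {φ : ℂ → ℂ} (hφ : Continuous φ)
    (hc : HasCompactSupport φ) :
    ∃ C : ℝ≥0∞, C ≠ ⊤ ∧ ∀ z, ‖φ z‖ₑ ≤ C * fubiniStudyDensity z := by
  have hpi := Real.pi_pos
  have hψ : Continuous fun z => φ z * ((Real.pi * (1 + ‖z‖ ^ 2) ^ 2 : ℝ) : ℂ) := by fun_prop
  obtain ⟨C, hC⟩ := (hc.mul_right (f' := fun z => ((Real.pi * (1 + ‖z‖ ^ 2) ^ 2 : ℝ) : ℂ))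
    ).exists_bound_of_continuous hψ
  refine ⟨ENNReal.ofReal C, ENNReal.ofReal_ne_top, fun z => ?_⟩
  rw [← ofReal_norm, fubiniStudyDensity, ← ENNReal.ofReal_mul' (fubiniStudyDensity_pos z).le]
  refine ENNReal.ofReal_le_ofReal ?_
  have h1 := hC z
  rw [Pi.mul_apply, norm_mul, Complex.norm_real, Real.norm_of_nonneg (by positivity)] at h1
  rw [mul_one_div, le_div_iff₀ (by positivity)]
  exact h1

theorem delNorm_sq {h : P1 → ℝ} {g : Fin 2 → ℂ → ℂ} (hd : HasDel h g) :
    delNorm h ^ 2 = 2 * (sqNorm (g 0)).toReal := by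
  rw [hd.delNorm_eq, Real.sq_sqrt, integral_norm_sq_eq (hd 0).1.1]
  · rfl
  · exact mul_nonneg (by norm_num) (integral_nonneg fun z => by positivity)

section

variable [MeasurableSpace PSL(2, ℂ)] [BorelSpace PSL(2, ℂ)]

/-! ### Convolution powers and moments -/

instance isProbabilityMeasure_convPow (μ : Measure PSL(2, ℂ)) [IsProbabilityMeasure μ] (n : ℕ) :
    IsProbabilityMeasure (convPow μ n) := by
  induction n with
  | zero => exact Measure.dirac.isProbabilityMeasure
  | succ n ih => exact Measure.probabilitymeasure_of_probabilitymeasures_mconv μ (convPow μ n)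

theorem convPow_add (μ : Measure PSL(2, ℂ)) [IsProbabilityMeasure μ] (n k : ℕ) :
    convPow μ (n + k) = (convPow μ n).mconv (convPow μ k) := by
  induction n with
  | zero => rw [zero_add, convPow, Measure.dirac_one_mconv]
  | succ n ih => rw [Nat.succ_add, convPow, ih, convPow, Measure.mconv_assoc]

theorem convPow_one (μ : Measure PSL(2, ℂ)) [IsProbabilityMeasure μ] : convPow μ 1 = μ := by
  rw [convPow, convPow, Measure.mconv_dirac_one]

theorem convPow_succ' (μ : Measure PSL(2, ℂ)) [IsProbabilityMeasure μ] (n : ℕ) :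
    convPow μ (n + 1) = (convPow μ n).mconv μ := by
  rw [convPow_add, convPow_one]

theorem measurable_log_opNorm : Measurable fun g : PSL(2, ℂ) => Real.log (opNorm g) :=
  Real.measurable_log.comp continuous_opNorm.measurable

theorem HasFiniteFirstMoment.integrable {m : Measure PSL(2, ℂ)} (hm : HasFiniteFirstMoment m) :
    Integrable (fun g => Real.log (opNorm g)) m := by
  refine ⟨measurable_log_opNorm.aestronglyMeasurable, ?_⟩
  rw [hasFiniteIntegral_iff_ofReal (.of_forall log_opNorm_nonneg)]
  exact hm

theorem HasFiniteFirstMoment.mconv {m m' : Measure PSL(2, ℂ)} [IsProbabilityMeasure m]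
    [IsProbabilityMeasure m'] (h : HasFiniteFirstMoment m) (h' : HasFiniteFirstMoment m') :
    HasFiniteFirstMoment (m.mconv m') := by
  have hl : Measurable fun g : PSL(2, ℂ) => ENNReal.ofReal (Real.log (opNorm g)) :=
    measurable_log_opNorm.ennreal_ofReal
  rw [HasFiniteFirstMoment, Measure.lintegral_mconv hl]
  calc ∫⁻ x, ∫⁻ y, ENNReal.ofReal (Real.log (opNorm (x * y))) ∂m' ∂m
      ≤ ∫⁻ x, ∫⁻ y, (ENNReal.ofReal (Real.log (opNorm x)) +
          ENNReal.ofReal (Real.log (opNorm y))) ∂m' ∂m := by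
        refine lintegral_mono fun x => lintegral_mono fun y => ?_
        rw [← ENNReal.ofReal_add (log_opNorm_nonneg x) (log_opNorm_nonneg y)]
        exact ENNReal.ofReal_le_ofReal (log_opNorm_mul_le x y)
    _ = ∫⁻ x, ENNReal.ofReal (Real.log (opNorm x)) ∂m +
          ∫⁻ y, ENNReal.ofReal (Real.log (opNorm y)) ∂m' := by
        have : ∀ x : PSL(2, ℂ), ∫⁻ y, (ENNReal.ofReal (Real.log (opNorm x)) +
            ENNReal.ofReal (Real.log (opNorm y))) ∂m' = ENNReal.ofReal (Real.log (opNorm x)) +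
            ∫⁻ y, ENNReal.ofReal (Real.log (opNorm y)) ∂m' := fun x => by
          rw [lintegral_add_left measurable_const]
          simp
        simp only [this]
        rw [lintegral_add_left hl]
        simp
    _ < ⊤ := ENNReal.add_lt_top.2 ⟨h, h'⟩

theorem hasFiniteFirstMoment_dirac (g : PSL(2, ℂ)) : HasFiniteFirstMoment (Measure.dirac g) := by
  rw [HasFiniteFirstMoment, lintegral_dirac' _ measurable_log_opNorm.ennreal_ofReal]
  exact ENNReal.ofReal_lt_top

theorem HasFiniteFirstMoment.convPow {μ : Measure PSL(2, ℂ)} [IsProbabilityMeasure μ]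
    (h : HasFiniteFirstMoment μ) (n : ℕ) : HasFiniteFirstMoment (convPow μ n) := by
  induction n with
  | zero => exact hasFiniteFirstMoment_dirac 1
  | succ n ih => exact h.mconv ih

/-! ### The transfer operator on the Sobolev space -/

variable {m : Measure PSL(2, ℂ)} [IsProbabilityMeasure m]

theorem measurable_smul_swap : Measurable fun q : P1 × PSL(2, ℂ) => q.2 • q.1 :=
  (continuous_snd.smul continuous_fst).measurable

/-- By the Poincaré inequality for h ∘ g and the logarithmic bound on its mean, the L¹ norm of h ∘ g
is at most affine in log ‖g‖, and the first moment integrates it. This gives the almost everywhere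
absolute convergence of the transfer operator and justifies the later uses of Fubini. -/
theorem integrable_smul_prod (hm : HasFiniteFirstMoment m) {h : P1 → ℝ} (hh : MemW12 h)
    (hmeas : Measurable h) :
    Integrable (fun q : P1 × PSL(2, ℂ) => h (q.2 • q.1)) (fubiniStudy.prod m) := by
  obtain ⟨C, hC, H⟩ := exists_poincare
  obtain ⟨C', hC', H'⟩ := exists_mean_smul_sub_le
  have hms : AEStronglyMeasurable (fun q : P1 × PSL(2, ℂ) => h (q.2 • q.1)) (fubiniStudy.prod m) :=
    (hmeas.comp measurable_smul_swap).aestronglyMeasurable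
  rw [integrable_prod_iff' hms]
  refine ⟨.of_forall fun g => integrable_comp_smul hh.1 g, ?_⟩
  have hb : Integrable (fun g => C * delNorm h + C' * (1 + Real.log (opNorm g)) * delNorm h +
      |∫ x, h x ∂fubiniStudy|) m :=
    ((integrable_const _).add ((((integrable_const _).add hm.integrable).const_mul _).mul_const
      _)).add (integrable_const _)
  refine hb.mono' hms.norm.prod_swap.integral_prod_right' (.of_forall fun g => ?_)
  rw [Real.norm_of_nonneg (integral_nonneg fun x => norm_nonneg _)]
  have h1 := H _ (memW12_comp_smul hh g)
  have h2 := H' h hh g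
  rw [delNorm_comp_smul hh] at h1
  set c := ∫ x, h (g • x) ∂fubiniStudy
  have hi := integrable_comp_smul hh.1 g
  calc ∫ x, ‖h (g • x)‖ ∂fubiniStudy ≤ ∫ x, (|h (g • x) - c| + |c|) ∂fubiniStudy := by
        refine integral_mono hi.norm ((hi.sub (integrable_const c)).abs.add (integrable_const _))
          fun x => ?_
        have := abs_add_le (h (g • x) - c) c
        simpa using this
    _ = ∫ x, |h (g • x) - c| ∂fubiniStudy + |c| := by
        rw [integral_add (f := fun x => |h (g • x) - c|) (hi.sub (integrable_const c)).abs
          (integrable_const _)]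
        simp
    _ ≤ C * delNorm h + (C' * (1 + Real.log (opNorm g)) * delNorm h +
        |∫ x, h x ∂fubiniStudy|) := by
        gcongr
        have := abs_sub_abs_le_abs_sub c (∫ x, h x ∂fubiniStudy)
        linarith
    _ = _ := by ring

theorem integrable_chart_prod {h : P1 → ℝ} (hmeas : Measurable h)
    (hi : Integrable (fun q : P1 × PSL(2, ℂ) => h (q.2 • q.1)) (fubiniStudy.prod m))
    {φ : ℂ → ℂ} (hφ : Continuous φ) (hc : HasCompactSupport φ) :
    Integrable (fun q : ℂ × PSL(2, ℂ) => (h (q.2 • chart 0 q.1) : ℂ) * φ q.1)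
      (volume.prod m) := by
  obtain ⟨C, hC, hφC⟩ := exists_enorm_le_fubiniStudyDensity hφ hc
  have hs : Measurable fun q : ℂ × PSL(2, ℂ) => q.2 • chart 0 q.1 :=
    (continuous_snd.smul ((continuous_chart 0).comp continuous_fst)).measurable
  refine ⟨((Complex.measurable_ofReal.comp (hmeas.comp hs)).mul
    (hφ.measurable.comp measurable_fst)).aestronglyMeasurable, ?_⟩
  have hsm : Measurable fun q : P1 × PSL(2, ℂ) => ‖h (q.2 • q.1)‖ₑ :=
    (hmeas.comp measurable_smul_swap).enorm
  have hfin := hi.2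
  rw [hasFiniteIntegral_iff_enorm, lintegral_prod _ hsm.aemeasurable,
    lintegral_fubiniStudy hsm.lintegral_prod_right'] at hfin
  rw [hasFiniteIntegral_iff_enorm, lintegral_prod _ (Measurable.aemeasurable (by
    exact ((Complex.measurable_ofReal.comp (hmeas.comp hs)).mul
      (hφ.measurable.comp measurable_fst)).enorm))]
  calc ∫⁻ z, ∫⁻ g, ‖(h (g • chart 0 z) : ℂ) * φ z‖ₑ ∂m
      ≤ ∫⁻ z, C * (fubiniStudyDensity z * ∫⁻ g, ‖h (g • chart 0 z)‖ₑ ∂m) := by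
        refine lintegral_mono fun z => ?_
        rw [← mul_assoc, ← lintegral_const_mul _ (f := fun g : PSL(2, ℂ) => ‖h (g • chart 0 z)‖ₑ)
          (hsm.comp measurable_prodMk_left)]
        refine lintegral_mono fun g => ?_
        rw [enorm_mul, mul_comm]
        refine mul_le_mul' (hφC z) (le_of_eq ?_)
        simp [enorm_eq_nnnorm]
    _ = C * ∫⁻ z, fubiniStudyDensity z * ∫⁻ g, ‖h (g • chart 0 z)‖ₑ ∂m :=
        lintegral_const_mul' _ _ hC
    _ < ⊤ := ENNReal.mul_lt_top hC.lt_top hfin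

theorem integrable_pullBack_prod {φ ψ : ℂ → ℂ} (hφ : MemLp φ 2 volume) (hψ : MemLp ψ 2 volume) :
    Integrable (fun q : ℂ × PSL(2, ℂ) => pullBack q.2 φ q.1 * ψ q.1) (volume.prod m) := by
  have h1 : MemLp (fun q : ℂ × PSL(2, ℂ) => pullBack q.2 φ q.1) 2 (volume.prod m) := by
    have ha := aestronglyMeasurable_pullBack m hφ.1
    rw [memLp_two_iff ha, lintegral_prod _ (ha.enorm.pow_const 2),
      lintegral_lintegral_pullBack m hφ.1]
    exact (memLp_two_iff hφ.1).1 hφ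
  have h2 : MemLp (fun q : ℂ × PSL(2, ℂ) => ψ q.1) 2 (volume.prod m) := hψ.comp_fst m
  exact h1.integrable_mul h2

/-- Derivative of the average of a function. -/
theorem HasDel.hasWeakWirtinger_average {h : P1 → ℝ} {g : Fin 2 → ℂ → ℂ} (hd : HasDel h g)
    (hh : Integrable h fubiniStudy) (hmeas : Measurable h)
    (hi : Integrable (fun q : P1 × PSL(2, ℂ) => h (q.2 • q.1)) (fubiniStudy.prod m)) :
    HasWeakWirtinger (fun z => ∫ γ, h (γ • chart 0 z) ∂m) (formAvg m (g 0)) := by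
  have hL := memLp_formAvg m (hd 0).1
  refine ⟨locallyIntegrable_chart_zero (h := fun x => ∫ γ, h (γ • x) ∂m) hi.integral_prod_left,
    hL.locallyIntegrable (by norm_num), fun φ hφ hc => ?_⟩
  have i1 := integrable_chart_prod hmeas hi (continuous_wirtinger hφ)
    (hasCompactSupport_wirtinger hc)
  have hφ2 : MemLp φ 2 volume := hφ.continuous.memLp_of_hasCompactSupport hc
  have i2 := integrable_pullBack_prod (m := m) (hd 0).1 hφ2
  calc ∫ z, ((∫ γ, h (γ • chart 0 z) ∂m : ℝ) : ℂ) * wirtinger φ z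
      = ∫ z, ∫ γ, (h (γ • chart 0 z) : ℂ) * wirtinger φ z ∂m := by
        refine integral_congr_ae (.of_forall fun z => ?_)
        simp only
        rw [integral_mul_const, integral_complex_ofReal]
    _ = ∫ γ, (∫ z, (h (γ • chart 0 z) : ℂ) * wirtinger φ z) ∂m :=
        integral_integral_swap (f := fun z γ => (h (γ • chart 0 z) : ℂ) * wirtinger φ z) i1
    _ = ∫ γ, (-∫ z, pullBack γ (g 0) z * φ z) ∂m := by
        refine integral_congr_ae (.of_forall fun γ => ?_)
        exact (hd.hasWeakWirtinger_smul γ (locallyIntegrable_smul_chart hh γ)).2.2 φ hφ hc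
    _ = -∫ z, ∫ γ, pullBack γ (g 0) z * φ z ∂m := by
        rw [integral_neg, integral_integral_swap (f := fun z γ => pullBack γ (g 0) z * φ z) i2]
    _ = _ := by
        congr 1
        refine integral_congr_ae (.of_forall fun z => ?_)
        simp only
        rw [integral_mul_const]
        rfl

/-- The average of a function over a measure on the group. -/
def funAvg (m : Measure PSL(2, ℂ)) (h : P1 → ℝ) (x : P1) : ℝ := ∫ γ, h (γ • x) ∂m

theorem HasFiniteFirstMoment.map_mul_right (hm : HasFiniteFirstMoment m) (g : PSL(2, ℂ)) :
    HasFiniteFirstMoment (m.map (· * g)) := by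
  have : m.map (· * g) = m.mconv (Measure.dirac g) := (Measure.mconv_dirac m g).symm
  rw [this]
  exact hm.mconv (hasFiniteFirstMoment_dirac g)

/-- In the second coordinate the same computation applies to the law of γ multiplied on the right by
the exchange of coordinates. -/
theorem HasDel.funAvg {h : P1 → ℝ} {g : Fin 2 → ℂ → ℂ} (hd : HasDel h g)
    (hh : Integrable h fubiniStudy) (hmeas : Measurable h) (hm : HasFiniteFirstMoment m) :
    HasDel (funAvg m h) ![formAvg m (g 0), formAvg (m.map (· * toPSL swapSL)) (g 0)] := by
  have hmul : Measurable fun γ : PSL(2, ℂ) => γ * toPSL swapSL := measurable_mul_const _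
  have hp : IsProbabilityMeasure (m.map (· * toPSL swapSL)) :=
    Measure.isProbabilityMeasure_map hmul.aemeasurable
  have hW : MemW12 h := ⟨hh, g, hd⟩
  have h1 := hd.hasWeakWirtinger_average hh hmeas (integrable_smul_prod hm hW hmeas)
  have h2 := hd.hasWeakWirtinger_average hh hmeas
    (integrable_smul_prod (hm.map_mul_right (toPSL swapSL)) hW hmeas)
  refine hasDel_of_swap h1 ?_ (memLp_formAvg m (hd 0).1) (memLp_formAvg _ (hd 0).1)
  convert h2 using 2 with z
  rw [RandomProducts.funAvg, integral_map hmul.aemeasurable]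
  · simp only [smul_smul]
  · exact (hmeas.comp (continuous_id.smul continuous_const).measurable).aestronglyMeasurable

theorem memW12_funAvg {h : P1 → ℝ} (hh : MemW12 h) (hmeas : Measurable h)
    (hm : HasFiniteFirstMoment m) : MemW12 (funAvg m h) := by
  obtain ⟨hi, g, hd⟩ := hh
  exact ⟨(integrable_smul_prod hm ⟨hi, g, hd⟩ hmeas).integral_prod_left, _, hd.funAvg hi hmeas hm⟩

theorem integral_funAvg {h : P1 → ℝ} (hh : MemW12 h) (hmeas : Measurable h)
    (hm : HasFiniteFirstMoment m) :
    ∫ x, funAvg m h x ∂fubiniStudy = ∫ γ, (∫ x, h (γ • x) ∂fubiniStudy) ∂m :=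
  integral_integral_swap (f := fun x γ => h (γ • x)) (integrable_smul_prod hm hh hmeas)

end


/-! ### A non-elementary measure has no invariant measure -/

theorem isCompact_matNorm_le (R : ℝ) : IsCompact {A : Matrix (Fin 2) (Fin 2) ℂ | matNorm A ≤ R} := by
  have hK : IsCompact {A : Fin 2 → Fin 2 → ℂ | ∀ i j, A i j ∈ Metric.closedBall (0 : ℂ) R} := by
    have h1 : IsCompact (Set.pi univ fun _ : Fin 2 => Set.pi univ fun _ : Fin 2 =>
        Metric.closedBall (0 : ℂ) R) :=
      isCompact_univ_pi fun _ => isCompact_univ_pi fun _ => isCompact_closedBall 0 R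
    convert h1 using 1
    ext A
    simp
  refine IsCompact.of_isClosed_subset (X := Matrix (Fin 2) (Fin 2) ℂ) hK
    (isClosed_le continuous_matNorm continuous_const) fun A hA i j => ?_
  rw [mem_closedBall_zero_iff]
  exact (norm_entry_le A i j).trans hA

theorem isCompact_opNorm_le (R : ℝ) : IsCompact {g : PSL(2, ℂ) | opNorm g ≤ R} := by
  have hcl : IsClosed {A : Matrix (Fin 2) (Fin 2) ℂ | A.det = 1} :=
    isClosed_eq (continuous_id.matrix_det) continuous_const
  have hemb : IsClosedEmbedding (Subtype.val : SL(2, ℂ) → Matrix (Fin 2) (Fin 2) ℂ) :=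
    hcl.isClosedEmbedding_subtypeVal
  have h1 := hemb.isCompact_preimage (isCompact_matNorm_le R)
  have h2 := h1.image isOpenQuotientMap_toPSL.continuous
  convert h2 using 1
  ext g
  constructor
  · intro hg
    obtain ⟨A, rfl⟩ := isOpenQuotientMap_toPSL.surjective g
    exact ⟨A, hg, rfl⟩
  · rintro ⟨A, hA, rfl⟩
    exact hA

theorem eq_zero_of_mulVec_eq_zero {B : Matrix (Fin 2) (Fin 2) ℂ} {v w : Fin 2 → ℂ}
    (hvw : v 0 * w 1 ≠ v 1 * w 0) (hv : B.mulVec v = 0) (hw : B.mulVec w = 0) : B = 0 := by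
  have hv' := fun i => congrFun hv i
  have hw' := fun i => congrFun hw i
  simp only [Matrix.mulVec, dotProduct, Fin.sum_univ_two, Pi.zero_apply] at hv' hw'
  have h : v 0 * w 1 - v 1 * w 0 ≠ 0 := sub_ne_zero.2 hvw
  have c0 : ∀ i, B i 0 = 0 := fun i => by
    have : (v 0 * w 1 - v 1 * w 0) * B i 0 = 0 := by linear_combination w 1 * hv' i - v 1 * hw' i
    exact (mul_eq_zero.1 this).resolve_left h
  have c1 : ∀ i, B i 1 = 0 := fun i => by
    have : (v 0 * w 1 - v 1 * w 0) * B i 1 = 0 := by linear_combination v 0 * hw' i - w 0 * hv' i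
    exact (mul_eq_zero.1 this).resolve_left h
  ext i j
  fin_cases j
  · exact c0 i
  · exact c1 i

theorem toP1_mulVec_eq {B : Matrix (Fin 2) (Fin 2) ℂ} (hB : B.det = 0) {v w : Fin 2 → ℂ}
    (hv : B.mulVec v ≠ 0) (hw : B.mulVec w ≠ 0) : toP1 ⟨_, hv⟩ = toP1 ⟨_, hw⟩ := by
  rw [toP1_eq_iff]
  rw [Matrix.det_fin_two] at hB
  simp only [Matrix.mulVec, dotProduct, Fin.sum_univ_two]
  linear_combination (v 0 * w 1 - v 1 * w 0) * hB

/-- Along a divergent sequence of group elements, a subsequence converges to a constant map outside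
a point. -/
theorem exists_tendsto_const {A : ℕ → SL(2, ℂ)}
    (hA : Tendsto (fun k => matNorm (A k).1) atTop atTop) :
    ∃ (p q : P1) (σ : ℕ → ℕ), StrictMono σ ∧
      ∀ x, x ≠ q → Tendsto (fun k => toPSL (A (σ k)) • x) atTop (𝓝 p) := by
  have hpos : ∀ k, 0 < matNorm (A k).1 := fun k => one_pos.trans_le (one_le_matNorm _)
  -- After normalization the determinants ‖A_k‖⁻² tend to 0 while the norms stay 1, so a limit B0
  -- has rank one: p is its image and q its kernel.
  set B : ℕ → Matrix (Fin 2) (Fin 2) ℂ := fun k => ((matNorm (A k).1 : ℂ)⁻¹) • (A k).1 with hBdef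
  have hB1 : ∀ k, matNorm (B k) = 1 := fun k => by
    rw [hBdef, matNorm_smul, norm_inv, Complex.norm_real, Real.norm_of_nonneg (hpos k).le,
      inv_mul_cancel₀ (hpos k).ne']
  have : FirstCountableTopology (Matrix (Fin 2) (Fin 2) ℂ) :=
    inferInstanceAs (FirstCountableTopology (Fin 2 → Fin 2 → ℂ))
  obtain ⟨B0, -, σ, hσ, hlim⟩ := (isCompact_matNorm_le 1).tendsto_subseq (x := B)
    fun k => (hB1 k).le
  have hN : matNorm B0 = 1 := by
    have h1 := (continuous_matNorm.tendsto B0).comp hlim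
    have h2 : (matNorm ∘ (B ∘ σ)) = fun _ => 1 := funext fun k => hB1 (σ k)
    rw [h2] at h1
    exact tendsto_nhds_unique h1 tendsto_const_nhds |>.symm ▸ rfl
  have hdet : B0.det = 0 := by
    have h1 := ((continuous_id.matrix_det (n := Fin 2) (R := ℂ)).tendsto B0).comp hlim
    have h2 : Tendsto (fun k => ((matNorm (A (σ k)).1 : ℂ)⁻¹) ^ 2) atTop (𝓝 0) := by
      have h3 : Tendsto (fun k => (((matNorm (A (σ k)).1)⁻¹ : ℝ) : ℂ)) atTop (𝓝 ((0 : ℝ) : ℂ)) :=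
        (Complex.continuous_ofReal.tendsto 0).comp
          (tendsto_inv_atTop_zero.comp (hA.comp hσ.tendsto_atTop))
      have h4 := h3.pow 2
      simpa using h4
    have h5 : (fun k => ((matNorm (A (σ k)).1 : ℂ)⁻¹) ^ 2) =
        (fun M : Matrix (Fin 2) (Fin 2) ℂ => (id M).det) ∘ (B ∘ σ) := by
      ext k
      simp [hBdef, Matrix.det_smul]
    rw [h5] at h2
    exact tendsto_nhds_unique h1 h2
  have hB0 : B0 ≠ 0 := by
    rintro rfl
    have : matNorm (0 : Matrix (Fin 2) (Fin 2) ℂ) = 0 := by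
      have := matNorm_smul 0 (0 : Matrix (Fin 2) (Fin 2) ℂ)
      simpa using this
    linarith
  have hconv : ∀ (v : {v : Fin 2 → ℂ // v ≠ 0}) (hv : B0.mulVec v.1 ≠ 0),
      Tendsto (fun k => toPSL (A (σ k)) • toP1 v) atTop (𝓝 (toP1 ⟨_, hv⟩)) := by
    intro v hv
    have hne : ∀ k, (B k).mulVec v.1 ≠ 0 := fun k => by
      rw [hBdef, Matrix.smul_mulVec]
      refine smul_ne_zero (inv_ne_zero ?_) (SL_mulVec_ne_zero _ v.2)
      exact_mod_cast (hpos k).ne'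
    have e : ∀ k, toPSL (A k) • toP1 v = toP1 ⟨(B k).mulVec v.1, hne k⟩ := fun k => by
      rw [toPSL_smul_toP1 _ _ (SL_mulVec_ne_zero _ v.2), toP1_eq_iff]
      simp only [hBdef, Matrix.smul_mulVec, Pi.smul_apply, smul_eq_mul]
      ring
    simp only [e]
    refine (isOpenQuotientMap_toP1.continuous.tendsto _).comp ?_
    rw [tendsto_subtype_rng]
    have hc : Continuous fun M : Matrix (Fin 2) (Fin 2) ℂ => M.mulVec v.1 :=
      Continuous.matrix_mulVec continuous_id continuous_const
    exact (hc.tendsto B0).comp hlim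
  obtain ⟨w, hw⟩ : ∃ w : Fin 2 → ℂ, B0.mulVec w ≠ 0 := by
    by_contra! hall
    exact hB0 (eq_zero_of_mulVec_eq_zero (v := ![1, 0]) (w := ![0, 1]) (by simp) (hall _) (hall _))
  by_cases hq : ∃ q : {v : Fin 2 → ℂ // v ≠ 0}, B0.mulVec q.1 = 0
  · obtain ⟨q, hq⟩ := hq
    refine ⟨toP1 ⟨_, hw⟩, toP1 q, σ, hσ, fun x hx => ?_⟩
    obtain ⟨v, rfl⟩ := isOpenQuotientMap_toP1.surjective x
    have hv : B0.mulVec v.1 ≠ 0 := fun hv => by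
      rw [Ne, toP1_eq_iff] at hx
      exact hB0 (eq_zero_of_mulVec_eq_zero hx hv hq)
    rw [← toP1_mulVec_eq hdet hv hw]
    exact hconv v hv
  -- A singular matrix has a kernel, so this case is vacuous; without a kernel vector, convergence
  -- would hold everywhere and q would be arbitrary.
  · push Not at hq
    refine ⟨toP1 ⟨_, hw⟩, toP1 ⟨_, hw⟩, σ, hσ, fun x _ => ?_⟩
    obtain ⟨v, rfl⟩ := isOpenQuotientMap_toP1.surjective x
    rw [← toP1_mulVec_eq hdet (hq v) hw]
    exact hconv v (hq v)

theorem measurable_const_smul_P1 (g : PSL(2, ℂ)) : Measurable fun x : P1 => g • x :=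
  (continuous_const_smul g).measurable

theorem integrable_continuous_P1 {M : Measure P1} [IsFiniteMeasure M] {f : P1 → ℝ}
    (hf : Continuous f) : Integrable f M :=
  hf.integrable_of_hasCompactSupport (HasCompactSupport.of_compactSpace f)

theorem measure_ext_P1 {M M' : Measure P1} [IsFiniteMeasure M] [IsFiniteMeasure M']
    (h : ∀ f : C(P1, ℝ), ∫ x, f x ∂M = ∫ x, f x ∂M') : M = M' :=
  ext_of_forall_integral_eq_of_IsFiniteMeasure fun f => h f.toContinuousMap

/-- If the norms were unbounded on T, some sequence in T would send every x ≠ q to a single point p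
in the limit. As M does not charge q, dominated convergence and invariance would give M = δ_p, which
has an atom. -/
theorem opNorm_le_of_map_eq {M : Measure P1} [IsProbabilityMeasure M] (hM : ∀ x, M {x} = 0)
    {T : Set PSL(2, ℂ)} (hT : ∀ g ∈ T, M.map (g • ·) = M) : ∃ R, ∀ g ∈ T, opNorm g ≤ R := by
  by_contra! hcon
  choose g hgT hg using fun k : ℕ => hcon k
  choose A hA using fun k => isOpenQuotientMap_toPSL.surjective (g k)
  have hlim : Tendsto (fun k => matNorm (A k).1) atTop atTop := by
    refine tendsto_atTop_mono (fun k => ?_) tendsto_natCast_atTop_atTop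
    rw [← opNorm_toPSL, hA]
    exact (hg k).le
  obtain ⟨p, q, σ, -, hpq⟩ := exists_tendsto_const hlim
  have hae : ∀ᵐ x ∂M, x ≠ q := measure_eq_zero_iff_ae_notMem.1 (hM q)
  have hdirac : M = Measure.dirac p := by
    refine measure_ext_P1 fun f => ?_
    rw [integral_dirac]
    have h1 : Tendsto (fun k => ∫ x, f (toPSL (A (σ k)) • x) ∂M) atTop (𝓝 (∫ _, f p ∂M)) := by
      refine tendsto_integral_of_dominated_convergence (fun _ => ‖f‖) (fun k => ?_)
        (integrable_const _) (fun k => .of_forall fun x => f.norm_coe_le_norm _) ?_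
      · exact (f.continuous.comp (continuous_const_smul _)).aestronglyMeasurable
      · filter_upwards [hae] with x hx
        exact (f.continuous.tendsto p).comp (hpq x hx)
    have h2 : ∀ k, ∫ x, f (toPSL (A (σ k)) • x) ∂M = ∫ x, f x ∂M := fun k => by
      conv_rhs => rw [← hT _ (hgT (σ k)), integral_map (measurable_const_smul_P1 _).aemeasurable
        f.continuous.aestronglyMeasurable]
      rw [hA]
    simp only [h2] at h1
    have := tendsto_nhds_unique h1 tendsto_const_nhds
    simpa using this.symm
  have := hM p
  rw [hdirac] at this
  simp at this

/-- The two halves of non-elementarity exclude the two cases. The points at least as heavy as a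
given atom form a finite invariant set. Without atoms, invariance passes to the generated semigroup,
which is then bounded in norm, hence relatively compact. -/
theorem not_exists_invariant [MeasurableSpace PSL(2, ℂ)] {μ : Measure PSL(2, ℂ)}
    (hμ : IsNonElementary μ) (M : Measure P1) [IsProbabilityMeasure M]
    (hM : ∀ g ∈ μ.support, M.map (g • ·) = M) : False := by
  by_cases hat : ∃ x, M {x} ≠ 0
  · obtain ⟨x0, hx0⟩ := hat
    refine hμ.1 ⟨{x | M {x0} ≤ M {x}}, ?_, ⟨x0, by simp⟩, fun g hg x hx => ?_⟩
    · exact Measure.finite_const_le_meas_of_disjoint_iUnion M (pos_iff_ne_zero.2 hx0)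
        (fun x => measurableSet_singleton x)
        (fun x y hxy => by simpa using hxy) (measure_ne_top _ _)
    · have : M {g • x} = M {x} := by
        conv_lhs => rw [← hM g hg, Measure.map_apply (measurable_const_smul_P1 g)
          (measurableSet_singleton _)]
        congr 1
        ext y
        simp
      simp only [mem_ofPred_eq] at hx ⊢
      rwa [this]
  · push Not at hat
    have hT : ∀ g ∈ (Subsemigroup.closure μ.support : Set PSL(2, ℂ)), M.map (g • ·) = M := by
      intro g hg
      induction hg using Subsemigroup.closure_induction with
      | mem g hg => exact hM g hg
      | mul g g' _ _ h h' =>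
        have e : (fun x : P1 => (g * g') • x) = (fun x => g • x) ∘ fun x => g' • x := by
          ext x; simp [mul_smul]
        rw [e, ← Measure.map_map (measurable_const_smul_P1 g) (measurable_const_smul_P1 g'), h', h]
    obtain ⟨R, hR⟩ := opNorm_le_of_map_eq hat hT
    refine hμ.2 ((isCompact_opNorm_le R).of_isClosed_subset isClosed_closure ?_)
    exact closure_minimal hR (isClosed_le continuous_opNorm continuous_const)


/-! ### The contraction property of the averages of forms -/

/-- The measure `|φ|²` on the projective line attached to a form `φ dz`. -/
def formMeasure (φ : ℂ → ℂ) : Measure P1 :=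
  (volume.withDensity fun z => ‖φ z‖ₑ ^ 2).map (chart 0)

theorem formMeasure_univ (φ : ℂ → ℂ) : formMeasure φ univ = sqNorm φ := by
  rw [formMeasure, Measure.map_apply (measurable_chart 0) MeasurableSet.univ, preimage_univ,
    withDensity_apply _ MeasurableSet.univ, Measure.restrict_univ, sqNorm]

theorem isFiniteMeasure_formMeasure {φ : ℂ → ℂ} (hφ : MemLp φ 2 volume) :
    IsFiniteMeasure (formMeasure φ) :=
  ⟨by rw [formMeasure_univ]; exact (memLp_two_iff hφ.1).1 hφ⟩

theorem integral_formMeasure {φ : ℂ → ℂ} (hφ : MemLp φ 2 volume) {f : P1 → ℝ}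
    (hf : Continuous f) :
    ∫ x, f x ∂formMeasure φ = ∫ z, ‖φ z‖ ^ 2 * f (chart 0 z) := by
  rw [formMeasure, integral_map (measurable_chart 0).aemeasurable hf.aestronglyMeasurable,
    integral_withDensity_eq_integral_toReal_smul₀ (hφ.1.enorm.pow_const 2)
      (.of_forall fun z => by simp)]
  simp

theorem integrable_norm_sq_mul {φ : ℂ → ℂ} (hφ : MemLp φ 2 volume) {f : P1 → ℝ}
    (hf : Continuous f) : Integrable fun z => ‖φ z‖ ^ 2 * f (chart 0 z) := by
  obtain ⟨C, hC⟩ := (isCompact_range hf).isBounded.exists_norm_le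
  refine (hφ.integrable_norm_pow (by norm_num)).mul_bdd (c := C)
    (hf.comp (continuous_chart 0)).aestronglyMeasurable
    (.of_forall fun z => hC _ (mem_range_self _))

theorem abs_integral_formMeasure_le {φ : ℂ → ℂ} (hφ : MemLp φ 2 volume) (f : C(P1, ℝ)) :
    |∫ x, f x ∂formMeasure φ| ≤ ‖f‖ * (sqNorm φ).toReal := by
  have := isFiniteMeasure_formMeasure hφ
  have h := norm_integral_le_of_norm_le_const (μ := formMeasure φ) (f := f)
    (.of_forall fun x => f.norm_coe_le_norm x)
  rwa [measureReal_def, formMeasure_univ] at h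

/-- The map φ ↦ |φ|² is equivariant, the Jacobian being absorbed by |g'|²; hence almost invariant
forms yield almost invariant measures. -/
theorem integral_formMeasure_pullBack (g : PSL(2, ℂ)) {φ : ℂ → ℂ} (hφ : MemLp φ 2 volume)
    {f : P1 → ℝ} (hf : Continuous f) :
    ∫ x, f x ∂formMeasure (pullBack g φ) = ∫ x, f (g⁻¹ • x) ∂formMeasure φ := by
  rw [integral_formMeasure (memLp_pullBack g hφ) hf,
    integral_formMeasure hφ (f := fun x => f (g⁻¹ • x)) (hf.comp (continuous_const_smul g⁻¹)),
    ← integral_mob g fun z => ‖φ z‖ ^ 2 * f (g⁻¹ • chart 0 z)]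
  refine integral_congr_ae ?_
  filter_upwards [ae_mobDeriv_ne_zero g] with z hz
  rw [← smul_chart_mob g hz, inv_smul_smul, pullBack, norm_mul, smul_eq_mul]
  ring

/-- | |φ|² - |ψ|² | is at most |φ - ψ| (|φ| + |ψ|), split by Young's inequality. The parameter ε
stays free: the squared distances will telescope, and the other term is summed with a small ε. -/
theorem abs_integral_formMeasure_sub_le {φ ψ : ℂ → ℂ} (hφ : MemLp φ 2 volume)
    (hψ : MemLp ψ 2 volume) (f : C(P1, ℝ)) {ε : ℝ} (hε : 0 < ε) :
    |∫ x, f x ∂formMeasure φ - ∫ x, f x ∂formMeasure ψ| ≤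
      ‖f‖ * ((∫⁻ z, ‖φ z - ψ z‖ₑ ^ 2).toReal / (2 * ε) +
        ε * ((sqNorm φ).toReal + (sqNorm ψ).toReal)) := by
  have hd : MemLp (fun z => φ z - ψ z) 2 volume := hφ.sub hψ
  have i1 := hφ.integrable_norm_pow (p := 2) (by norm_num)
  have i2 := hψ.integrable_norm_pow (p := 2) (by norm_num)
  have i12 : Integrable fun z => ‖φ z‖ ^ 2 + ‖ψ z‖ ^ 2 := i1.add i2
  have i3 := hd.integrable_norm_pow (p := 2) (by norm_num)
  rw [integral_formMeasure hφ f.continuous, integral_formMeasure hψ f.continuous,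
    ← integral_sub (integrable_norm_sq_mul hφ f.continuous)
      (integrable_norm_sq_mul hψ f.continuous), sqNorm, sqNorm, ← integral_norm_sq_eq' hφ.1,
    ← integral_norm_sq_eq' hψ.1, ← integral_norm_sq_eq' hd.1, ← integral_add i1 i2,
    ← integral_div, ← integral_const_mul, ← integral_add (i3.div_const _) (i12.const_mul _),
    ← integral_const_mul, ← Real.norm_eq_abs]
  refine norm_integral_le_of_norm_le
    (((i3.div_const _).add (i12.const_mul _)).const_mul _) (.of_forall fun z => ?_)
  rw [← sub_mul, norm_mul, mul_comm]
  refine mul_le_mul (f.norm_coe_le_norm _) ?_ (norm_nonneg _) (norm_nonneg _)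
  have h1 := abs_norm_sub_norm_le (φ z) (ψ z)
  rw [Real.norm_eq_abs, sq_sub_sq, abs_mul, abs_of_nonneg (by positivity : 0 ≤ ‖φ z‖ + ‖ψ z‖)]
  set a := ‖φ z‖
  set b := ‖ψ z‖
  set d := ‖φ z - ψ z‖
  have hd0 : 0 ≤ d := norm_nonneg _
  have ha : 0 ≤ a := norm_nonneg _
  have hb : 0 ≤ b := norm_nonneg _
  have h2 : (a + b) * |a - b| ≤ (a + b) * d := mul_le_mul_of_nonneg_left h1 (by positivity)
  have h3 : (a + b) * d ≤ d ^ 2 / (2 * ε) + ε / 2 * (a + b) ^ 2 := by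
    have : d ^ 2 / (2 * ε) + ε / 2 * (a + b) ^ 2 - (a + b) * d =
        (d - ε * (a + b)) ^ 2 / (2 * ε) := by
      field_simp
      ring
    have h4 : 0 ≤ (d - ε * (a + b)) ^ 2 / (2 * ε) := by positivity
    linarith
  nlinarith [mul_nonneg hε.le (sq_nonneg (a - b))]

theorem sqNorm_congr {φ ψ : ℂ → ℂ} (h : φ =ᵐ[volume] ψ) : sqNorm φ = sqNorm ψ :=
  lintegral_congr_ae (by filter_upwards [h] with z hz; rw [hz])

theorem sqNorm_const_mul (c : ℂ) (φ : ℂ → ℂ) :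
    sqNorm (fun z => c * φ z) = ‖c‖ₑ ^ 2 * sqNorm φ := by
  simp only [sqNorm, enorm_mul, mul_pow]
  rw [lintegral_const_mul' _ _ (by simp)]

theorem sqNorm_lt_top {φ : ℂ → ℂ} (hφ : MemLp φ 2 volume) : sqNorm φ < ⊤ :=
  (memLp_two_iff hφ.1).1 hφ

theorem continuous_integral_inv_smul (M : Measure P1) [IsFiniteMeasure M] (f : C(P1, ℝ)) :
    Continuous fun g : PSL(2, ℂ) => ∫ x, f (g⁻¹ • x) ∂M := by
  refine continuous_of_dominated (bound := fun _ => ‖f‖) (fun g => ?_)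
    (fun g => .of_forall fun x => f.norm_coe_le_norm _) (integrable_const _)
    (.of_forall fun x => ?_)
  · exact (f.continuous.comp (continuous_const_smul _)).aestronglyMeasurable
  · exact f.continuous.comp (continuous_inv.smul continuous_const)

section

variable [MeasurableSpace PSL(2, ℂ)] [BorelSpace PSL(2, ℂ)]

theorem formAvg_congr (m : Measure PSL(2, ℂ)) [IsProbabilityMeasure m] {φ ψ : ℂ → ℂ}
    (h : φ =ᵐ[volume] ψ) : formAvg m φ =ᵐ[volume] formAvg m ψ := by
  have h1 := Measure.ae_ae_of_ae_prod ((quasiMeasurePreserving_mob_prod m).ae h)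
  filter_upwards [h1] with z hz
  refine integral_congr_ae ?_
  filter_upwards [hz] with g hg
  rw [pullBack, pullBack, hg]

variable (μ : Measure PSL(2, ℂ)) [IsProbabilityMeasure μ]

theorem formAvg_const_mul (c : ℂ) (φ : ℂ → ℂ) :
    formAvg μ (fun z => c * φ z) = fun z => c * formAvg μ φ z := by
  funext z
  simp only [formAvg, pullBack, mul_assoc, integral_const_mul]

theorem iterate_formAvg_const_mul (c : ℂ) (φ : ℂ → ℂ) (n : ℕ) :
    (formAvg μ)^[n] (fun z => c * φ z) = fun z => c * (formAvg μ)^[n] φ z := by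
  induction n with
  | zero => rfl
  | succ n ih => rw [Function.iterate_succ_apply', ih, formAvg_const_mul,
      Function.iterate_succ_apply']

theorem memLp_iterate_formAvg {φ : ℂ → ℂ} (hφ : MemLp φ 2 volume) (n : ℕ) :
    MemLp ((formAvg μ)^[n] φ) 2 volume := by
  induction n with
  | zero => exact hφ
  | succ n ih => rw [Function.iterate_succ_apply']; exact memLp_formAvg μ ih

theorem sqNorm_iterate_formAvg_le {φ : ℂ → ℂ} (hφ : MemLp φ 2 volume) (n : ℕ) :
    sqNorm ((formAvg μ)^[n] φ) ≤ sqNorm φ := by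
  induction n with
  | zero => exact le_rfl
  | succ n ih =>
    rw [Function.iterate_succ_apply']
    exact (sqNorm_formAvg_le μ (memLp_iterate_formAvg μ hφ n)).trans ih

theorem formAvg_convPow_succ {φ : ℂ → ℂ} (hφ : MemLp φ 2 volume) (n : ℕ) :
    formAvg (convPow μ (n + 1)) φ =ᵐ[volume] (formAvg μ)^[n + 1] φ := by
  induction n with
  | zero => rw [zero_add, convPow_one, Function.iterate_one]
  | succ n ih =>
    rw [convPow_succ', Function.iterate_succ_apply']
    exact (formAvg_mconv μ (convPow μ (n + 1)) hφ).trans (formAvg_congr μ ih)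

theorem aemeasurable_lintegral_pullBack_sub {φ : ℂ → ℂ} (hφ : MemLp φ 2 volume) :
    AEMeasurable (fun g => ∫⁻ z, ‖pullBack g φ z - formAvg μ φ z‖ₑ ^ 2) μ := by
  have h1 := aestronglyMeasurable_pullBack μ hφ.1
  have h2 := aestronglyMeasurable_formAvg μ hφ.1
  exact AEMeasurable.lintegral_prod_left' (((h1.sub
    (h2.comp_quasiMeasurePreserving Measure.quasiMeasurePreserving_fst)).enorm).pow_const 2)

theorem integrable_lintegral_pullBack_sub {φ : ℂ → ℂ} (hφ : MemLp φ 2 volume) :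
    Integrable (fun g => (∫⁻ z, ‖pullBack g φ z - formAvg μ φ z‖ₑ ^ 2).toReal) μ ∧
    ∫ g, (∫⁻ z, ‖pullBack g φ z - formAvg μ φ z‖ₑ ^ 2).toReal ∂μ =
      (sqNorm φ).toReal - (sqNorm (formAvg μ φ)).toReal := by
  have hv := lintegral_formAvg_variance μ hφ
  have ha := aemeasurable_lintegral_pullBack_sub μ hφ
  have ht : ∫⁻ g, (∫⁻ z, ‖pullBack g φ z - formAvg μ φ z‖ₑ ^ 2) ∂μ ≠ ⊤ :=
    ((le_self_add.trans hv.le).trans_lt (sqNorm_lt_top hφ)).ne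
  refine ⟨integrable_toReal_of_lintegral_ne_top ha ht, ?_⟩
  rw [integral_toReal ha (ae_lt_top' ha ht), ← hv,
    ENNReal.toReal_add ht (sqNorm_lt_top (memLp_formAvg μ hφ)).ne]
  ring

/-- If the averages of a form do not decay, there is an almost invariant measure. -/
theorem exists_almost_invariant {φ : ℂ → ℂ} (hφ : MemLp φ 2 volume) (h1 : sqNorm φ ≤ 1) (n : ℕ)
    (h2 : ∀ j < (n + 1) ^ 2, 1 / 2 ≤ (sqNorm ((formAvg μ)^[j] φ)).toReal) :
    ∃ M : Measure P1, IsProbabilityMeasure M ∧ ∀ f : C(P1, ℝ),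
      ∫ g, |∫ x, f (g⁻¹ • x) ∂M - ∫ x, f x ∂M| ∂μ ≤ 9 * ‖f‖ / (n + 1) := by
  set a : ℕ → ℂ → ℂ := fun j => (formAvg μ)^[j] φ with ha
  have ha' : ∀ j, a (j + 1) = formAvg μ (a j) := fun j => Function.iterate_succ_apply' _ _ _
  have hm : ∀ j, MemLp (a j) 2 volume := memLp_iterate_formAvg μ hφ
  have hfin := fun j => isFiniteMeasure_formMeasure (hm j)
  set S : ℕ → ℝ := fun j => (sqNorm (a j)).toReal with hS
  have hS0 : ∀ j, 0 ≤ S j := fun j => ENNReal.toReal_nonneg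
  have hS1 : ∀ j, S j ≤ 1 := fun j =>
    ENNReal.toReal_le_of_le_ofReal zero_le_one
      (by simpa using (sqNorm_iterate_formAvg_le μ hφ j).trans h1)
  set k := (n + 1) ^ 2 with hk
  have hk' : (k : ℝ) = ((n : ℝ) + 1) ^ 2 := by rw [hk]; push_cast; ring
  set W := ∑ j ∈ Finset.range k, S j with hW
  have hWk : (k : ℝ) / 2 ≤ W := by
    have : ∑ j ∈ Finset.range k, (1 / 2 : ℝ) ≤ W :=
      Finset.sum_le_sum fun j hj => h2 j (Finset.mem_range.1 hj)
    simpa [div_eq_mul_inv] using this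
  have hk0 : (0 : ℝ) < k := by rw [hk']; positivity
  have hW0 : 0 < W := by linarith
  -- The lower bound on the norms gives W ≥ k/2, so after normalization the bounded end terms
  -- contribute O(1/k).
  set M : Measure P1 := ENNReal.ofReal W⁻¹ • ∑ j ∈ Finset.range k, formMeasure (a j) with hM
  have hint : ∀ f : P1 → ℝ, Continuous f →
      ∫ x, f x ∂M = W⁻¹ * ∑ j ∈ Finset.range k, ∫ x, f x ∂formMeasure (a j) := by
    intro f hf
    rw [hM, integral_smul_measure, integral_finsetSum_measure, ENNReal.toReal_ofReal (by positivity),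
      smul_eq_mul]
    exact fun j _ => integrable_continuous_P1 hf
  have hprob : IsProbabilityMeasure M := by
    refine ⟨?_⟩
    rw [hM, Measure.smul_apply, Measure.coe_finsetSum, Finset.sum_apply]
    simp only [formMeasure_univ]
    have : ∑ j ∈ Finset.range k, sqNorm (a j) = ENNReal.ofReal W := by
      rw [hW, ENNReal.ofReal_sum_of_nonneg fun j _ => hS0 j]
      exact Finset.sum_congr rfl fun j _ => (ENNReal.ofReal_toReal (sqNorm_lt_top (hm j)).ne).symm
    rw [this, smul_eq_mul, ← ENNReal.ofReal_mul (by positivity), inv_mul_cancel₀ hW0.ne',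
      ENNReal.ofReal_one]
  refine ⟨M, hprob, fun f => ?_⟩
  set d : ℕ → PSL(2, ℂ) → ℝ := fun j g =>
    (∫⁻ z, ‖pullBack g (a j) z - formAvg μ (a j) z‖ₑ ^ 2).toReal with hd
  -- Balances the two errors: the variances sum to at most 1 and cost 1/(2ε), while k = (n+1)² terms
  -- cost 2kε; both are of order n + 1.
  set ε : ℝ := ((n : ℝ) + 1)⁻¹ with hε
  have hε0 : 0 < ε := by positivity
  have hpt : ∀ g, |∫ x, f (g⁻¹ • x) ∂M - ∫ x, f x ∂M| ≤
      W⁻¹ * ∑ j ∈ Finset.range k, (‖f‖ * (d j g / (2 * ε) + ε * 2)) + W⁻¹ * (2 * ‖f‖) := by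
    intro g
    rw [hint (fun x => f (g⁻¹ • x)) (f.continuous.comp (continuous_const_smul g⁻¹)), hint _ f.continuous, ← mul_sub,
      abs_mul, abs_of_pos (inv_pos.2 hW0), ← mul_add]
    refine mul_le_mul_of_nonneg_left ?_ (by positivity)
    -- The image of |φ_j|² by g⁻¹ is compared with |φ_{j+1}|² rather than |φ_j|²; the shift of index
    -- costs only two end terms.
    have htel := Finset.sum_range_sub (fun j => ∫ x, f x ∂formMeasure (a j)) k
    have hsplit : ∑ j ∈ Finset.range k, ∫ x, f (g⁻¹ • x) ∂formMeasure (a j) -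
        ∑ j ∈ Finset.range k, ∫ x, f x ∂formMeasure (a j) =
        ∑ j ∈ Finset.range k, (∫ x, f (g⁻¹ • x) ∂formMeasure (a j) -
          ∫ x, f x ∂formMeasure (a (j + 1))) +
        (∫ x, f x ∂formMeasure (a k) - ∫ x, f x ∂formMeasure (a 0)) := by
      rw [← htel, ← Finset.sum_sub_distrib, ← Finset.sum_add_distrib]
      exact Finset.sum_congr rfl fun j _ => by ring
    rw [hsplit]
    refine (abs_add_le _ _).trans (add_le_add ((Finset.abs_sum_le_sum_abs _ _).trans
      (Finset.sum_le_sum fun j _ => ?_)) ?_)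
    · rw [← integral_formMeasure_pullBack g (hm j) f.continuous, ha' j]
      refine (abs_integral_formMeasure_sub_le (memLp_pullBack g (hm j))
        (memLp_formAvg μ (hm j)) f hε0).trans ?_
      have e1 : sqNorm (pullBack g (a j)) = sqNorm (a j) := lintegral_pullBack g (a j)
      rw [e1, ← ha' j]
      have := hS1 j
      have := hS1 (j + 1)
      gcongr
      · rw [hd, ha' j]
      · simp only [hS] at *
        linarith
    · refine (abs_sub _ _).trans ?_
      have b1 := abs_integral_formMeasure_le (hm k) f
      have b2 := abs_integral_formMeasure_le (hm 0) f
      have b3 := mul_le_of_le_one_right (norm_nonneg f) (hS1 k)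
      have b4 := mul_le_of_le_one_right (norm_nonneg f) (hS1 0)
      simp only [hS] at b3 b4
      linarith
  have hdi : ∀ j, Integrable (d j) μ := fun j => (integrable_lintegral_pullBack_sub μ (hm j)).1
  have hdi' : ∀ j, ∫ g, d j g ∂μ = S j - S (j + 1) := fun j => by
    rw [(integrable_lintegral_pullBack_sub μ (hm j)).2, ← ha' j]
  have hti : ∀ j ∈ Finset.range k, Integrable (fun g => ‖f‖ * (d j g / (2 * ε) + ε * 2)) μ :=
    fun j _ => (((hdi j).div_const _).add (integrable_const _)).const_mul _
  have hsum := (integrable_finsetSum _ hti).const_mul W⁻¹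
  refine (integral_mono_of_nonneg (.of_forall fun g => abs_nonneg _)
    (hsum.add (integrable_const (W⁻¹ * (2 * ‖f‖)))) (.of_forall hpt)).trans ?_
  simp only [Pi.add_apply]
  rw [integral_add hsum (integrable_const _), integral_const_mul, integral_finsetSum _ hti,
    integral_const, probReal_univ, one_smul]
  have hj : ∀ j, ∫ g, ‖f‖ * (d j g / (2 * ε) + ε * 2) ∂μ =
      ‖f‖ * ((S j - S (j + 1)) / (2 * ε) + ε * 2) := fun j => by
    rw [integral_const_mul, integral_add ((hdi j).div_const _) (integrable_const _),
      integral_div, hdi' j]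
    simp
  simp only [hj]
  rw [← Finset.mul_sum, Finset.sum_add_distrib, ← Finset.sum_div, Finset.sum_range_sub',
    Finset.sum_const, Finset.card_range, nsmul_eq_mul, ← mul_add]
  have hSk : S 0 - S k ≤ 1 := by linarith [hS1 0, hS0 k]
  have hn1 : (1 : ℝ) ≤ (n : ℝ) + 1 := by linarith [(Nat.cast_nonneg n : (0 : ℝ) ≤ n)]
  have hWi : W⁻¹ ≤ 2 / k := by
    rw [inv_le_comm₀ hW0 (by positivity), inv_div]
    exact hWk
  -- The sum is at most (n+1)/2 + 2(n+1) + 2 times ‖f‖, and 2 ≤ 2(n+1); multiplied by W⁻¹ ≤ 2/(n+1)²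
  -- this produces the constant 9.
  have hb : ‖f‖ * ((S 0 - S k) / (2 * ε) + k * (ε * 2)) + 2 * ‖f‖ ≤
      ‖f‖ * (9 / 2 * ((n : ℝ) + 1)) := by
    have e1 : (S 0 - S k) / (2 * ε) ≤ ((n : ℝ) + 1) / 2 := by
      rw [hε]
      have : (S 0 - S k) / (2 * ((n : ℝ) + 1)⁻¹) = (S 0 - S k) * (((n : ℝ) + 1) / 2) := by
        field_simp
      rw [this]
      exact mul_le_of_le_one_left (by positivity) hSk
    have e2 : (k : ℝ) * (ε * 2) = 2 * ((n : ℝ) + 1) := by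
      rw [hk', hε]
      field_simp
    nlinarith [norm_nonneg f]
  calc _ ≤ 2 / k * (‖f‖ * (9 / 2 * ((n : ℝ) + 1))) :=
        mul_le_mul hWi hb (by
          have : 0 ≤ S 0 - S k := by
            have : S k ≤ S 0 := ENNReal.toReal_mono (sqNorm_lt_top (hm 0)).ne
              (sqNorm_iterate_formAvg_le μ hφ k)
            linarith
          positivity) (by positivity)
    _ = 9 * ‖f‖ / (n + 1) := by
        rw [hk']
        field_simp
        
variable {μ}

/-- Otherwise, for each n, some form of squared norm 1 keeps more than half of it for (n+1)² steps,
and there is an almost invariant probability measure. By compactness of `P1` these have a weak limit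
point, invariant under μ-almost every g, hence by continuity in g under the whole support, against
`not_exists_invariant`. -/
theorem exists_contraction (hμ : IsNonElementary μ) :
    ∃ N, ∀ φ, MemLp φ 2 volume → sqNorm ((formAvg μ)^[N] φ) ≤ 2⁻¹ * sqNorm φ := by
  by_contra! hcon
  have key : ∀ n : ℕ, ∃ M : Measure P1, IsProbabilityMeasure M ∧ ∀ f : C(P1, ℝ),
      ∫ g, |∫ x, f (g⁻¹ • x) ∂M - ∫ x, f x ∂M| ∂μ ≤ 9 * ‖f‖ / (n + 1) := by
    intro n
    obtain ⟨φ, hφ, hlt⟩ := hcon ((n + 1) ^ 2)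
    have ht := (sqNorm_lt_top hφ).ne
    have h0 : sqNorm φ ≠ 0 := by
      intro h0
      have := hlt.trans_le (sqNorm_iterate_formAvg_le μ hφ _)
      simp [h0] at this
    have hpos : 0 < (sqNorm φ).toReal := ENNReal.toReal_pos h0 ht
    set c : ℂ := (((Real.sqrt (sqNorm φ).toReal)⁻¹ : ℝ) : ℂ) with hc
    have hcs : ‖c‖ₑ ^ 2 = (sqNorm φ)⁻¹ := by
      rw [hc, ← ofReal_norm, ← ENNReal.ofReal_pow (norm_nonneg _), Complex.norm_real, norm_inv,
        Real.norm_of_nonneg (Real.sqrt_nonneg _), inv_pow, Real.sq_sqrt hpos.le,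
        ENNReal.ofReal_inv_of_pos hpos, ENNReal.ofReal_toReal ht]
    refine exists_almost_invariant μ (φ := fun z => c * φ z) (hφ.const_mul c) ?_ n fun j hj => ?_
    · rw [sqNorm_const_mul, hcs, ENNReal.inv_mul_cancel h0 ht]
    · rw [iterate_formAvg_const_mul, sqNorm_const_mul, hcs]
      -- Norms decrease along the iteration, so the lower bound at the last step holds at all
      -- earlier ones.
      have hle : sqNorm ((formAvg μ)^[(n + 1) ^ 2] φ) ≤ sqNorm ((formAvg μ)^[j] φ) := by
        obtain ⟨i, hi⟩ := Nat.exists_eq_add_of_le' hj.le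
        rw [hi, Function.iterate_add_apply]
        exact sqNorm_iterate_formAvg_le μ (memLp_iterate_formAvg μ hφ j) i
      have h3 := ENNReal.toReal_mono (sqNorm_lt_top (memLp_iterate_formAvg μ hφ j)).ne
        (hlt.le.trans hle)
      rw [ENNReal.toReal_mul] at h3
      rw [ENNReal.toReal_mul, ENNReal.toReal_inv]
      simp only [ENNReal.toReal_inv, ENNReal.toReal_ofNat] at h3
      rw [inv_mul_eq_div, le_div_iff₀ hpos]
      linarith
  choose M hMp hM using key
  obtain ⟨M0, -, σ, hσ, hlim⟩ := (isCompact_univ (X := ProbabilityMeasure P1)).tendsto_subseq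
    (x := fun n => ⟨M n, hMp n⟩) fun n => mem_univ _
  rw [ProbabilityMeasure.tendsto_iff_forall_integral_tendsto] at hlim
  have hlim' : ∀ f : C(P1, ℝ), Tendsto (fun n => ∫ x, f x ∂M (σ n)) atTop
      (𝓝 (∫ x, f x ∂(M0 : Measure P1))) := fun f =>
    hlim (BoundedContinuousFunction.mkOfCompact f)
  have hinv : ∀ f : C(P1, ℝ), ∀ g ∈ μ.support,
      ∫ x, f (g⁻¹ • x) ∂(M0 : Measure P1) = ∫ x, f x ∂(M0 : Measure P1) := by
    intro f
    have hcg : ∀ m : Measure P1, IsProbabilityMeasure m →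
        Continuous fun g : PSL(2, ℂ) => |∫ x, f (g⁻¹ • x) ∂m - ∫ x, f x ∂m| := fun m _ =>
      ((continuous_integral_inv_smul m f).sub continuous_const).abs
    have hbd : ∀ m : Measure P1, IsProbabilityMeasure m → ∀ g : PSL(2, ℂ),
        ‖|∫ x, f (g⁻¹ • x) ∂m - ∫ x, f x ∂m|‖ ≤ 2 * ‖f‖ := by
      intro m _ g
      have b1 := norm_integral_le_of_norm_le_const (μ := m) (f := fun x => f (g⁻¹ • x))
        (.of_forall fun x => f.norm_coe_le_norm _)
      have b2 := norm_integral_le_of_norm_le_const (μ := m) (f := f)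
        (.of_forall fun x => f.norm_coe_le_norm _)
      rw [probReal_univ, mul_one] at b1 b2
      rw [norm_abs_eq_norm]
      exact (norm_sub_le _ _).trans (by linarith)
    have h1 : Tendsto (fun n => ∫ g, |∫ x, f (g⁻¹ • x) ∂M (σ n) - ∫ x, f x ∂M (σ n)| ∂μ) atTop
        (𝓝 (∫ g, |∫ x, f (g⁻¹ • x) ∂(M0 : Measure P1) - ∫ x, f x ∂(M0 : Measure P1)| ∂μ)) := by
      refine tendsto_integral_of_dominated_convergence (fun _ => 2 * ‖f‖) (fun n => ?_)
        (integrable_const _) (fun n => .of_forall (hbd _ (hMp _))) (.of_forall fun g => ?_)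
      · exact (hcg _ (hMp _)).aestronglyMeasurable
      · exact ((hlim' (f.comp ⟨fun x => g⁻¹ • x, continuous_const_smul g⁻¹⟩)).sub (hlim' f)).abs
    have h2 : Tendsto (fun n : ℕ => 9 * ‖f‖ / ((σ n : ℝ) + 1)) atTop (𝓝 0) :=
      (Tendsto.const_div_atTop (tendsto_atTop_add_const_right _ 1
        (tendsto_natCast_atTop_atTop (R := ℝ))) (9 * ‖f‖)).comp hσ.tendsto_atTop
    have h3 : ∫ g, |∫ x, f (g⁻¹ • x) ∂(M0 : Measure P1) - ∫ x, f x ∂(M0 : Measure P1)| ∂μ = 0 :=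
      le_antisymm (le_of_tendsto_of_tendsto' h1 h2 fun n => hM (σ n) f)
        (integral_nonneg fun g => abs_nonneg _)
    have h4 := (integral_eq_zero_iff_of_nonneg (μ := μ) (fun g => abs_nonneg _)
      (Integrable.of_bound (hcg _ M0.2).aestronglyMeasurable (2 * ‖f‖)
        (.of_forall (hbd _ M0.2)))).1 h3
    have hcl : IsClosed {g : PSL(2, ℂ) |
        |∫ x, f (g⁻¹ • x) ∂(M0 : Measure P1) - ∫ x, f x ∂(M0 : Measure P1)| = 0} :=
      isClosed_eq (hcg _ M0.2) continuous_const
    intro g hg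
    exact sub_eq_zero.1 (abs_eq_zero.1 (Measure.support_subset_of_isClosed hcl h4 hg))
  refine not_exists_invariant hμ (M0 : Measure P1) fun g hg => ?_
  have : IsProbabilityMeasure ((M0 : Measure P1).map (g • ·)) :=
    Measure.isProbabilityMeasure_map (measurable_const_smul_P1 g).aemeasurable
  refine measure_ext_P1 fun f => ?_
  rw [integral_map (measurable_const_smul_P1 g).aemeasurable f.continuous.aestronglyMeasurable]
  have := hinv (f.comp ⟨fun x => g • x, continuous_const_smul g⟩) g hg
  simpa using this.symm

theorem exists_sqNorm_formAvg_le (hμ : IsNonElementary μ) :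
    ∃ A lam : ℝ, 0 < A ∧ 0 < lam ∧ lam < 1 ∧ ∀ φ, MemLp φ 2 volume → ∀ n,
      (sqNorm (formAvg (convPow μ n) φ)).toReal ≤ (A * lam ^ n) ^ 2 * (sqNorm φ).toReal := by
  obtain ⟨N, hN⟩ := exists_contraction hμ
  -- θ is the rate for squared norms, with θ^(N+1) = 1/2; blocks of length N + 1 rather than N avoid
  -- a division by zero. The norms decay at rate √θ, and the factor 4 = 2² absorbs an incomplete
  -- block, where θ^r ≥ 1/2.
  set θ : ℝ := (1 / 2 : ℝ) ^ ((N + 1 : ℕ) : ℝ)⁻¹ with hθ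
  have hθ0 : 0 < θ := by positivity
  have hθ1 : θ < 1 := Real.rpow_lt_one (by norm_num) (by norm_num) (by positivity)
  have hθN : θ ^ (N + 1) = 1 / 2 := Real.rpow_inv_natCast_pow (by norm_num) (Nat.succ_ne_zero N)
  refine ⟨2, Real.sqrt θ, two_pos, Real.sqrt_pos.2 hθ0, by rw [Real.sqrt_lt' one_pos]; simpa using hθ1,
    fun φ hφ n => ?_⟩
  have hb : (2 * Real.sqrt θ ^ n) ^ 2 = 4 * θ ^ n := by
    rw [mul_pow, ← pow_mul, mul_comm n, pow_mul, Real.sq_sqrt hθ0.le]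
    norm_num
  rw [hb]
  rcases n with _ | n
  · have := ENNReal.toReal_mono (sqNorm_lt_top hφ).ne (sqNorm_formAvg_le (convPow μ 0) hφ)
    have := ENNReal.toReal_nonneg (a := sqNorm φ)
    simp only [pow_zero]
    linarith
  rw [sqNorm_congr (formAvg_convPow_succ μ hφ n)]
  generalize n + 1 = n
  have hiter : ∀ q, sqNorm ((formAvg μ)^[(N + 1) * q] φ) ≤ 2⁻¹ ^ q * sqNorm φ := by
    intro q
    induction q with
    | zero => simp
    | succ q ih =>
      rw [Nat.mul_succ, add_comm ((N + 1) * q), Function.iterate_add_apply, add_comm N,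
        Function.iterate_add_apply]
      have hq := memLp_iterate_formAvg μ hφ ((1 + N) * q)
      refine (sqNorm_iterate_formAvg_le μ (memLp_iterate_formAvg μ hq N) 1).trans ?_
      refine (hN _ hq).trans ?_
      rw [pow_succ', mul_assoc]
      rw [add_comm N] at ih
      gcongr
  have hdiv := Nat.mod_add_div n (N + 1)
  have hmod := Nat.mod_lt n (Nat.succ_pos N)
  have h1 : sqNorm ((formAvg μ)^[n] φ) ≤ 2⁻¹ ^ (n / (N + 1)) * sqNorm φ := by
    conv_lhs => rw [← hdiv, Function.iterate_add_apply]
    exact (sqNorm_iterate_formAvg_le μ (memLp_iterate_formAvg μ hφ _) _).trans (hiter _)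
  have h2 := ENNReal.toReal_mono (ENNReal.mul_ne_top (by simp) (sqNorm_lt_top hφ).ne) h1
  rw [ENNReal.toReal_mul, ENNReal.toReal_pow, ENNReal.toReal_inv, ENNReal.toReal_ofNat] at h2
  refine h2.trans (mul_le_mul_of_nonneg_right ?_ ENNReal.toReal_nonneg)
  have h3 : θ ^ n = θ ^ (n % (N + 1)) * (2⁻¹ : ℝ) ^ (n / (N + 1)) := by
    conv_lhs => rw [← hdiv, pow_add, pow_mul, hθN, one_div]
  have h4 : (1 / 2 : ℝ) ≤ θ ^ (n % (N + 1)) :=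
    hθN ▸ pow_le_pow_of_le_one hθ0.le hθ1.le hmod.le
  rw [h3]
  nlinarith [(by positivity : (0 : ℝ) ≤ (2⁻¹ : ℝ) ^ (n / (N + 1)))]

end


/-! ### The limit of the transfer operator -/

theorem hasWeakWirtinger_of_contDiff {u : ℂ → ℝ} (hu : ContDiff ℝ ∞ u) :
    HasWeakWirtinger u (wirtinger fun z => (u z : ℂ)) := by
  have hu' : ContDiff ℝ ∞ fun z => (u z : ℂ) := Complex.ofRealCLM.contDiff.comp hu
  refine ⟨hu.continuous.locallyIntegrable, (continuous_wirtinger hu').locallyIntegrable,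
    fun φ hφ hc => ?_⟩
  have hd := hu'.continuous_fderiv (by simp)
  have hd' := hφ.continuous_fderiv (by simp)
  have hi : ∀ F : ℂ → ℂ, Continuous F → Integrable fun z => F z * φ z := fun F hF =>
    (hF.mul hφ.continuous).integrable_of_hasCompactSupport hc.mul_left
  have hi' : ∀ a : ℂ, Integrable fun z => (u z : ℂ) * fderiv ℝ φ z a := fun a =>
    (hu'.continuous.mul (by fun_prop)).integrable_of_hasCompactSupport
      ((hc.fderiv_apply ℝ a).mul_left)
  have key : ∀ a : ℂ, ∫ z, (u z : ℂ) * fderiv ℝ φ z a =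
      -∫ z, fderiv ℝ (fun z => (u z : ℂ)) z a * φ z := fun a =>
    integral_mul_fderiv_eq_neg_fderiv_mul_of_integrable (hi _ (by fun_prop)) (hi' a)
      (hi _ hu'.continuous) (fun z _ => hu'.differentiable (by simp) z)
      (fun z _ => hφ.differentiable (by simp) z)
  have e1 : ∀ z, (u z : ℂ) * wirtinger φ z = ((u z : ℂ) * fderiv ℝ φ z 1) / 2 -
      Complex.I / 2 * ((u z : ℂ) * fderiv ℝ φ z Complex.I) := fun z => by
    rw [wirtinger]; ring
  have e2 : ∀ z, wirtinger (fun z => (u z : ℂ)) z * φ z =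
      (fderiv ℝ (fun z => (u z : ℂ)) z 1 * φ z) / 2 -
      Complex.I / 2 * (fderiv ℝ (fun z => (u z : ℂ)) z Complex.I * φ z) := fun z => by
    rw [wirtinger]; ring
  simp only [e1, e2]
  rw [integral_sub ((hi' 1).div_const 2) ((hi' Complex.I).const_mul _),
    integral_sub ((hi _ (by fun_prop)).div_const 2) ((hi _ (by fun_prop)).const_mul _),
    integral_div, integral_div, integral_const_mul, integral_const_mul, key, key]
  ring

theorem hasDel_const (c : ℝ) : HasDel (fun _ => c) 0 := by
  intro i
  refine ⟨MemLp.zero, ?_⟩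
  have h := hasWeakWirtinger_of_contDiff (u := fun _ => c) contDiff_const
  have e : (wirtinger fun _ => (c : ℂ)) = 0 := by
    funext z
    simp [wirtinger]
  rwa [e] at h

theorem HasDel.sub_const {h : P1 → ℝ} {g : Fin 2 → ℂ → ℂ} (hd : HasDel h g) (c : ℝ) :
    HasDel (fun x => h x - c) g := by
  have := hd.add (hasDel_const (-c))
  rw [add_zero] at this
  exact this

theorem delNorm_sub_const {h : P1 → ℝ} (hh : MemW12 h) (c : ℝ) :
    delNorm (fun x => h x - c) = delNorm h := by
  obtain ⟨-, g, hd⟩ := hh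
  rw [hd.delNorm_eq, (hd.sub_const c).delNorm_eq]

theorem MemW12.sub_const {h : P1 → ℝ} (hh : MemW12 h) (c : ℝ) : MemW12 fun x => h x - c :=
  ⟨hh.1.sub (integrable_const c), hh.2.imp fun _ hd => hd.sub_const c⟩

theorem measurable_W12 (h : W12) : Measurable h.1 := (Lp.stronglyMeasurable h.1).measurable

section

variable [MeasurableSpace PSL(2, ℂ)] [BorelSpace PSL(2, ℂ)]

/-- The mean of a function for the image of the Fubini-Study measure by a random element of the
group. -/
def meanAvg (m : Measure PSL(2, ℂ)) (h : P1 → ℝ) : ℝ := ∫ γ, (∫ x, h (γ • x) ∂fubiniStudy) ∂m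

theorem meanAvg_congr (m : Measure PSL(2, ℂ)) {h h' : P1 → ℝ} (e : h =ᵐ[fubiniStudy] h') :
    meanAvg m h = meanAvg m h' := by
  refine integral_congr_ae (.of_forall fun γ => integral_congr_ae ?_)
  exact (quasiMeasurePreserving_smul γ).ae_eq_comp e

variable {m : Measure PSL(2, ℂ)} [IsProbabilityMeasure m]

theorem integrable_mean_smul (hm : HasFiniteFirstMoment m) {h : P1 → ℝ} (hh : MemW12 h)
    (hmeas : Measurable h) : Integrable (fun γ => ∫ x, h (γ • x) ∂fubiniStudy) m :=
  (integrable_smul_prod hm hh hmeas).integral_prod_right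

theorem measurable_funAvg {h : P1 → ℝ} (hmeas : Measurable h) : Measurable (funAvg m h) :=
  ((hmeas.comp measurable_smul_swap).stronglyMeasurable.integral_prod_right').measurable

theorem funAvg_mconv (m' : Measure PSL(2, ℂ)) [IsProbabilityMeasure m'] {h : P1 → ℝ}
    (hh : MemW12 h) (hmeas : Measurable h) (hm : HasFiniteFirstMoment m)
    (hm' : HasFiniteFirstMoment m') :
    funAvg (m'.mconv m) h =ᵐ[fubiniStudy] funAvg m (funAvg m' h) := by
  filter_upwards [(integrable_smul_prod (hm'.mconv hm) hh hmeas).prod_right_ae] with x hx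
  have hmul : Measurable fun p : PSL(2, ℂ) × PSL(2, ℂ) => p.1 * p.2 := measurable_mul
  have hi : Integrable (fun p : PSL(2, ℂ) × PSL(2, ℂ) => h ((p.1 * p.2) • x)) (m'.prod m) :=
    hx.comp_measurable hmul
  rw [funAvg, Measure.mconv, integral_map hmul.aemeasurable hx.1, integral_prod_symm _ hi]
  simp only [funAvg, mul_smul]

variable {μ : Measure PSL(2, ℂ)} [IsProbabilityMeasure μ]

theorem exists_delNorm_funAvg_le (hμ : IsNonElementary μ) (hmom : HasFiniteFirstMoment μ) :
    ∃ A lam : ℝ, 0 < A ∧ 0 < lam ∧ lam < 1 ∧ ∀ h, MemW12 h → Measurable h → ∀ n,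
      delNorm (funAvg (convPow μ n) h) ≤ A * lam ^ n * delNorm h := by
  obtain ⟨A, lam, hA, hl0, hl1, H⟩ := exists_sqNorm_formAvg_le hμ
  refine ⟨A, lam, hA, hl0, hl1, fun h hh hmeas n => ?_⟩
  obtain ⟨hi, g, hd⟩ := hh
  refine abs_le_of_sq_le_sq' ?_ (mul_nonneg (by positivity) (delNorm_nonneg h)) |>.2
  rw [delNorm_sq (hd.funAvg hi hmeas (hmom.convPow n)), mul_pow, delNorm_sq hd]
  have := H _ (hd 0).1 n
  simp only [Matrix.cons_val_zero]
  linarith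

/-- With h_n the n-th average of h, the next mean is the μ-average of the means of h_n ∘ g. It
differs from the mean of h_n by at most ∫ C (1 + log ‖g‖) dμ times ‖∂h_n‖, which decays
geometrically. -/
theorem exists_meanAvg_sub_le (hμ : IsNonElementary μ) (hmom : HasFiniteFirstMoment μ) :
    ∃ A lam : ℝ, 0 < A ∧ 0 < lam ∧ lam < 1 ∧ ∀ h, MemW12 h → Measurable h → ∀ n,
      delNorm (funAvg (convPow μ n) h) ≤ A * delNorm h * lam ^ n ∧
      |meanAvg (convPow μ n) h - meanAvg (convPow μ (n + 1)) h| ≤ A * delNorm h * lam ^ n := by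
  obtain ⟨A, lam, hA, hl0, hl1, H⟩ := exists_delNorm_funAvg_le hμ hmom
  obtain ⟨C, hC, HC⟩ := exists_mean_smul_sub_le
  set K : ℝ := ∫ g, C * (1 + Real.log (opNorm g)) ∂μ with hK
  have hKi : Integrable (fun g => C * (1 + Real.log (opNorm g))) μ :=
    ((integrable_const _).add hmom.integrable).const_mul _
  have hK0 : 0 ≤ K := integral_nonneg fun g =>
    mul_nonneg hC.le (add_nonneg zero_le_one (log_opNorm_nonneg g))
  refine ⟨A * (1 + K), lam, by positivity, hl0, hl1, fun h hh hmeas n => ?_⟩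
  have hd := H h hh hmeas n
  have hn0 := delNorm_nonneg h
  have hpow : 0 ≤ A * lam ^ n * delNorm h := by positivity
  refine ⟨by nlinarith [mul_nonneg hpow hK0], ?_⟩
  have hW := memW12_funAvg hh hmeas (hmom.convPow n)
  have hWm := measurable_funAvg (m := convPow μ n) hmeas
  have e1 : meanAvg (convPow μ n) h = ∫ x, funAvg (convPow μ n) h x ∂fubiniStudy :=
    (integral_funAvg hh hmeas (hmom.convPow n)).symm
  have e2 : meanAvg (convPow μ (n + 1)) h =
      ∫ g, (∫ x, funAvg (convPow μ n) h (g • x) ∂fubiniStudy) ∂μ := by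
    rw [meanAvg, ← integral_funAvg hh hmeas (hmom.convPow (n + 1)), ← integral_funAvg hW hWm hmom,
      convPow_succ']
    exact integral_congr_ae (funAvg_mconv _ hh hmeas hmom (hmom.convPow n))
  have hint := integrable_mean_smul hmom hW hWm
  rw [abs_sub_comm, e1, e2]
  set c := ∫ x, funAvg (convPow μ n) h x ∂fubiniStudy
  have e3 : (∫ g, (∫ x, funAvg (convPow μ n) h (g • x) ∂fubiniStudy) ∂μ) - c =
      ∫ g, ((∫ x, funAvg (convPow μ n) h (g • x) ∂fubiniStudy) - c) ∂μ := by
    rw [integral_sub hint (integrable_const _)]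
    simp
  rw [e3, ← Real.norm_eq_abs]
  calc _ ≤ ∫ g, C * (1 + Real.log (opNorm g)) * delNorm (funAvg (convPow μ n) h) ∂μ :=
        norm_integral_le_of_norm_le (hKi.mul_const _) (.of_forall fun g => HC _ hW g)
    _ = K * delNorm (funAvg (convPow μ n) h) := by rw [integral_mul_const]
    _ ≤ K * (A * lam ^ n * delNorm h) := by gcongr
    _ ≤ A * (1 + K) * delNorm h * lam ^ n := by nlinarith

theorem meanAvg_dirac_one {h : P1 → ℝ} (hmeas : Measurable h) :
    meanAvg (Measure.dirac 1) h = ∫ x, h x ∂fubiniStudy := by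
  have hsm : StronglyMeasurable fun γ : PSL(2, ℂ) => ∫ x, h (γ • x) ∂fubiniStudy :=
    (hmeas.comp measurable_smul_swap).stronglyMeasurable.integral_prod_left'
  rw [meanAvg, integral_dirac' _ _ hsm]
  simp

/-- The increments of the means are geometric, so the means converge to L h with error at most A
‖∂h‖ λ^n / (1 - λ). This controls the mean part of the Sobolev norm; the derivative part, blind to
constants, decays by itself. -/
theorem exists_limit_functional (hμ : IsNonElementary μ) (hmom : HasFiniteFirstMoment μ) :
    ∃ (L : W12 →ₗ[ℝ] ℝ), (∀ h : W12, Tendsto (fun n => meanAvg (convPow μ n) h.1) atTop (𝓝 (L h))) ∧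
      (∃ A' : ℝ, 0 < A' ∧ ∀ h : W12, |L h| ≤ A' * sobolevNorm h.1) ∧
      (∃ A lam : ℝ, 0 < A ∧ 0 < lam ∧ lam < 1 ∧ ∀ (n : ℕ) (h : W12),
          (∀ᵐ x ∂fubiniStudy, Integrable (fun g => h.1 (g • x)) (convPow μ n)) ∧
          MemW12 (fun x => transfer μ n h.1 x - L h) ∧
          sobolevNorm (fun x => transfer μ n h.1 x - L h) ≤ A * delNorm h.1 * lam ^ n) := by
  obtain ⟨A, lam, hA, hl0, hl1, H⟩ := exists_meanAvg_sub_le hμ hmom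
  have hex : ∀ h : W12, ∃ l, Tendsto (fun n => meanAvg (convPow μ n) h.1) atTop (𝓝 l) := fun h =>
    cauchySeq_tendsto_of_complete (cauchySeq_of_le_geometric lam _ hl1 fun n =>
      (H h.1 h.2 (measurable_W12 h) n).2)
  choose L hL using hex
  have hLn : ∀ (h : W12) n, |meanAvg (convPow μ n) h.1 - L h| ≤
      A * delNorm h.1 * lam ^ n / (1 - lam) := fun h n =>
    dist_le_of_le_geometric_of_tendsto lam _ hl1 (fun n =>
      (H h.1 h.2 (measurable_W12 h) n).2) (hL h) n
  have hl : 0 < 1 - lam := by linarith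
  have hadd : ∀ h h' : W12, L (h + h') = L h + L h' := by
    intro h h'
    refine tendsto_nhds_unique (hL (h + h')) (((hL h).add (hL h')).congr fun n => ?_)
    have i1 := integrable_mean_smul (hmom.convPow n) h.2 (measurable_W12 h)
    have i2 := integrable_mean_smul (hmom.convPow n) h'.2 (measurable_W12 h')
    refine Eq.trans ?_ (meanAvg_congr _ (Lp.coeFn_add h.1 h'.1)).symm
    rw [meanAvg, meanAvg, meanAvg, ← integral_add i1 i2]
    refine integral_congr_ae (.of_forall fun γ => ?_)
    exact (integral_add (integrable_comp_smul h.2.1 γ) (integrable_comp_smul h'.2.1 γ)).symm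
  have hsmul : ∀ (c : ℝ) (h : W12), L (c • h) = c * L h := by
    intro c h
    refine tendsto_nhds_unique (hL (c • h)) (((hL h).const_mul c).congr fun n => ?_)
    refine Eq.trans ?_ (meanAvg_congr _ (Lp.coeFn_smul c h.1)).symm
    rw [meanAvg, meanAvg, ← integral_const_mul]
    refine integral_congr_ae (.of_forall fun γ => ?_)
    exact (integral_const_mul _ _).symm
  refine ⟨{ toFun := L, map_add' := hadd, map_smul' := hsmul }, hL, ⟨1 + A / (1 - lam), by positivity,
    fun h => ?_⟩, A + A / (1 - lam), lam, by positivity, hl0, hl1, fun n h => ?_⟩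
  -- At n = 0 the mean is the Fubini-Study integral, and the error bound becomes the continuity of
  -- L.
  · have h0 := hLn h 0
    rw [convPow, meanAvg_dirac_one (measurable_W12 h), pow_zero, mul_one] at h0
    have hd := delNorm_nonneg h.1
    have h1 := abs_sub_abs_le_abs_sub (L h) (∫ x, h.1 x ∂fubiniStudy)
    rw [abs_sub_comm] at h1
    simp only [LinearMap.coe_mk, AddHom.coe_mk, sobolevNorm]
    have h2 : A * delNorm h.1 / (1 - lam) = A / (1 - lam) * delNorm h.1 := by ring
    have h3 : 0 ≤ A / (1 - lam) * |∫ x, h.1 x ∂fubiniStudy| := by positivity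
    nlinarith
  · have hm := hmom.convPow n
    have hW := memW12_funAvg h.2 (measurable_W12 h) hm
    refine ⟨(integrable_smul_prod hm h.2 (measurable_W12 h)).prod_right_ae, hW.sub_const _, ?_⟩
    change sobolevNorm (fun x => funAvg (convPow μ n) h.1 x - L h) ≤ _
    rw [sobolevNorm, delNorm_sub_const hW, integral_sub hW.1 (integrable_const _),
      integral_funAvg h.2 (measurable_W12 h) hm]
    have h1 := hLn h n
    have h2 := (H h.1 h.2 (measurable_W12 h) n).1
    rw [meanAvg] at h1
    simp only [integral_const, probReal_univ, one_smul]
    calc _ ≤ A * delNorm h.1 * lam ^ n / (1 - lam) + A * delNorm h.1 * lam ^ n := add_le_add h1 h2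
      _ = _ := by ring

/-! ### The stationary measure -/

theorem meanAvg_eq_integral_map (m : Measure PSL(2, ℂ)) [IsProbabilityMeasure m] (f : C(P1, ℝ)) :
    meanAvg m f =
      ∫ x, f x ∂(m.prod fubiniStudy).map (fun p : PSL(2, ℂ) × P1 => p.1 • p.2) := by
  have hs : Measurable fun p : PSL(2, ℂ) × P1 => p.1 • p.2 := continuous_smul.measurable
  rw [integral_map hs.aemeasurable f.continuous.aestronglyMeasurable, integral_prod]
  · rfl
  · exact Integrable.of_bound (f.continuous.comp continuous_smul).aestronglyMeasurable ‖f‖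
      (.of_forall fun p => f.norm_coe_le_norm _)

theorem abs_meanAvg_le (m : Measure PSL(2, ℂ)) [IsProbabilityMeasure m] (f : C(P1, ℝ)) :
    |meanAvg m f| ≤ ‖f‖ := by
  have h1 := norm_integral_le_of_norm_le_const (μ := m)
    (f := fun γ => ∫ x, f (γ • x) ∂fubiniStudy) (C := ‖f‖) (.of_forall fun γ => by
      have h2 := norm_integral_le_of_norm_le_const (μ := fubiniStudy) (f := fun x => f (γ • x))
        (.of_forall fun x => f.norm_coe_le_norm _)
      simpa using h2)
  rwa [probReal_univ, mul_one] at h1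

/-- The Markov operator of a random walk on the projective line. -/
def markov (μ : Measure PSL(2, ℂ)) [IsProbabilityMeasure μ] (f : C(P1, ℝ)) : C(P1, ℝ) where
  toFun := funAvg μ f
  continuous_toFun := continuous_of_dominated (bound := fun _ => ‖f‖)
    (fun _ => (f.continuous.comp (continuous_id.smul continuous_const)).aestronglyMeasurable)
    (fun _ => .of_forall fun _ => f.norm_coe_le_norm _) (integrable_const _)
    (.of_forall fun g => f.continuous.comp (continuous_const_smul g))

theorem meanAvg_markov (n : ℕ) (f : C(P1, ℝ)) :
    meanAvg (convPow μ n) (markov μ f) = meanAvg (convPow μ (n + 1)) f := by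
  have hmul : Measurable fun p : PSL(2, ℂ) × PSL(2, ℂ) => p.1 * p.2 := measurable_mul
  have hc : Continuous fun g : PSL(2, ℂ) => ∫ x, f (g • x) ∂fubiniStudy :=
    continuous_of_dominated (bound := fun _ => ‖f‖)
      (fun g => (f.continuous.comp (continuous_const_smul g)).aestronglyMeasurable)
      (fun g => .of_forall fun x => f.norm_coe_le_norm _) (integrable_const _)
      (.of_forall fun x => f.continuous.comp (continuous_id.smul continuous_const))
  have hb : ∀ g : PSL(2, ℂ), ‖∫ x, f (g • x) ∂fubiniStudy‖ ≤ ‖f‖ := fun g => by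
    have h2 := norm_integral_le_of_norm_le_const (μ := fubiniStudy) (f := fun x => f (g • x))
      (.of_forall fun x => f.norm_coe_le_norm _)
    simpa using h2
  rw [meanAvg, meanAvg, convPow, Measure.mconv,
    integral_map hmul.aemeasurable hc.aestronglyMeasurable, integral_prod_symm
      (f := fun p : PSL(2, ℂ) × PSL(2, ℂ) => ∫ x, f ((p.1 * p.2) • x) ∂fubiniStudy)
      (Integrable.of_bound (hc.measurable.comp hmul).aestronglyMeasurable ‖f‖
        (.of_forall fun p => hb _))]
  refine integral_congr_ae (.of_forall fun γ => ?_)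
  change ∫ x, (∫ g, f (g • γ • x) ∂μ) ∂fubiniStudy = ∫ g, (∫ x, f ((g * γ) • x) ∂fubiniStudy) ∂μ
  simp only [← mul_smul]
  refine integral_integral_swap (f := fun x g => f ((g * γ) • x)) ?_
  have hcc : Continuous fun p : P1 × PSL(2, ℂ) => f ((p.2 * γ) • p.1) := by fun_prop
  exact Integrable.of_bound hcc.aestronglyMeasurable ‖f‖ (.of_forall fun p => f.norm_coe_le_norm _)

/-- Krylov-Bogolyubov: applying the Markov operator to f changes its integral against the average of
the laws 0, ..., k by at most 2‖f‖/(k + 1), so weak limit points are stationary. Cesàro averaging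
preserves limits, so ν computes every existing limit of means of a continuous function. -/
theorem exists_stationary (μ : Measure PSL(2, ℂ)) [IsProbabilityMeasure μ] :
    ∃ ν : Measure P1, IsProbabilityMeasure ν ∧ IsStationary μ ν ∧ ∀ (f : C(P1, ℝ)) (l : ℝ),
      Tendsto (fun n => meanAvg (convPow μ n) f) atTop (𝓝 l) → l = ∫ x, f x ∂ν := by
  have hs : Measurable fun p : PSL(2, ℂ) × P1 => p.1 • p.2 := continuous_smul.measurable
  set ρ : ℕ → Measure P1 := fun j =>
    ((convPow μ j).prod fubiniStudy).map (fun p : PSL(2, ℂ) × P1 => p.1 • p.2) with hρ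
  have hρp : ∀ j, IsProbabilityMeasure (ρ j) := fun j =>
    Measure.isProbabilityMeasure_map hs.aemeasurable
  set M : ℕ → Measure P1 := fun k =>
    ((k + 1 : ℕ) : ℝ≥0∞)⁻¹ • ∑ j ∈ Finset.range (k + 1), ρ j with hM
  have hMp : ∀ k, IsProbabilityMeasure (M k) := fun k => by
    refine ⟨?_⟩
    rw [hM, Measure.smul_apply, Measure.coe_finsetSum, Finset.sum_apply]
    simp only [measure_univ, Finset.sum_const, Finset.card_range, smul_eq_mul, nsmul_eq_mul,
      mul_one]
    exact ENNReal.inv_mul_cancel (by simp) (by simp)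
  have hMf : ∀ k (f : C(P1, ℝ)), ∫ x, f x ∂M k =
      ((k + 1 : ℕ) : ℝ)⁻¹ * ∑ j ∈ Finset.range (k + 1), meanAvg (convPow μ j) f := by
    intro k f
    rw [hM, integral_smul_measure, integral_finsetSum_measure
      fun j _ => integrable_continuous_P1 f.continuous]
    simp only [meanAvg_eq_integral_map, smul_eq_mul, ENNReal.toReal_inv, ENNReal.toReal_natCast]
    rfl
  obtain ⟨ν, -, σ, hσ, hlim⟩ := (isCompact_univ (X := ProbabilityMeasure P1)).tendsto_subseq
    (x := fun n => ⟨M n, hMp n⟩) fun n => mem_univ _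
  rw [ProbabilityMeasure.tendsto_iff_forall_integral_tendsto] at hlim
  have hlim' : ∀ f : C(P1, ℝ), Tendsto (fun n => ∫ x, f x ∂M (σ n)) atTop
      (𝓝 (∫ x, f x ∂(ν : Measure P1))) := fun f =>
    hlim (BoundedContinuousFunction.mkOfCompact f)
  have hσ' : Tendsto (fun n => σ n + 1) atTop atTop :=
    (tendsto_add_atTop_nat 1).comp hσ.tendsto_atTop
  refine ⟨ν, ν.2, ?_, fun f l hl => ?_⟩
  · have hp : IsProbabilityMeasure ((μ.prod (ν : Measure P1)).map
        (fun p : PSL(2, ℂ) × P1 => p.1 • p.2)) := Measure.isProbabilityMeasure_map hs.aemeasurable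
    refine measure_ext_P1 fun f => ?_
    rw [integral_map hs.aemeasurable f.continuous.aestronglyMeasurable, integral_prod_symm
      (f := fun p : PSL(2, ℂ) × P1 => f (p.1 • p.2))
      (Integrable.of_bound (f.continuous.comp continuous_smul).aestronglyMeasurable ‖f‖
        (.of_forall fun p => f.norm_coe_le_norm _))]
    change ∫ x, markov μ f x ∂(ν : Measure P1) = _
    refine tendsto_nhds_unique (hlim' (markov μ f)) ?_
    have h0 : Tendsto (fun n => ∫ x, markov μ f x ∂M (σ n) - ∫ x, f x ∂M (σ n)) atTop (𝓝 0) := by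
      have hb : Tendsto (fun n => ((σ n + 1 : ℕ) : ℝ)⁻¹ * (2 * ‖f‖)) atTop (𝓝 0) := by
        have := (tendsto_inv_atTop_nhds_zero_nat (𝕜 := ℝ)).comp hσ'
        simpa using this.mul_const (2 * ‖f‖)
      refine squeeze_zero_norm (fun n => ?_) hb
      rw [hMf, hMf, ← mul_sub, ← Finset.sum_sub_distrib, norm_mul, Real.norm_of_nonneg (by positivity)]
      refine mul_le_mul_of_nonneg_left ?_ (by positivity)
      simp only [meanAvg_markov]
      rw [Finset.sum_range_sub (fun j => meanAvg (convPow μ j) f)]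
      refine (norm_sub_le _ _).trans ?_
      have b1 := abs_meanAvg_le (convPow μ (σ n + 1)) f
      have b2 := abs_meanAvg_le (convPow μ 0) f
      rw [Real.norm_eq_abs, Real.norm_eq_abs]
      linarith
    simpa using h0.add (hlim' f)
  · refine tendsto_nhds_unique ?_ (hlim' f)
    refine (hl.cesaro.comp hσ').congr fun n => ?_
    rw [hMf]
    rfl

end


/-! ### Superharmonic functions -/

theorem lt_toENNReal_sub_iff (C : ℝ) (a : NNReal) (x : EReal) :
    (a : ℝ≥0∞) < ((C : EReal) - x).toENNReal ↔ x < ((C - a : ℝ) : EReal) := by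
  induction x with
  | bot => simpa using EReal.bot_lt_coe (C - a)
  | top => simp
  | coe y =>
    rw [← EReal.coe_sub, EReal.toENNReal_of_ne_top (EReal.coe_ne_top _), EReal.toReal_coe,
      EReal.coe_lt_coe_iff, ← ENNReal.ofReal_coe_nnreal, ENNReal.ofReal_lt_ofReal_iff']
    constructor
    · rintro ⟨h, -⟩
      linarith
    · intro h
      exact ⟨by linarith, by linarith [a.2]⟩

theorem toENNReal_sub_add (C : ℝ) (hC : 0 ≤ C) {x : EReal} (hx : x < C) :
    ((C : EReal) - x).toENNReal + x.toENNReal = ENNReal.ofReal C + (-x).toENNReal := by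
  induction x with
  | bot => simp
  | top => simp at hx
  | coe y =>
    have hy : y < C := by exact_mod_cast hx
    rw [← EReal.coe_sub, ← EReal.coe_neg, EReal.toENNReal_of_ne_top (EReal.coe_ne_top _),
      EReal.toENNReal_of_ne_top (EReal.coe_ne_top _),
      EReal.toENNReal_of_ne_top (EReal.coe_ne_top _)]
    simp only [EReal.toReal_coe]
    rcases le_total 0 y with h | h
    · rw [ENNReal.ofReal_of_nonpos (by linarith : -y ≤ 0), add_zero,
        ← ENNReal.ofReal_add (by linarith) h]
      congr 1; ring
    · rw [ENNReal.ofReal_of_nonpos h, add_zero, ← ENNReal.ofReal_add hC (by linarith)]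
      congr 1

/-- P, A and B stand for the circle means of C - v, v⁺ and v⁻. The sub-mean inequality for v becomes
a super-mean inequality in [0, ∞]; infinite B is compatible only with the value -∞ at the center. -/
theorem le_toENNReal_sub {C : ℝ} {x : EReal} {A B P : ℝ≥0∞} (hx : x ≠ ⊤) (hA : A ≠ ⊤)
    (hC : 0 ≤ C) (h : P + A = ENNReal.ofReal C + B) (hle : x ≤ (A : EReal) - (B : EReal)) :
    P ≤ ((C : EReal) - x).toENNReal := by
  induction x with
  | bot => simp
  | top => exact absurd rfl hx
  | coe y =>
    have hB : B ≠ ⊤ := by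
      rintro rfl
      simp at hle
    have hP : P ≠ ⊤ := by
      rintro rfl
      rw [top_add] at h
      exact ENNReal.add_ne_top.2 ⟨ENNReal.ofReal_ne_top, hB⟩ h.symm
    lift A to NNReal using hA
    lift B to NNReal using hB
    lift P to NNReal using hP
    have h1 : (P : ℝ) + A = C + B := by
      have := congrArg ENNReal.toReal h
      rw [ENNReal.toReal_add (by simp) (by simp), ENNReal.toReal_add (by simp) (by simp),
        ENNReal.toReal_ofReal hC] at this
      simpa using this
    have h2 : y ≤ (A : ℝ) - B := by
      rw [EReal.coe_nnreal_eq_coe_real, EReal.coe_nnreal_eq_coe_real] at hle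
      simpa using EReal.coe_le_coe_iff.1 (hle.trans_eq (EReal.coe_sub _ _).symm)
    rw [← EReal.coe_sub, EReal.toENNReal_of_ne_top (EReal.coe_ne_top _), EReal.toReal_coe,
      ← ENNReal.ofReal_coe_nnreal]
    exact ENNReal.ofReal_le_ofReal (by linarith)

theorem lintegral_circleMap_add (p : ℂ → ℝ≥0∞) (z : ℂ) (r α : ℝ) :
    ∫⁻ θ in Ioc 0 (2 * Real.pi), p (circleMap z r (θ + α)) =
      ∫⁻ θ in Ioc 0 (2 * Real.pi), p (circleMap z r θ) := by
  have hT : Fact (0 < 2 * Real.pi) := ⟨Real.two_pi_pos⟩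
  have hper : Function.Periodic (fun θ => p (circleMap z r θ)) (2 * Real.pi) := fun θ => by
    simp only [periodic_circleMap z r θ]
  have h1 := AddCircle.lintegral_preimage (2 * Real.pi) 0 hper.lift
  have h2 := AddCircle.lintegral_preimage (2 * Real.pi) α hper.lift
  simp only [Function.Periodic.lift_coe, zero_add] at h1 h2
  rw [h1, ← h2]
  have h3 := (measurePreserving_add_right (volume : Measure ℝ) α).setLIntegral_comp_preimage_emb
    (MeasurableEquiv.addRight α).measurableEmbedding (fun θ => p (circleMap z r θ))
    (Ioc α (α + 2 * Real.pi))
  rw [← h3]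
  congr 2
  ext θ
  simp [add_comm]

/-- The means of `p` over the discs contained in `V` are at most the values at the centers. -/
def DiscSuper (p : ℂ → ℝ≥0∞) (V : Set ℂ) : Prop :=
  ∀ z r, 0 < r → Metric.closedBall z r ⊆ V →
    ∫⁻ ξ in Metric.ball (0 : ℂ) 1, p (z + r * ξ) ≤ volume (Metric.ball (0 : ℂ) 1) * p z

/-- Rotations preserve the area of the disc. Averaging over them replaces the integral over the disc
by circle means of radius r|ξ|, each at most p(z). -/
theorem discSuper_of_circle {p : ℂ → ℝ≥0∞} (hp : Measurable p) {V : Set ℂ}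
    (h : ∀ z r, 0 < r → Metric.closedBall z r ⊆ V →
      ∫⁻ θ in Ioc 0 (2 * Real.pi), p (circleMap z r θ) ≤ ENNReal.ofReal (2 * Real.pi) * p z) :
    DiscSuper p V := by
  intro z r hr hV
  have hpi := Real.two_pi_pos
  set B := Metric.ball (0 : ℂ) 1 with hB
  have hrot : ∀ θ : ℝ, ∫⁻ ξ in B, p (z + r * (Complex.exp (θ * Complex.I) * ξ)) =
      ∫⁻ ξ in B, p (z + r * ξ) := by
    intro θ
    have hmp := (rotation (Circle.exp θ)).measurePreserving
    have := hmp.setLIntegral_comp_preimage_emb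
      (rotation (Circle.exp θ)).toHomeomorph.measurableEmbedding (fun ξ => p (z + r * ξ)) B
    rw [← this]
    congr 2
    ext ξ
    rw [mem_preimage, hB, mem_ball_zero_iff, mem_ball_zero_iff, LinearIsometryEquiv.norm_map]
  have hmeas : Measurable fun q : ℝ × ℂ => p (z + r * (Complex.exp (q.1 * Complex.I) * q.2)) :=
    hp.comp (by fun_prop)
  have hin : ∀ ξ ∈ B, ∫⁻ θ in Ioc 0 (2 * Real.pi), p (z + r * (Complex.exp (θ * Complex.I) * ξ)) ≤
      ENNReal.ofReal (2 * Real.pi) * p z := by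
    intro ξ hξ
    rcases eq_or_ne ξ 0 with rfl | h0
    · simp [mul_comm]
    · have e : ∀ θ : ℝ, z + r * (Complex.exp (θ * Complex.I) * ξ) =
          circleMap z (r * ‖ξ‖) (θ + Complex.arg ξ) := by
        intro θ
        conv_lhs => rw [← Complex.norm_mul_exp_arg_mul_I ξ]
        rw [circleMap]
        push_cast
        rw [add_mul, Complex.exp_add]
        ring
      simp only [e, lintegral_circleMap_add]
      refine h z _ (by positivity) ((Metric.closedBall_subset_closedBall ?_).trans hV)
      have : ‖ξ‖ < 1 := by simpa [hB] using hξ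
      nlinarith
  have key : ENNReal.ofReal (2 * Real.pi) * ∫⁻ ξ in B, p (z + r * ξ) ≤
      ENNReal.ofReal (2 * Real.pi) * (volume B * p z) := by
    calc _ = ∫⁻ θ in Ioc 0 (2 * Real.pi), (∫⁻ ξ in B,
          p (z + r * (Complex.exp (θ * Complex.I) * ξ))) := by
          simp only [hrot]
          rw [setLIntegral_const, Real.volume_Ioc, sub_zero, mul_comm]
      _ = ∫⁻ ξ in B, (∫⁻ θ in Ioc 0 (2 * Real.pi),
          p (z + r * (Complex.exp (θ * Complex.I) * ξ))) :=
          lintegral_lintegral_swap (f := fun (θ : ℝ) (ξ : ℂ) =>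
            p (z + r * (Complex.exp (θ * Complex.I) * ξ))) hmeas.aemeasurable
      _ ≤ ∫⁻ ξ in B, ENNReal.ofReal (2 * Real.pi) * p z :=
          setLIntegral_mono' Metric.isOpen_ball.measurableSet hin
      _ = _ := by rw [setLIntegral_const]; ring
  exact (ENNReal.mul_le_mul_iff_right (by simpa using hpi) ENNReal.ofReal_ne_top).1 key

/-- Near each point, a subharmonic function is the difference of a constant and a superharmonic
function with values in `[0, ∞]`. -/
theorem IsSubharmonicOn.exists_discSuper {v : ℂ → EReal} {U : Set ℂ} (hU : IsOpen U)
    (hv : IsSubharmonicOn v U) {z0 : ℂ} (hz0 : z0 ∈ U) :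
    ∃ R > 0, Metric.ball z0 R ⊆ U ∧ ∃ p : ℂ → ℝ≥0∞, LowerSemicontinuous p ∧
      DiscSuper p (Metric.ball z0 R) ∧ (∀ z ∈ Metric.ball z0 R, p z = ⊤ ↔ v z = ⊥) ∧
      ∀ z ∉ Metric.ball z0 R, p z = 0 := by
  obtain ⟨husc, htop, hmean⟩ := hv
  obtain ⟨C, hC0, hC⟩ : ∃ C : ℝ, 0 ≤ C ∧ v z0 < C := by
    obtain ⟨q, hq⟩ := EReal.lt_iff_exists_real_btwn.1 (lt_top_iff_ne_top.2 (htop z0 hz0))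
    exact ⟨max q 0, le_max_right _ _, hq.1.trans_le (by exact_mod_cast le_max_left q 0)⟩
  have hnear : ∀ᶠ w in 𝓝 z0, v w < C := by
    have := husc z0 hz0 C hC
    rwa [hU.nhdsWithin_eq hz0] at this
  obtain ⟨R, hR, hball⟩ := Metric.eventually_nhds_iff_ball.1 (hnear.and (hU.mem_nhds hz0))
  set V := Metric.ball z0 R with hV
  have hVU : V ⊆ U := fun w hw => (hball w hw).2
  -- Upper semicontinuity makes v < C on V, so nothing is truncated there. Extending by 0 outside
  -- the open set V keeps a nonnegative function lower semicontinuous on the plane.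
  set p : ℂ → ℝ≥0∞ := V.indicator fun w => ((C : EReal) - v w).toENNReal with hp
  have hpV : ∀ w ∈ V, p w = ((C : EReal) - v w).toENNReal := fun w hw => indicator_of_mem hw _
  have hlsc : LowerSemicontinuous p := by
    intro y a ha
    have hy : y ∈ V := by
      by_contra hy
      rw [hp, indicator_of_notMem hy] at ha
      exact not_lt_zero ha
    lift a to NNReal using (ha.trans_le le_top).ne
    replace ha : (a : ℝ≥0∞) < p y := ha
    rw [hpV y hy, lt_toENNReal_sub_iff] at ha
    have h1 := husc y (hVU hy) _ ha
    rw [hU.nhdsWithin_eq (hVU hy)] at h1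
    filter_upwards [h1, Metric.isOpen_ball.mem_nhds hy] with w hw hwV
    change (a : ℝ≥0∞) < p w
    rw [hpV w hwV, lt_toENNReal_sub_iff]
    exact hw
  refine ⟨R, hR, hVU, p, hlsc, discSuper_of_circle hlsc.measurable fun z r hr hzr => ?_,
    fun z hz => ?_, fun z hz => indicator_of_notMem hz _⟩
  · have hzV : z ∈ V := hzr (Metric.mem_closedBall_self hr.le)
    have hm := hmean z (hVU hzV) r hr (hzr.trans hVU)
    have hpi := Real.two_pi_pos
    have hpi0 : ENNReal.ofReal (2 * Real.pi) ≠ 0 := by simpa using hpi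
    have hcirc : ∀ θ, circleMap z r θ ∈ V := fun θ => hzr (circleMap_mem_closedBall z hr.le θ)
    have hone : ∀ c : ℝ≥0∞, ∫⁻ _ in Ioc 0 (2 * Real.pi), c / ENNReal.ofReal (2 * Real.pi) = c := by
      intro c
      rw [setLIntegral_const, Real.volume_Ioc, sub_zero,
        ENNReal.div_mul_cancel hpi0 ENNReal.ofReal_ne_top]
    set A := ∫⁻ θ in Ioc 0 (2 * Real.pi), (v (circleMap z r θ)).toENNReal /
      ENNReal.ofReal (2 * Real.pi) with hA
    set B := ∫⁻ θ in Ioc 0 (2 * Real.pi), (-v (circleMap z r θ)).toENNReal /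
      ENNReal.ofReal (2 * Real.pi) with hB
    have hsum : (∫⁻ θ in Ioc 0 (2 * Real.pi), p (circleMap z r θ) / ENNReal.ofReal (2 * Real.pi)) +
        A = ENNReal.ofReal C + B := by
      rw [hA, hB, ← lintegral_add_left, ← hone (ENNReal.ofReal C), ← lintegral_add_left]
      · refine lintegral_congr fun θ => ?_
        rw [← ENNReal.add_div, ← ENNReal.add_div, hpV _ (hcirc θ),
          toENNReal_sub_add C hC0 (hball _ (hcirc θ)).1]
      · exact measurable_const
      · exact (hlsc.measurable.comp (continuous_circleMap z r).measurable).div_const _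
    have hAtop : A ≠ ⊤ := by
      refine ne_top_of_le_ne_top (ENNReal.ofReal_ne_top (r := C)) ?_
      rw [← hone (ENNReal.ofReal C)]
      refine lintegral_mono fun θ => ENNReal.div_le_div_right ?_ _
      have h1 := (hball _ (hcirc θ)).1.le
      calc _ ≤ (C : EReal).toENNReal := EReal.toENNReal_le_toENNReal h1
        _ = _ := by rw [EReal.toENNReal_of_ne_top (EReal.coe_ne_top _), EReal.toReal_coe]
    have h2 := le_toENNReal_sub (htop z (hVU hzV)) hAtop hC0 hsum hm
    rw [hpV z hzV]
    simp only [ENNReal.div_eq_inv_mul] at h2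
    rw [lintegral_const_mul' _ _ (by simpa using hpi0)] at h2
    rw [mul_comm (ENNReal.ofReal _)]
    rwa [← ENNReal.div_eq_inv_mul, ENNReal.div_le_iff hpi0 ENNReal.ofReal_ne_top] at h2
  · rw [hpV z hz]
    have h1 := htop z (hVU hz)
    generalize v z = x at h1
    induction x with
    | bot => simp
    | top => exact absurd rfl h1
    | coe y =>
      rw [← EReal.coe_sub, EReal.toENNReal_of_ne_top (EReal.coe_ne_top _)]
      simp

theorem DiscSuper.lintegral_ball_lt_top {p : ℂ → ℝ≥0∞} {V : Set ℂ}
    (h : DiscSuper p V) {z : ℂ} {r : ℝ} (hr : 0 < r) (hV : Metric.closedBall z r ⊆ V)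
    (hz : p z ≠ ⊤) : ∫⁻ w in Metric.ball z r, p w < ⊤ := by
  have h1 := (h z r hr hV).trans_lt (ENNReal.mul_lt_top measure_ball_lt_top hz.lt_top)
  set e : ℂ ≃ₜ ℂ := (Homeomorph.mulLeft₀ (r : ℂ) (by exact_mod_cast hr.ne')).trans
    (Homeomorph.addLeft z) with he
  have hpre : e ⁻¹' (Metric.ball z r) = Metric.ball 0 1 := by
    ext ξ
    simp [he, abs_of_pos hr, mul_lt_iff_lt_one_right hr]
  have hmap : Measure.map e volume = ENNReal.ofReal (|r ^ 2|⁻¹) • volume := by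
    have h2 : (e : ℂ → ℂ) = (fun w => z + w) ∘ fun w : ℂ => r • w := by
      ext w; simp [he]
    rw [h2, ← Measure.map_map (by fun_prop) (by fun_prop), Measure.map_addHaar_smul _ hr.ne',
      Measure.map_smul, map_add_left_eq_self]
    simp
  have h3 : ∫⁻ w in Metric.ball z r, p w ∂(Measure.map e volume) =
      ∫⁻ ξ in Metric.ball (0 : ℂ) 1, p (z + r * ξ) := by
    rw [e.measurableEmbedding.restrict_map, e.measurableEmbedding.lintegral_map, hpre]
    rfl
  rw [← h3, hmap, Measure.restrict_smul, lintegral_smul_measure] at h1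
  by_contra hcon
  rw [not_lt, top_le_iff] at hcon
  rw [hcon, smul_eq_mul, ENNReal.mul_top (by simp; positivity)] at h1
  exact lt_irrefl _ h1


/-! ### The energy estimate -/

/-- The scalar product of the gradients of two functions. -/
def gradProd (u w : ℂ → ℝ) (z : ℂ) : ℝ :=
  fderiv ℝ u z 1 * fderiv ℝ w z 1 + fderiv ℝ u z Complex.I * fderiv ℝ w z Complex.I

theorem continuous_gradProd {u w : ℂ → ℝ} (hu : ContDiff ℝ ∞ u) (hw : ContDiff ℝ ∞ w) :
    Continuous (gradProd u w) := by
  have h1 := hu.continuous_fderiv (by simp)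
  have h2 := hw.continuous_fderiv (by simp)
  unfold gradProd
  fun_prop

theorem fderiv_apply_re_im (u : ℂ → ℝ) (z ξ : ℂ) :
    fderiv ℝ u z ξ = ξ.re * fderiv ℝ u z 1 + ξ.im * fderiv ℝ u z Complex.I := by
  have : ξ = ξ.re • (1 : ℂ) + ξ.im • Complex.I := by simp
  conv_lhs => rw [this, map_add, map_smul, map_smul]
  simp

theorem fderiv_mul_add_fderiv_mul (u w : ℂ → ℝ) (z ξ : ℂ) :
    fderiv ℝ u z ξ * fderiv ℝ w z ξ +
      fderiv ℝ u z (Complex.I * ξ) * fderiv ℝ w z (Complex.I * ξ) = ‖ξ‖ ^ 2 * gradProd u w z := by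
  rw [fderiv_apply_re_im u z ξ, fderiv_apply_re_im w z ξ, fderiv_apply_re_im u z (Complex.I * ξ),
    fderiv_apply_re_im w z (Complex.I * ξ), ← Complex.normSq_eq_norm_sq, Complex.normSq_apply,
    gradProd]
  simp
  ring

/-- Discrete integration by parts. -/
theorem integral_sub_mul_sub {q η : ℂ → ℝ} (hq : Continuous q) (hη : Continuous η)
    (hc : HasCompactSupport η) (h : ℂ) :
    ∫ z, (q (z + h) - q z) * (η (z + h) - η z) =
      2 * (∫ z, q z * η z) - (∫ z, q (z + h) * η z) - ∫ z, q (z - h) * η z := by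
  have i0 : Integrable fun z => q z * η z :=
    (hq.mul hη).integrable_of_hasCompactSupport hc.mul_left
  have i1 : Integrable fun z => q (z + h) * η z :=
    ((hq.comp (by fun_prop)).mul hη).integrable_of_hasCompactSupport hc.mul_left
  have i2 : Integrable fun z => q (z - h) * η z :=
    ((hq.comp (by fun_prop)).mul hη).integrable_of_hasCompactSupport hc.mul_left
  have i3 : Integrable fun z => q (z + h) * η (z + h) := i0.comp_add_right h
  have i4 : Integrable fun z => q z * η (z + h) := by simpa using i2.comp_add_right h
  have e3 : ∫ z, q (z + h) * η (z + h) = ∫ z, q z * η z :=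
    integral_add_right_eq_self (fun z => q z * η z) h
  have e4 : ∫ z, q z * η (z + h) = ∫ z, q (z - h) * η z := by
    rw [← integral_add_right_eq_self (fun z => q (z - h) * η z) h]
    simp
  have e : ∀ z, (q (z + h) - q z) * (η (z + h) - η z) =
      q (z + h) * η (z + h) + q z * η z - q (z + h) * η z - q z * η (z + h) := fun z => by ring
  simp only [e]
  rw [integral_sub (f := fun z => q (z + h) * η (z + h) + q z * η z - q (z + h) * η z)
      ((i3.add i0).sub i1) i4,
    integral_sub (f := fun z => q (z + h) * η (z + h) + q z * η z) (i3.add i0) i1,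
    integral_add i3 i0, e3, e4]
  ring

/-- The unit disc, with Lebesgue measure. -/
abbrev unitDisc : Measure ℂ := volume.restrict (Metric.ball 0 1)

instance isFiniteMeasure_unitDisc : IsFiniteMeasure unitDisc :=
  ⟨by rw [Measure.restrict_apply_univ]; exact measure_ball_lt_top⟩

theorem integral_unitDisc_neg (f : ℂ → ℝ) : ∫ ξ, f (-ξ) ∂unitDisc = ∫ ξ, f ξ ∂unitDisc := by
  have h := (Measure.measurePreserving_neg (volume : Measure ℂ)).setIntegral_preimage_emb
    (Homeomorph.neg ℂ).measurableEmbedding f (Metric.ball 0 1)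
  rw [← h]
  congr 2
  ext ξ
  simp

theorem integral_unitDisc_I_mul (f : ℂ → ℝ) :
    ∫ ξ, f (Complex.I * ξ) ∂unitDisc = ∫ ξ, f ξ ∂unitDisc := by
  have h := (rotation (Circle.exp (Real.pi / 2))).measurePreserving.setIntegral_preimage_emb
    (rotation (Circle.exp (Real.pi / 2))).toHomeomorph.measurableEmbedding f (Metric.ball 0 1)
  have e : ∀ ξ, rotation (Circle.exp (Real.pi / 2)) ξ = Complex.I * ξ := fun ξ => by
    simp [rotation_apply]
  simp only [e] at h
  have hpre : (fun ξ : ℂ => rotation (Circle.exp (Real.pi / 2)) ξ) ⁻¹' Metric.ball 0 1 =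
      Metric.ball 0 1 := by
    ext ξ
    rw [mem_preimage, e, mem_ball_zero_iff, mem_ball_zero_iff]
    simp
  rw [← h, hpre]

/-- Discrete integration by parts and the symmetry ξ ↦ -ξ rewrite the double integral as 2 ∫ (∫
(q(z) - q(z + rξ)) dξ) η(z) dz, whose inner integral is nonnegative on the support of η. -/
theorem integral_discrete_nonneg {q η : ℂ → ℝ} (hq : Continuous q) (hqb : ∃ C, ∀ z, |q z| ≤ C)
    (hη : Continuous η) (hc : HasCompactSupport η) (h0 : ∀ z, 0 ≤ η z) {r : ℝ}
    (hsup : ∀ z ∈ tsupport η, ∫ ξ, q (z + r * ξ) ∂unitDisc ≤ ∫ _, q z ∂unitDisc) :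
    0 ≤ ∫ ξ, (∫ z, (q (z + r * ξ) - q z) * (η (z + r * ξ) - η z)) ∂unitDisc := by
  obtain ⟨C, hC⟩ := hqb
  have hηi : Integrable η := hη.integrable_of_hasCompactSupport hc
  have hF : ∀ s : ℝ, Integrable (fun p : ℂ × ℂ => q (p.2 + s * p.1) * η p.2)
      (unitDisc.prod volume) := fun s => by
    have h1 : Integrable (fun p : ℂ × ℂ => η p.2) (unitDisc.prod volume) := hηi.comp_snd _
    exact h1.bdd_mul (c := C) (hq.comp (by fun_prop)).aestronglyMeasurable
      (.of_forall fun p => hC _)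
  have i1 : Integrable (fun ξ => ∫ z, q (z + r * ξ) * η z) unitDisc := (hF r).integral_prod_left
  have i2 : Integrable (fun ξ => ∫ z, q (z - r * ξ) * η z) unitDisc := by
    have := (hF (-r)).integral_prod_left
    simpa [sub_eq_add_neg] using this
  have e2 : ∫ ξ, (∫ z, q (z - r * ξ) * η z) ∂unitDisc =
      ∫ ξ, (∫ z, q (z + r * ξ) * η z) ∂unitDisc := by
    rw [← integral_unitDisc_neg]
    simp
  have e1 : ∫ ξ, (∫ z, q (z + r * ξ) * η z) ∂unitDisc =
      ∫ z, (∫ ξ, q (z + r * ξ) ∂unitDisc) * η z := by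
    rw [integral_integral_swap (f := fun ξ z => q (z + r * ξ) * η z) (hF r)]
    simp only [integral_mul_const]
  have e0 : ∫ _ξ : ℂ, (2 * ∫ z, q z * η z) ∂unitDisc = 2 * ∫ z, (∫ _, q z ∂unitDisc) * η z := by
    simp only [integral_const, smul_eq_mul]
    rw [← mul_assoc, mul_comm _ (2 : ℝ), mul_assoc, ← integral_const_mul]
    simp only [mul_assoc]
  simp only [integral_sub_mul_sub hq hη hc]
  rw [integral_sub (f := fun ξ => 2 * (∫ z, q z * η z) - ∫ z, q (z + r * ξ) * η z)
    ((integrable_const _).sub i1) i2, integral_sub (integrable_const _) i1, e0, e2, e1]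
  have key : ∫ z, (∫ ξ, q (z + r * ξ) ∂unitDisc) * η z ≤ ∫ z, (∫ _, q z ∂unitDisc) * η z := by
    have i3 : Integrable fun z => (∫ ξ, q (z + r * ξ) ∂unitDisc) * η z := by
      have := (hF r).integral_prod_right
      simpa only [integral_mul_const] using this
    have i4 : Integrable fun z => (∫ _, q z ∂unitDisc) * η z := by
      simp only [integral_const, smul_eq_mul, mul_assoc]
      exact ((hq.mul hη).integrable_of_hasCompactSupport hc.mul_left).const_mul _
    refine integral_mono i3 i4 fun z => ?_
    by_cases hz : z ∈ tsupport η
    · exact mul_le_mul_of_nonneg_right (hsup z hz) (h0 z)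
    · simp [image_eq_zero_of_notMem_tsupport hz]
  linarith

theorem tendsto_slope_fderiv {u : ℂ → ℝ} (hu : ContDiff ℝ ∞ u) (z ξ : ℂ) {r : ℕ → ℝ}
    (hr : Tendsto r atTop (𝓝[≠] 0)) :
    Tendsto (fun n => (r n)⁻¹ * (u (z + r n * ξ) - u z)) atTop (𝓝 (fderiv ℝ u z ξ)) := by
  have h := ((hu.differentiable (by simp)) z).hasFDerivAt.hasLineDerivAt ξ
  have h2 := (hasDerivAt_iff_tendsto_slope_zero.1 h).comp hr
  refine h2.congr fun n => ?_
  simp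

/-- The weak form of -Δq ≥ 0, obtained without second derivatives: the discrete form is divided by
r² and r tends to 0. The invariance of the disc under multiplication by i then replaces dq(ξ) dη(ξ)
by half of |ξ|² ∇q·∇η. -/
theorem integral_gradProd_nonneg {q η : ℂ → ℝ} (hq : ContDiff ℝ ∞ q) (hqc : HasCompactSupport q)
    (hη : ContDiff ℝ ∞ η) (hc : HasCompactSupport η) (h0 : ∀ z, 0 ≤ η z) {δ : ℝ} (hδ : 0 < δ)
    (hsup : ∀ z ∈ tsupport η, ∀ r, 0 < r → r < δ →
      ∫ ξ, q (z + r * ξ) ∂unitDisc ≤ ∫ _, q z ∂unitDisc) :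
    0 ≤ ∫ z, gradProd q η z := by
  obtain ⟨Cq, hCq⟩ := hqc.exists_bound_of_continuous hq.continuous
  obtain ⟨Lq, hLq⟩ := ContDiff.lipschitzWith_of_hasCompactSupport hqc hq (by simp)
  obtain ⟨Lη, hLη⟩ := ContDiff.lipschitzWith_of_hasCompactSupport hc hη (by simp)
  obtain ⟨R, hR⟩ := hc.isCompact.isBounded.subset_closedBall (0 : ℂ)
  set r : ℕ → ℝ := fun n => min 1 δ / (n + 2) with hrdef
  have hmin : 0 < min 1 δ := lt_min one_pos hδ
  have hrpos : ∀ n, 0 < r n := fun n => by positivity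
  have hrlt : ∀ n, r n < min 1 δ := fun n => by
    rw [hrdef]
    simp only
    rw [div_lt_iff₀ (by positivity)]
    nlinarith [(Nat.cast_nonneg n : (0 : ℝ) ≤ n)]
  have hr0 : Tendsto r atTop (𝓝[≠] 0) := by
    refine tendsto_nhdsWithin_iff.2 ⟨?_, .of_forall fun n => (hrpos n).ne'⟩
    exact Tendsto.const_div_atTop (tendsto_atTop_add_const_right _ 2
      (tendsto_natCast_atTop_atTop (R := ℝ))) _
  set G : ℕ → ℂ × ℂ → ℝ := fun n p => ((r n)⁻¹ * (q (p.2 + r n * p.1) - q p.2)) *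
    ((r n)⁻¹ * (η (p.2 + r n * p.1) - η p.2)) with hG
  set D : ℂ × ℂ → ℝ := fun p => fderiv ℝ q p.2 p.1 * fderiv ℝ η p.2 p.1 with hD
  set bound : ℂ × ℂ → ℝ := fun p =>
    (Metric.closedBall (0 : ℂ) (R + 1)).indicator (fun _ => (Lq * Lη : ℝ)) p.2 with hbound
  have hbi : Integrable bound (unitDisc.prod volume) := by
    have : Integrable ((Metric.closedBall (0 : ℂ) (R + 1)).indicator fun _ => (Lq * Lη : ℝ)) :=
      (integrable_indicator_iff Metric.isClosed_closedBall.measurableSet).2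
        (integrableOn_const (measure_closedBall_lt_top).ne)
    exact this.comp_snd _
  have hmem : ∀ᵐ p ∂(unitDisc.prod (volume : Measure ℂ)), p.1 ∈ Metric.ball (0 : ℂ) 1 :=
    Measure.quasiMeasurePreserving_fst.ae (ae_restrict_mem Metric.isOpen_ball.measurableSet)
  have hquot : ∀ (u : ℂ → ℝ) (L : NNReal), LipschitzWith L u → ∀ n z ξ, ‖ξ‖ < 1 →
      |(r n)⁻¹ * (u (z + r n * ξ) - u z)| ≤ L := by
    intro u L hL n z ξ hξ
    have h1 := hL.dist_le_mul (z + r n * ξ) z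
    rw [Real.dist_eq, dist_eq_norm, add_sub_cancel_left, norm_mul, Complex.norm_real,
      Real.norm_of_nonneg (hrpos n).le] at h1
    rw [abs_mul, abs_of_pos (inv_pos.2 (hrpos n)), inv_mul_le_iff₀ (hrpos n)]
    refine h1.trans ?_
    have : r n * ‖ξ‖ ≤ r n := mul_le_of_le_one_right (hrpos n).le hξ.le
    nlinarith [L.2]
  have hGb : ∀ n, ∀ᵐ p ∂(unitDisc.prod (volume : Measure ℂ)), ‖G n p‖ ≤ bound p := by
    intro n
    filter_upwards [hmem] with p hp
    have hp' : ‖p.1‖ < 1 := by simpa using hp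
    by_cases hz : p.2 ∈ Metric.closedBall (0 : ℂ) (R + 1)
    · rw [hbound]
      simp only
      rw [indicator_of_mem hz, hG, norm_mul]
      exact mul_le_mul (hquot q Lq hLq n _ _ hp') (hquot η Lη hLη n _ _ hp') (norm_nonneg _) Lq.2
    · have hzn : R + 1 < ‖p.2‖ := by simpa using hz
      have e1 : η p.2 = 0 := image_eq_zero_of_notMem_tsupport fun h => by
        have := hR h
        rw [mem_closedBall_zero_iff] at this
        linarith
      have e2 : η (p.2 + r n * p.1) = 0 := image_eq_zero_of_notMem_tsupport fun h => by
        have h1 := hR h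
        rw [mem_closedBall_zero_iff] at h1
        have h2 : ‖(r n : ℂ) * p.1‖ ≤ 1 := by
          rw [norm_mul, Complex.norm_real, Real.norm_of_nonneg (hrpos n).le]
          have := (hrlt n).le.trans (min_le_left 1 δ)
          exact mul_le_one₀ this (norm_nonneg _) hp'.le
        have h3 := norm_sub_le (p.2 + r n * p.1) (r n * p.1)
        rw [add_sub_cancel_right] at h3
        linarith
      rw [hbound, hG]
      simp only
      rw [indicator_of_notMem hz, e1, e2]
      simp
  have hGm : ∀ n, AEStronglyMeasurable (G n) (unitDisc.prod volume) := fun n => by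
    have h1 := hq.continuous
    have h2 := hη.continuous
    exact (by fun_prop : Continuous (G n)).aestronglyMeasurable
  have hGi : ∀ n, Integrable (G n) (unitDisc.prod volume) := fun n => hbi.mono' (hGm n) (hGb n)
  have hlim : ∀ p, Tendsto (fun n => G n p) atTop (𝓝 (D p)) := fun p =>
    (tendsto_slope_fderiv hq p.2 p.1 hr0).mul (tendsto_slope_fderiv hη p.2 p.1 hr0)
  have hDi : Integrable D (unitDisc.prod volume) := by
    have hDc : Continuous D := by
      have h1 := hq.continuous_fderiv (by simp)
      have h2 := hη.continuous_fderiv (by simp)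
      fun_prop
    refine hbi.mono' hDc.aestronglyMeasurable ?_
    filter_upwards [ae_all_iff.2 hGb] with p hp
    exact le_of_tendsto (hlim p).norm (.of_forall hp)
  have hT := tendsto_integral_of_dominated_convergence bound hGm hbi hGb (.of_forall hlim)
  have hpos : 0 ≤ ∫ p, D p ∂(unitDisc.prod volume) := by
    refine ge_of_tendsto' hT fun n => ?_
    rw [integral_prod _ (hGi n)]
    have h1 := integral_discrete_nonneg hq.continuous ⟨Cq, hCq⟩ hη.continuous hc h0 (r := r n)
      fun z hz => hsup z hz (r n) (hrpos n) ((hrlt n).trans_le (min_le_right _ _))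
    have h2 : ∀ ξ, ∫ z, G n (ξ, z) =
        ((r n)⁻¹) ^ 2 * ∫ z, (q (z + r n * ξ) - q z) * (η (z + r n * ξ) - η z) := fun ξ => by
      rw [← integral_const_mul]
      refine integral_congr_ae (.of_forall fun z => ?_)
      simp only [hG]
      ring
    simp only [h2]
    rw [integral_const_mul]
    positivity
  rw [integral_prod _ hDi] at hpos
  have hgc : Integrable (gradProd q η) :=
    (continuous_gradProd hq hη).integrable_of_hasCompactSupport (hc.mono' fun z hz => by
      by_contra hcon
      refine hz ?_
      have : fderiv ℝ η z = 0 := by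
        have := support_fderiv_subset ℝ (f := η)
        by_contra h
        exact hcon (this h)
      simp [gradProd, this])
  have hDz : ∀ ξ, Integrable fun z => D (ξ, z) := fun ξ => by
    have h1 := hq.continuous_fderiv (by simp)
    have h2 := hη.continuous_fderiv (by simp)
    exact (by fun_prop : Continuous fun z => D (ξ, z)).integrable_of_hasCompactSupport
      ((hc.fderiv_apply ℝ ξ).mul_left)
  have hsym : 2 * ∫ ξ, (∫ z, D (ξ, z)) ∂unitDisc =
      (∫ ξ, ‖ξ‖ ^ 2 ∂unitDisc) * ∫ z, gradProd q η z := by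
    have h1 := integral_unitDisc_I_mul fun ξ => ∫ z, D (ξ, z)
    have hi := hDi.integral_prod_left
    have hi' : Integrable (fun ξ => ∫ z, D (Complex.I * ξ, z)) unitDisc := by
      have e : ∀ ξ, ∫ z, D (Complex.I * ξ, z) = ‖ξ‖ ^ 2 * (∫ z, gradProd q η z) - ∫ z, D (ξ, z) := by
        intro ξ
        rw [← integral_const_mul, ← integral_sub (hgc.const_mul _) (hDz ξ)]
        refine integral_congr_ae (.of_forall fun z => ?_)
        simp only [hD]
        rw [← fderiv_mul_add_fderiv_mul]
        ring
      simp only [e]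
      refine Integrable.sub (Integrable.mul_const ?_ _) hi
      refine Integrable.of_bound (by fun_prop) 1 ?_
      filter_upwards [ae_restrict_mem Metric.isOpen_ball.measurableSet] with ξ hξ
      have : ‖ξ‖ < 1 := by simpa using hξ
      rw [norm_pow, norm_norm]
      exact pow_le_one₀ (norm_nonneg _) this.le
    rw [two_mul]
    nth_rewrite 2 [← h1]
    rw [← integral_add hi hi', ← integral_mul_const]
    refine integral_congr_ae (.of_forall fun ξ => ?_)
    simp only
    rw [← integral_add (hDz ξ) (hDz _), ← integral_const_mul]
    refine integral_congr_ae (.of_forall fun z => ?_)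
    exact fderiv_mul_add_fderiv_mul q η z ξ
  have hc0 : 0 < ∫ ξ, ‖ξ‖ ^ 2 ∂unitDisc := by
    rw [integral_pos_iff_support_of_nonneg (fun ξ => by positivity)]
    · have : Function.support (fun ξ : ℂ => ‖ξ‖ ^ 2) = {0}ᶜ := by ext; simp
      rw [this, Measure.restrict_apply (measurableSet_singleton _).compl, inter_comm,
        ← Set.sdiff_eq, measure_sdiff_null (measure_singleton _)]
      exact Metric.measure_ball_pos _ _ one_pos
    · refine Integrable.of_bound (by fun_prop) 1 ?_
      filter_upwards [ae_restrict_mem Metric.isOpen_ball.measurableSet] with ξ hξ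
      have : ‖ξ‖ < 1 := by simpa using hξ
      rw [norm_pow, norm_norm]
      exact pow_le_one₀ (norm_nonneg _) this.le
  have h3 : 0 ≤ (∫ ξ, ‖ξ‖ ^ 2 ∂unitDisc) * ∫ z, gradProd q η z := by rw [← hsym]; linarith
  exact (mul_nonneg_iff_of_pos_left hc0).1 h3


/-! ### Logarithmic energy and regularization -/

theorem log_one_add_sq_le {q : ℝ} (hq : 0 ≤ q) : Real.log (1 + q) ^ 2 ≤ 4 * q := by
  have h1 : 1 ≤ Real.sqrt (1 + q) := Real.one_le_sqrt.2 (by linarith)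
  have h2 := Real.sq_sqrt (by linarith : 0 ≤ 1 + q)
  have h3 : Real.log (1 + q) ≤ 2 * (Real.sqrt (1 + q) - 1) := by
    have := Real.log_le_sub_one_of_pos (by linarith : 0 < Real.sqrt (1 + q))
    have h4 : Real.log (1 + q) = 2 * Real.log (Real.sqrt (1 + q)) := by
      rw [Real.log_sqrt (by linarith)]; ring
    linarith
  have h5 : 0 ≤ Real.log (1 + q) := Real.log_nonneg (by linarith)
  nlinarith

theorem hasCompactSupport_gradProd {u w : ℂ → ℝ} (hc : HasCompactSupport w) :
    HasCompactSupport (gradProd u w) := by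
  refine hc.mono' fun z hz => ?_
  by_contra hcon
  refine hz ?_
  have : fderiv ℝ w z = 0 := by
    by_contra h
    exact hcon (support_fderiv_subset ℝ (f := w) h)
  simp [gradProd, this]

theorem integrable_gradProd {u w : ℂ → ℝ} (hu : ContDiff ℝ ∞ u) (hw : ContDiff ℝ ∞ w)
    (hc : HasCompactSupport w) : Integrable (gradProd u w) :=
  (continuous_gradProd hu hw).integrable_of_hasCompactSupport (hasCompactSupport_gradProd hc)

/-- The logarithm of a superharmonic function has bounded energy. -/
theorem integral_gradProd_log_le {q χ : ℂ → ℝ} (hq : ContDiff ℝ ∞ q) (hqc : HasCompactSupport q)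
    (hq0 : ∀ z, 0 ≤ q z) (hχ : ContDiff ℝ ∞ χ) (hχc : HasCompactSupport χ) {S : ℝ}
    (hS : ∀ z, gradProd χ χ z ≤ S)
    (hsup : ∀ η : ℂ → ℝ, ContDiff ℝ ∞ η → HasCompactSupport η → (∀ z, 0 ≤ η z) →
      tsupport η ⊆ tsupport χ → 0 ≤ ∫ z, gradProd q η z) :
    ∫ z, gradProd (fun z => χ z * Real.log (1 + q z)) (fun z => χ z * Real.log (1 + q z)) z ≤
      8 * S * (∫ z, q z) + 8 * ∫ z, gradProd χ χ z := by
  have hs0 : ∀ z, 1 + q z ≠ 0 := fun z => by linarith [hq0 z]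
  have hs : ContDiff ℝ ∞ fun z => 1 + q z := contDiff_const.add hq
  set L : ℂ → ℝ := fun z => Real.log (1 + q z) with hL
  have hLs : ContDiff ℝ ∞ L := hs.log hs0
  -- Caccioppoli's choice: ∇q·∇η contains -χ² |∇q|² / (1 + q)², the negative of χ² |∇ log(1 + q)|²,
  -- so its positivity in the mean bounds the energy.
  set η : ℂ → ℝ := fun z => χ z ^ 2 * (1 + q z)⁻¹ with hη
  have hηs : ContDiff ℝ ∞ η := (hχ.pow 2).mul (hs.inv hs0)
  have hηsup : Function.support η ⊆ Function.support χ := fun z hz h => hz (by simp [hη, h])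
  have hηc : HasCompactSupport η := hχc.mono hηsup
  have hhs : ContDiff ℝ ∞ fun z => χ z * L z := hχ.mul hLs
  have hhc : HasCompactSupport fun z => χ z * L z := hχc.mul_right
  have hdη : ∀ z a, fderiv ℝ η z a = 2 * χ z * fderiv ℝ χ z a * (1 + q z)⁻¹ -
      χ z ^ 2 * fderiv ℝ q z a * ((1 + q z)⁻¹) ^ 2 := by
    intro z a
    have h1 := ((hχ.differentiable (by simp)) z).hasFDerivAt
    have h2 := ((hq.differentiable (by simp)) z).hasFDerivAt.const_add 1
    have h3 := (h1.pow 2).mul ((hasDerivAt_inv (hs0 z)).comp_hasFDerivAt z h2)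
    have h4 : fderiv ℝ η z = _ := h3.fderiv
    rw [h4]
    simp
    ring
  have hdh : ∀ z a, fderiv ℝ (fun z => χ z * L z) z a =
      fderiv ℝ χ z a * L z + χ z * fderiv ℝ q z a * (1 + q z)⁻¹ := by
    intro z a
    have h1 := ((hχ.differentiable (by simp)) z).hasFDerivAt
    have h2 := ((hq.differentiable (by simp)) z).hasFDerivAt.const_add 1
    have h3 := h1.mul (h2.log (hs0 z))
    have h4 : fderiv ℝ (fun z => χ z * L z) z = _ := h3.fderiv
    rw [h4]
    simp [hL]
    ring
  have hpt : ∀ z, gradProd (fun z => χ z * L z) (fun z => χ z * L z) z ≤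
      8 * S * q z + 8 * gradProd χ χ z - 4 * gradProd q η z := by
    intro z
    -- Thanks to this the L¹ norm of q controls the term |∇χ|² log²(1 + q).
    have hL2 : L z ^ 2 ≤ 4 * q z := log_one_add_sq_le (hq0 z)
    have hγ0 : 0 ≤ gradProd χ χ z := add_nonneg (mul_self_nonneg _) (mul_self_nonneg _)
    have hb : L z ^ 2 * gradProd χ χ z ≤ 4 * q z * S :=
      mul_le_mul hL2 (hS z) hγ0 (by linarith [hq0 z])
    -- Here c and d are partial derivatives of χ and q, x = χ, i = 1/(1 + q) and l = log(1 + q). The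
    -- inequality combines (s + t)² ≤ 2s² + 2t² with 2(2c - xdi)² ≥ 0.
    have e1 : ∀ c d x i l : ℝ, (c * l + x * d * i) * (c * l + x * d * i) ≤
        2 * (l ^ 2 * (c * c)) + 8 * (c * c) - 4 * (d * (2 * x * c * i - x ^ 2 * d * i ^ 2)) := by
      intro c d x i l
      nlinarith [sq_nonneg (c * l - x * d * i), sq_nonneg (2 * c - x * d * i)]
    have h1 := e1 (fderiv ℝ χ z 1) (fderiv ℝ q z 1) (χ z) (1 + q z)⁻¹ (L z)
    have h2 := e1 (fderiv ℝ χ z Complex.I) (fderiv ℝ q z Complex.I) (χ z) (1 + q z)⁻¹ (L z)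
    simp only [gradProd, hdη, hdh] at hb ⊢
    linarith
  have i1 := integrable_gradProd hhs hhs hhc
  have i2 := (hq.continuous.integrable_of_hasCompactSupport (μ := volume) hqc).const_mul (8 * S)
  have i3 := (integrable_gradProd hχ hχ hχc).const_mul 8
  have i4 := (integrable_gradProd hq hηs hηc).const_mul 4
  have h0 := hsup η hηs hηc (fun z => by
    have := hq0 z
    simp only [hη]
    positivity) (closure_mono hηsup)
  calc _ ≤ ∫ z, (8 * S * q z + 8 * gradProd χ χ z - 4 * gradProd q η z) :=
        integral_mono i1 ((i2.add i3).sub i4) hpt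
    _ = 8 * S * (∫ z, q z) + 8 * (∫ z, gradProd χ χ z) - 4 * ∫ z, gradProd q η z := by
        rw [integral_sub (f := fun z => 8 * S * q z + 8 * gradProd χ χ z) (i2.add i3) i4,
          integral_add i2 i3, integral_const_mul, integral_const_mul, integral_const_mul]
    _ ≤ _ := by linarith

section

variable {p : ℂ → ℝ≥0∞} {z0 : ℂ} {R : ℝ}

theorem integrable_toReal_of_lintegral (hp : Measurable p) (hfin : ∫⁻ z, p z ≠ ⊤) :
    Integrable fun z => (p z).toReal :=
  integrable_toReal_of_lintegral_ne_top hp.aemeasurable hfin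

variable (φ : ContDiffBump (0 : ℂ))

/-- The regularization of a superharmonic function. -/
def regularize (p : ℂ → ℝ≥0∞) : ℂ → ℝ := mollify (φ.normed volume) fun z => (p z).toReal

theorem contDiff_regularize (hp : Measurable p) (hfin : ∫⁻ z, p z ≠ ⊤) :
    ContDiff ℝ ∞ (regularize φ p) :=
  contDiff_mollify φ.contDiff_normed φ.hasCompactSupport_normed
    (integrable_toReal_of_lintegral hp hfin).locallyIntegrable

theorem hasCompactSupport_regularize (h0 : ∀ z ∉ Metric.ball z0 R, p z = 0) :
    HasCompactSupport (regularize φ p) := by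
  refine HasCompactSupport.convolution _ ?_ φ.hasCompactSupport_normed
  refine HasCompactSupport.intro (isCompact_closedBall z0 R) fun z hz => ?_
  rw [h0 z fun h => hz (Metric.ball_subset_closedBall h), ENNReal.toReal_zero]

theorem regularize_nonneg (z : ℂ) : 0 ≤ regularize φ p z := by
  rw [regularize, mollify_apply]
  exact integral_nonneg fun t => mul_nonneg ENNReal.toReal_nonneg (φ.nonneg_normed _)

theorem integral_regularize (hp : Measurable p) (hfin : ∫⁻ z, p z ≠ ⊤) :
    ∫ z, regularize φ p z = (∫⁻ z, p z).toReal := by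
  have h := integral_convolution (ContinuousLinearMap.mul ℝ ℝ) (μ := volume) (ν := volume)
    (integrable_toReal_of_lintegral hp hfin) (φ.integrable_normed (μ := volume))
  rw [φ.integral_normed] at h
  simp only [ContinuousLinearMap.mul_apply', mul_one] at h
  rw [← integral_toReal hp.aemeasurable (ae_lt_top hp hfin), ← h]
  rfl

theorem ofReal_regularize (hp : Measurable p) (hfin : ∫⁻ z, p z ≠ ⊤) (z : ℂ) :
    ENNReal.ofReal (regularize φ p z) =
      ∫⁻ s, p (z - s) * ENNReal.ofReal (φ.normed volume s) := by
  have hc : Continuous (φ.normed (volume : Measure ℂ)) := φ.continuous_normed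
  obtain ⟨C, hC⟩ := φ.hasCompactSupport_normed.exists_bound_of_continuous hc
  have hi : Integrable fun t => (p t).toReal * φ.normed volume (z - t) :=
    (integrable_toReal_of_lintegral hp hfin).mul_bdd (c := C)
      (hc.comp (by fun_prop)).aestronglyMeasurable (.of_forall fun t => hC _)
  rw [regularize, mollify_apply, ofReal_integral_eq_lintegral_ofReal hi
    (.of_forall fun t => mul_nonneg ENNReal.toReal_nonneg (φ.nonneg_normed _)),
    ← lintegral_sub_left_eq_self (fun s => p (z - s) * ENNReal.ofReal (φ.normed volume s)) z]
  refine lintegral_congr_ae ?_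
  filter_upwards [ae_lt_top hp hfin] with t ht
  rw [ENNReal.ofReal_mul ENNReal.toReal_nonneg, ENNReal.ofReal_toReal ht.ne, sub_sub_cancel]

theorem le_regularize (hp : Measurable p) (hfin : ∫⁻ z, p z ≠ ⊤) {z : ℂ} {M : ℝ}
    (h : ∀ w ∈ Metric.ball z φ.rOut, ENNReal.ofReal M ≤ p w) : M ≤ regularize φ p z := by
  rw [← ENNReal.ofReal_le_ofReal_iff (regularize_nonneg φ z), ofReal_regularize φ hp hfin]
  have h1 : ∫⁻ s, ENNReal.ofReal (φ.normed volume s) = 1 := by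
    rw [← ofReal_integral_eq_lintegral_ofReal φ.integrable_normed
      (.of_forall fun t => φ.nonneg_normed _), φ.integral_normed, ENNReal.ofReal_one]
  calc ENNReal.ofReal M = ∫⁻ s, ENNReal.ofReal M * ENNReal.ofReal (φ.normed volume s) := by
        rw [lintegral_const_mul' _ _ ENNReal.ofReal_ne_top, h1, mul_one]
    _ ≤ _ := by
        refine lintegral_mono fun s => ?_
        by_cases hs : s ∈ Metric.ball (0 : ℂ) φ.rOut
        · gcongr
          refine h _ ?_
          rw [Metric.mem_ball, dist_eq_norm] at hs ⊢
          simpa using hs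
        · rw [← φ.support_normed_eq (μ := volume), Function.notMem_support] at hs
          simp [hs]

/-- A mollification is an average of translates of p by vectors shorter than the mollification
radius, and each translate satisfies the disc inequality as long as the translated disc stays in the
ball. -/
theorem integral_regularize_le (hp : Measurable p) (hfin : ∫⁻ z, p z ≠ ⊤)
    (h0 : ∀ z ∉ Metric.ball z0 R, p z = 0)
    (hd : DiscSuper p (Metric.ball z0 R)) {z : ℂ} {r : ℝ} (hr : 0 < r)
    (hz : Metric.closedBall z (φ.rOut + r) ⊆ Metric.ball z0 R) :
    ∫ ξ, regularize φ p (z + r * ξ) ∂unitDisc ≤ ∫ _, regularize φ p z ∂unitDisc := by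
  have hcont := (contDiff_regularize φ hp hfin).continuous
  obtain ⟨C, hC⟩ := (hasCompactSupport_regularize φ h0).exists_bound_of_continuous hcont
  have hi : Integrable (fun ξ => regularize φ p (z + r * ξ)) unitDisc :=
    Integrable.of_bound (hcont.comp (by fun_prop)).aestronglyMeasurable C (.of_forall fun ξ => hC _)
  rw [← ENNReal.ofReal_le_ofReal_iff (integral_nonneg fun _ => regularize_nonneg φ z),
    ofReal_integral_eq_lintegral_ofReal hi (.of_forall fun ξ => regularize_nonneg φ _),
    ofReal_integral_eq_lintegral_ofReal (integrable_const _)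
      (.of_forall fun ξ => regularize_nonneg φ _)]
  simp only [ofReal_regularize φ hp hfin]
  have hcn : Continuous (φ.normed (volume : Measure ℂ)) := φ.continuous_normed
  have hm : Measurable fun q : ℂ × ℂ => p (z + r * q.1 - q.2) *
      ENNReal.ofReal (φ.normed volume q.2) :=
    (hp.comp (by fun_prop)).mul (hcn.measurable.comp measurable_snd).ennreal_ofReal
  rw [lintegral_lintegral_swap (f := fun ξ s => p (z + r * ξ - s) *
    ENNReal.ofReal (φ.normed volume s)) hm.aemeasurable, lintegral_const, mul_comm,
    Measure.restrict_apply_univ, ← lintegral_const_mul' _ _ measure_ball_lt_top.ne]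
  refine lintegral_mono fun s => ?_
  rw [lintegral_mul_const' _ _ ENNReal.ofReal_ne_top, ← mul_assoc]
  by_cases hs : s ∈ Metric.ball (0 : ℂ) φ.rOut
  · gcongr
    have h1 := hd (z - s) r hr ((Metric.closedBall_subset_closedBall' ?_).trans hz)
    · simpa only [sub_add_eq_add_sub] using h1
    · rw [dist_eq_norm]
      have : ‖s‖ < φ.rOut := by simpa using hs
      simp
      linarith
  · rw [← φ.support_normed_eq (μ := volume), Function.notMem_support] at hs
    simp [hs]

end


/-! ### Smooth functions supported in the affine chart -/

theorem chart_zero_injective : Function.Injective (chart 0) := by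
  intro z w h
  have h1 := (toP1_eq_iff ⟨chartVec 0 z, chartVec_ne_zero 0 z⟩
    ⟨chartVec 0 w, chartVec_ne_zero 0 w⟩).1 h
  simpa [chartVec] using h1

theorem isOpenMap_chart_zero : IsOpenMap (chart 0) := by
  intro U hU
  rw [← isOpenQuotientMap_toP1.isQuotientMap.isOpen_preimage]
  have e : toP1 ⁻¹' (chart 0 '' U) =
      {v : {v : Fin 2 → ℂ // v ≠ 0} | v.1 1 ≠ 0} ∩ (fun v => v.1 0 / v.1 1) ⁻¹' U := by
    ext v
    simp only [mem_preimage, mem_image, mem_inter_iff, mem_ofPred_eq]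
    have key : ∀ z, chart 0 z = toP1 v ↔ z * v.1 1 = v.1 0 := fun z => by
      have h : chart 0 z = toP1 v ↔ chartVec 0 z 0 * v.1 1 = chartVec 0 z 1 * v.1 0 :=
        toP1_eq_iff ⟨chartVec 0 z, chartVec_ne_zero 0 z⟩ v
      rw [h]
      simp [chartVec]
    constructor
    · rintro ⟨z, hz, hzv⟩
      rw [key] at hzv
      have h1 : v.1 1 ≠ 0 := by
        intro h1
        refine v.2 ?_
        ext j
        fin_cases j
        · simpa [h1] using hzv.symm
        · exact h1
      refine ⟨h1, ?_⟩
      rwa [← hzv, mul_div_cancel_right₀ _ h1]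
    · rintro ⟨h1, hU⟩
      exact ⟨_, hU, (key _).2 (div_mul_cancel₀ _ h1)⟩
  rw [e]
  have c0 : Continuous fun v : {v : Fin 2 → ℂ // v ≠ 0} => v.1 0 :=
    (continuous_apply 0).comp continuous_subtype_val
  have c1 : Continuous fun v : {v : Fin 2 → ℂ // v ≠ 0} => v.1 1 :=
    (continuous_apply 1).comp continuous_subtype_val
  have ho : IsOpen {v : {v : Fin 2 → ℂ // v ≠ 0} | v.1 1 ≠ 0} := isOpen_ne_fun c1 continuous_const
  exact ContinuousOn.isOpen_inter_preimage (c0.continuousOn.div c1.continuousOn fun v hv => hv) ho hU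

theorem isOpenEmbedding_chart_zero : IsOpenEmbedding (chart 0) :=
  .of_continuous_injective_isOpenMap (continuous_chart 0) chart_zero_injective isOpenMap_chart_zero

theorem isOpenMap_chart (i : Fin 2) : IsOpenMap (chart i) := by
  fin_cases i
  · exact isOpenMap_chart_zero
  · have : chart 1 = (fun x => toPSL swapSL • x) ∘ chart 0 :=
      funext fun z => (swapSL_smul_chart z).symm
    change IsOpenMap (chart 1)
    rw [this]
    exact (isOpenMap_smul (toPSL swapSL)).comp isOpenMap_chart_zero

/-- The extension by zero of a function in the affine chart. -/
def chartExt (k : ℂ → ℝ) : P1 → ℝ := Function.extend (chart 0) k 0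

theorem chartExt_chart (k : ℂ → ℝ) (z : ℂ) : chartExt k (chart 0 z) = k z :=
  chart_zero_injective.extend_apply _ _ _

theorem chartExt_eq_zero {k : ℂ → ℝ} {x : P1} (hx : x ∉ chart 0 '' tsupport k) :
    chartExt k x = 0 := by
  by_cases h : ∃ z, chart 0 z = x
  · obtain ⟨z, rfl⟩ := h
    rw [chartExt_chart]
    exact image_eq_zero_of_notMem_tsupport fun hz => hx ⟨z, hz, rfl⟩
  · exact Function.extend_apply' _ _ _ h

theorem eventually_chartExt_eq_zero {k : ℂ → ℝ} (hc : HasCompactSupport k) {x : P1}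
    (hx : x ∉ chart 0 '' tsupport k) : ∀ᶠ y in 𝓝 x, chartExt k y = 0 := by
  have hcl := (hc.isCompact.image (continuous_chart 0)).isClosed
  filter_upwards [hcl.isOpen_compl.mem_nhds hx] with y hy
  exact chartExt_eq_zero hy

theorem continuous_chartExt {k : ℂ → ℝ} (hk : Continuous k) (hc : HasCompactSupport k) :
    Continuous (chartExt k) := by
  rw [continuous_iff_continuousAt]
  intro x
  by_cases hx : x ∈ chart 0 '' tsupport k
  · obtain ⟨z, -, rfl⟩ := hx
    rw [← isOpenEmbedding_chart_zero.continuousAt_iff]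
    have : chartExt k ∘ chart 0 = k := funext (chartExt_chart k)
    rw [this]
    exact hk.continuousAt
  · have := eventually_chartExt_eq_zero hc hx
    exact continuousAt_const.congr (this.mono fun y hy => hy.symm)

theorem chart_one_zero_ne (z : ℂ) : chart 0 z ≠ chart 1 0 := by
  intro h
  have h1 := (toP1_eq_iff ⟨chartVec 0 z, chartVec_ne_zero 0 z⟩
    ⟨chartVec 1 0, chartVec_ne_zero 1 0⟩).1 h
  simp [chartVec] at h1

/-- By compactness of the support the extension vanishes near the point missed by the first
coordinate; elsewhere it is k(1/z). -/
theorem contDiff_chartExt_chart_one {k : ℂ → ℝ} (hk : ContDiff ℝ ∞ k) (hc : HasCompactSupport k) :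
    ContDiff ℝ ∞ fun z => chartExt k (chart 1 z) := by
  rw [contDiff_iff_contDiffAt]
  intro z
  rcases eq_or_ne z 0 with rfl | hz
  · have h1 : chart 1 0 ∉ chart 0 '' tsupport k := fun ⟨w, _, hw⟩ => chart_one_zero_ne w hw
    have h2 := (continuous_chart 1).continuousAt.eventually (eventually_chartExt_eq_zero hc h1)
    exact (contDiffAt_const (c := (0 : ℝ))).congr_of_eventuallyEq h2
  · have h1 : (fun z => chartExt k (chart 1 z)) =ᶠ[𝓝 z] fun z => k z⁻¹ := by
      filter_upwards [isOpen_ne.mem_nhds hz] with w hw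
      rw [chart_one_eq hw, chartExt_chart]
    exact (hk.contDiffAt.comp z (contDiffAt_inv ℝ hz)).congr_of_eventuallyEq h1

theorem wirtinger_chartExt_chart_one {k : ℂ → ℝ} (hk : ContDiff ℝ ∞ k) {z : ℂ} (hz : z ≠ 0) :
    wirtinger (fun z => (chartExt k (chart 1 z) : ℂ)) z =
      pullBack (toPSL swapSL) (wirtinger fun z => (k z : ℂ)) z := by
  have hk' : ContDiff ℝ ∞ fun z => (k z : ℂ) := Complex.ofRealCLM.contDiff.comp hk
  have hz' := (mobDeriv_swap z).2 hz
  have hden : mden swapSL z ≠ 0 := by simpa [mobDeriv_toPSL] using hz'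
  have h1 : (fun z => (chartExt k (chart 1 z) : ℂ)) =ᶠ[𝓝 z]
      fun w => (k (mobSL swapSL w) : ℂ) * (starRingEnd ℂ) 1 := by
    filter_upwards [isOpen_ne.mem_nhds hz] with w hw
    rw [chart_one_eq_mob hw, chartExt_chart, mob_toPSL, map_one, mul_one]
  have h2 := wirtinger_comp_mul_conj (φ := fun z => (k z : ℂ)) (d := fun _ => 1)
    ((hk'.differentiable (by simp)) (mobSL swapSL z)) (hasDerivAt_mobSL swapSL hden)
    (hasDerivAt_const z 1)
  have h3 : wirtinger (fun z => (chartExt k (chart 1 z) : ℂ)) z =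
      wirtinger (fun w => (k (mobSL swapSL w) : ℂ) * (starRingEnd ℂ) 1) z := by
    rw [wirtinger, h1.fderiv_eq, wirtinger]
  rw [h3, h2, pullBack, mob_toPSL, mobDeriv_toPSL, map_one, mul_one]

theorem hasDel_chartExt {k : ℂ → ℝ} (hk : ContDiff ℝ ∞ k) (hc : HasCompactSupport k) :
    HasDel (chartExt k) ![wirtinger fun z => (k z : ℂ),
      wirtinger fun z => (chartExt k (chart 1 z) : ℂ)] := by
  have hk' : ContDiff ℝ ∞ fun z => (k z : ℂ) := Complex.ofRealCLM.contDiff.comp hk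
  have hc' : HasCompactSupport fun z => (k z : ℂ) := hc.comp_left (g := Complex.ofReal) rfl
  have m0 : MemLp (wirtinger fun z => (k z : ℂ)) 2 volume :=
    (continuous_wirtinger hk').memLp_of_hasCompactSupport (hasCompactSupport_wirtinger hc')
  refine hasDel_of_swap ?_ ?_ m0 ?_
  · simp only [chartExt_chart]
    exact hasWeakWirtinger_of_contDiff hk
  · simp only [swapSL_smul_chart]
    exact hasWeakWirtinger_of_contDiff (contDiff_chartExt_chart_one hk hc)
  · refine (memLp_congr_ae ?_).1 (memLp_pullBack (toPSL swapSL) m0)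
    have hne : ∀ᵐ z : ℂ, z ≠ 0 := by simp [ae_iff]
    filter_upwards [hne] with z hz
    exact (wirtinger_chartExt_chart_one hk hz).symm

theorem memW12_chartExt {k : ℂ → ℝ} (hk : ContDiff ℝ ∞ k) (hc : HasCompactSupport k) :
    MemW12 (chartExt k) :=
  ⟨integrable_continuous_P1 (continuous_chartExt hk.continuous hc), _, hasDel_chartExt hk hc⟩

theorem norm_sq_wirtinger {k : ℂ → ℝ} (hk : ContDiff ℝ ∞ k) (z : ℂ) :
    ‖wirtinger (fun z => (k z : ℂ)) z‖ ^ 2 = gradProd k k z / 4 := by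
  have hd : HasFDerivAt (fun z => (k z : ℂ)) (Complex.ofRealCLM.comp (fderiv ℝ k z)) z :=
    Complex.ofRealCLM.hasFDerivAt.comp z ((hk.differentiable (by simp)) z).hasFDerivAt
  rw [wirtinger, hd.fderiv, ← Complex.normSq_eq_norm_sq, Complex.normSq_apply, gradProd]
  simp
  ring

theorem delNorm_chartExt {k : ℂ → ℝ} (hk : ContDiff ℝ ∞ k) (hc : HasCompactSupport k) :
    delNorm (chartExt k) = Real.sqrt ((∫ z, gradProd k k z) / 2) := by
  rw [(hasDel_chartExt hk hc).delNorm_eq]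
  simp only [Matrix.cons_val_zero, norm_sq_wirtinger hk, integral_div]
  congr 1
  ring

/-- The Friedrichs inequality. -/
theorem exists_sobolevNorm_chartExt_le (z0 : ℂ) (R : ℝ) :
    ∃ C : ℝ, 0 < C ∧ ∀ k : ℂ → ℝ, ContDiff ℝ ∞ k → tsupport k ⊆ Metric.closedBall z0 R →
      sobolevNorm (chartExt k) ≤ C * delNorm (chartExt k) := by
  obtain ⟨C, hC, H⟩ := exists_poincare
  -- The extension vanishes on Z, which has positive mass; there its deviation from the mean is the
  -- mean itself, so the Poincaré inequality bounds the mean.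
  set Z : Set P1 := (chart 0 '' Metric.closedBall z0 R)ᶜ with hZ
  have hZm : MeasurableSet Z :=
    ((isCompact_closedBall z0 R).image (continuous_chart 0)).isClosed.measurableSet.compl
  have hZ0 : 0 < fubiniStudy.real Z := by
    refine ENNReal.toReal_pos (fun h0 => ?_) (measure_ne_top _ _)
    have h1 := ae_chart 0 (measure_eq_zero_iff_ae_notMem.1 h0)
    have h2 : (univ : Set ℂ) ≤ᵐ[volume] Metric.closedBall z0 R := by
      filter_upwards [h1] with z hz _
      rw [hZ, notMem_compl_iff] at hz
      obtain ⟨w, hw, hwz⟩ := hz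
      rwa [← chart_zero_injective hwz]
    have h3 := measure_mono_ae h2
    rw [measure_univ_of_isAddLeftInvariant] at h3
    exact absurd h3 (not_le.2 measure_closedBall_lt_top)
  refine ⟨C / fubiniStudy.real Z + 1, by positivity, fun k hk hsup => ?_⟩
  have hc : HasCompactSupport k :=
    (isCompact_closedBall z0 R).of_isClosed_subset (isClosed_tsupport k) hsup
  have hW := memW12_chartExt hk hc
  have hP := H _ hW
  set c := ∫ x, chartExt k x ∂fubiniStudy with hcdef
  have h1 : fubiniStudy.real Z * |c| ≤ ∫ x, |chartExt k x - c| ∂fubiniStudy := by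
    have e : ∫ x in Z, |chartExt k x - c| ∂fubiniStudy = fubiniStudy.real Z * |c| := by
      rw [setIntegral_congr_fun hZm (g := fun _ => |c|), setIntegral_const, smul_eq_mul]
      intro x hx
      have : chartExt k x = 0 := chartExt_eq_zero fun h => hx (image_mono hsup h)
      simp [this]
    rw [← e]
    exact setIntegral_le_integral (hW.1.sub (integrable_const c)).abs
      (.of_forall fun x => abs_nonneg _)
  rw [sobolevNorm, ← hcdef, add_mul, one_mul, div_mul_eq_mul_div]
  gcongr
  rw [le_div_iff₀ hZ0, mul_comm]
  exact h1.trans hP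


/-! ### Polar sets -/

/-- Integration against `ν` is bounded for the Sobolev norm. -/
def IsSobolevBounded (ν : Measure P1) : Prop :=
  ∃ A : ℝ, 0 < A ∧ ∀ f : P1 → ℝ, Continuous f → MemW12 f → ∫ x, f x ∂ν ≤ A * sobolevNorm f

/-- `delNorm` is invariant and the mean varies by a multiple of it. With g the exchange of
coordinates, this reduces the second coordinate to the first. -/
theorem IsSobolevBounded.map_smul {ν : Measure P1} (hν : IsSobolevBounded ν) (g : PSL(2, ℂ)) :
    IsSobolevBounded (ν.map (g • ·)) := by
  obtain ⟨A, hA, H⟩ := hν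
  obtain ⟨C, hC, H'⟩ := exists_mean_smul_sub_le
  have hl := log_opNorm_nonneg g
  have hK : 0 ≤ C * (1 + Real.log (opNorm g)) := by positivity
  refine ⟨A * (1 + C * (1 + Real.log (opNorm g))), by positivity, fun f hf hW => ?_⟩
  rw [integral_map (measurable_const_smul_P1 g).aemeasurable hf.aestronglyMeasurable]
  refine (H (fun x => f (g • x)) (hf.comp (continuous_const_smul g)) (memW12_comp_smul hW g)).trans ?_
  rw [mul_assoc]
  refine mul_le_mul_of_nonneg_left ?_ hA.le
  rw [sobolevNorm, sobolevNorm, delNorm_comp_smul hW]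
  have h1 := H' f hW g
  have h2 := abs_sub_abs_le_abs_sub (∫ x, f (g • x) ∂fubiniStudy) (∫ x, f x ∂fubiniStudy)
  have h3 := mul_nonneg hK (abs_nonneg (∫ x, f x ∂fubiniStudy))
  linarith

/-- The cut-off lives within R/2, and mollification and mean-value discs use less than R/8 each, so
everything stays in the ball of radius R. The bound sees p only through its integral, which
mollification preserves; hence it is uniform in φ. -/
theorem exists_energy_bound {p : ℂ → ℝ≥0∞} {z0 : ℂ} {R : ℝ} (hR : 0 < R) (hp : Measurable p)
    (hfin : ∫⁻ z, p z ≠ ⊤) (h0 : ∀ z ∉ Metric.ball z0 R, p z = 0)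
    (hd : DiscSuper p (Metric.ball z0 R)) :
    ∃ χ : ℂ → ℝ, ContDiff ℝ ∞ χ ∧ (∀ z, 0 ≤ χ z) ∧ tsupport χ ⊆ Metric.closedBall z0 (R / 2) ∧
      (∀ z ∈ Metric.closedBall z0 (R / 8), χ z = 1) ∧ ∃ E : ℝ, ∀ φ : ContDiffBump (0 : ℂ),
        φ.rOut < R / 8 →
        ∫ z, gradProd (fun z => χ z * Real.log (1 + regularize φ p z))
          (fun z => χ z * Real.log (1 + regularize φ p z)) z ≤ E := by
  let χ : ContDiffBump z0 := ⟨R / 4, R / 2, by positivity, by linarith⟩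
  have hχ : ContDiff ℝ ∞ χ := χ.contDiff
  have hχc : HasCompactSupport χ := χ.hasCompactSupport
  have hts : tsupport χ = Metric.closedBall z0 (R / 2) := χ.tsupport_eq
  obtain ⟨S, hS⟩ := (hasCompactSupport_gradProd (u := χ) hχc).exists_bound_of_continuous
    (continuous_gradProd hχ hχ)
  refine ⟨χ, hχ, fun z => χ.nonneg, hts.le, fun z hz => ?_,
    8 * S * (∫⁻ z, p z).toReal + 8 * ∫ z, gradProd χ χ z, fun φ hφ => ?_⟩
  · exact χ.one_of_mem_closedBall (Metric.closedBall_subset_closedBall (by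
      change R / 8 ≤ R / 4
      linarith) hz)
  · rw [← integral_regularize φ hp hfin]
    refine integral_gradProd_log_le (contDiff_regularize φ hp hfin)
      (hasCompactSupport_regularize φ h0) (regularize_nonneg φ) hχ hχc
      (fun z => (le_abs_self _).trans (hS z)) fun η hη hηc hη0 hηs => ?_
    refine integral_gradProd_nonneg (contDiff_regularize φ hp hfin)
      (hasCompactSupport_regularize φ h0) hη hηc hη0 (δ := R / 8) (by positivity)
      fun z hz r hr hrδ => integral_regularize_le φ hp hfin h0 hd hr ?_
    have hz' := hηs hz
    rw [hts, Metric.mem_closedBall] at hz'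
    exact Metric.closedBall_subset_ball' (by linarith)

/-- A capacity argument: the functions χ log(1 + q), for mollifications q of p, have uniformly
bounded Sobolev norm and can be made at least log(1 + M) on K for any M. -/
theorem measure_chart_image_eq_zero_of_isCompact {ν : Measure P1} [IsProbabilityMeasure ν]
    (hν : IsSobolevBounded ν) {p : ℂ → ℝ≥0∞} {z0 : ℂ} {R : ℝ} (hR : 0 < R)
    (hp : LowerSemicontinuous p) (hfin : ∫⁻ z, p z ≠ ⊤)
    (h0 : ∀ z ∉ Metric.ball z0 R, p z = 0) (hd : DiscSuper p (Metric.ball z0 R)) {K : Set ℂ}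
    (hK : IsCompact K) (hKp : ∀ z ∈ K, p z = ⊤) (hKz : K ⊆ Metric.closedBall z0 (R / 8)) :
    ν (chart 0 '' K) = 0 := by
  obtain ⟨χ, hχ, hχ0, hχs, hχ1, E, hE⟩ := exists_energy_bound hR hp.measurable hfin h0 hd
  obtain ⟨A, hA, H⟩ := hν
  obtain ⟨C, hC, HC⟩ := exists_sobolevNorm_chartExt_le z0 (R / 2)
  have hχc : HasCompactSupport χ :=
    (isCompact_closedBall z0 (R / 2)).of_isClosed_subset (isClosed_tsupport χ) hχs
  set B := A * (C * Real.sqrt (E / 2)) with hB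
  have key : ∀ M : ℝ, 0 < M → Real.log (1 + M) * ν.real (chart 0 '' K) ≤ B := by
    intro M hM
    -- By lower semicontinuity p > M on a δ-neighbourhood of the compact set K; mollifying at a
    -- scale at most δ keeps q ≥ M on K.
    obtain ⟨δ, hδ, hδK⟩ := hK.exists_thickening_subset_open (hp.isOpen_preimage (ENNReal.ofReal M))
      (fun z hz => by
        rw [mem_preimage, hKp z hz]
        exact ENNReal.ofReal_lt_top)
    have hε : 0 < min δ (R / 16) := lt_min hδ (by positivity)
    let φ : ContDiffBump (0 : ℂ) := ⟨min δ (R / 16) / 2, min δ (R / 16), by positivity, by linarith⟩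
    have hφ : φ.rOut = min δ (R / 16) := rfl
    set q := regularize φ p with hq
    have hqs : ContDiff ℝ ∞ q := contDiff_regularize φ hp.measurable hfin
    have hq0 : ∀ z, 0 ≤ q z := regularize_nonneg φ
    have hqK : ∀ z ∈ K, M ≤ q z := fun z hz =>
      le_regularize φ hp.measurable hfin fun w hw => (hδK (by
        rw [Metric.mem_thickening_iff]
        refine ⟨z, hz, ?_⟩
        rw [Metric.mem_ball, hφ] at hw
        exact hw.trans_le (min_le_left _ _))).le
    set k : ℂ → ℝ := fun z => χ z * Real.log (1 + q z) with hk
    have hks : ContDiff ℝ ∞ k :=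
      hχ.mul ((contDiff_const.add hqs).log fun z => by linarith [hq0 z])
    have hksub : tsupport k ⊆ Metric.closedBall z0 (R / 2) :=
      (closure_mono (Function.support_mul_subset_left _ _)).trans hχs
    have hkc : HasCompactSupport k := hχc.mul_right
    have hk0 : ∀ z, 0 ≤ k z := fun z =>
      mul_nonneg (hχ0 z) (Real.log_nonneg (by linarith [hq0 z]))
    have hext0 : ∀ x, 0 ≤ chartExt k x := fun x => by
      by_cases hx : x ∈ chart 0 '' tsupport k
      · obtain ⟨z, -, rfl⟩ := hx
        rw [chartExt_chart]
        exact hk0 z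
      · rw [chartExt_eq_zero hx]
    have hcont := continuous_chartExt hks.continuous hkc
    have hW := memW12_chartExt hks hkc
    have h1 := mul_meas_ge_le_integral_of_nonneg (μ := ν) (.of_forall hext0)
      (integrable_continuous_P1 hcont) (Real.log (1 + M))
    have h2 : ν.real (chart 0 '' K) ≤ ν.real {x | Real.log (1 + M) ≤ chartExt k x} := by
      refine measureReal_mono ?_
      rintro _ ⟨z, hz, rfl⟩
      rw [mem_ofPred_eq, chartExt_chart, hk]
      simp only
      rw [hχ1 z (hKz hz), one_mul]
      exact Real.log_le_log (by linarith) (by linarith [hqK z hz])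
    have h3 := hE φ (by
      rw [hφ]
      exact (min_le_right _ _).trans_lt (by linarith))
    calc _ ≤ Real.log (1 + M) * ν.real {x | Real.log (1 + M) ≤ chartExt k x} :=
          mul_le_mul_of_nonneg_left h2 (Real.log_nonneg (by linarith))
      _ ≤ ∫ x, chartExt k x ∂ν := h1
      _ ≤ A * sobolevNorm (chartExt k) := H _ hcont hW
      _ ≤ A * (C * delNorm (chartExt k)) := by gcongr; exact HC k hks hksub
      _ ≤ B := by
          rw [hB, delNorm_chartExt hks hkc]
          gcongr
  by_contra hne
  have hpos : 0 < ν.real (chart 0 '' K) := ENNReal.toReal_pos hne (measure_ne_top _ _)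
  have hB0 : 0 ≤ B / ν.real (chart 0 '' K) := by
    rw [hB]
    positivity
  -- For this M the left side of `key` is at least B + ν(K), which exceeds B.
  have h1 := key (Real.exp (B / ν.real (chart 0 '' K) + 1)) (Real.exp_pos _)
  have h2 : B / ν.real (chart 0 '' K) + 1 ≤
      Real.log (1 + Real.exp (B / ν.real (chart 0 '' K) + 1)) := by
    conv_lhs => rw [← Real.log_exp (B / ν.real (chart 0 '' K) + 1)]
    exact Real.log_le_log (Real.exp_pos _) (by linarith)
  have h3 := (mul_le_mul_of_nonneg_right h2 hpos.le).trans h1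
  rw [add_mul, div_mul_cancel₀ _ hpos.ne', one_mul] at h3
  linarith

/-- Inner regularity of ν reduces the claim to compact subsets. -/
theorem measure_chart_zero_image_eq_zero {ν : Measure P1} [IsProbabilityMeasure ν]
    (hν : IsSobolevBounded ν) {p : ℂ → ℝ≥0∞} {z0 : ℂ} {R : ℝ} (hR : 0 < R)
    (hp : LowerSemicontinuous p) (hfin : ∫⁻ z, p z ≠ ⊤)
    (h0 : ∀ z ∉ Metric.ball z0 R, p z = 0) (hd : DiscSuper p (Metric.ball z0 R)) :
    ν (chart 0 '' ({z | p z = ⊤} ∩ Metric.closedBall z0 (R / 8))) = 0 := by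
  have hm : MeasurableSet ({z | p z = ⊤} ∩ Metric.closedBall z0 (R / 8)) :=
    (hp.measurable (measurableSet_singleton ⊤)).inter Metric.isClosed_closedBall.measurableSet
  have hm' := isOpenEmbedding_chart_zero.measurableEmbedding.measurableSet_image.2 hm
  rw [hm'.measure_eq_iSup_isCompact]
  simp only [ENNReal.iSup_eq_zero]
  intro K hK hKc
  have hK' : K = chart 0 '' (chart 0 ⁻¹' K) :=
    (image_preimage_eq_of_subset (hK.trans (image_subset_range _ _))).symm
  have hsub : chart 0 ⁻¹' K ⊆ {z | p z = ⊤} ∩ Metric.closedBall z0 (R / 8) := by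
    intro z hz
    obtain ⟨w, hw, hwz⟩ := hK hz
    rwa [← chart_zero_injective hwz]
  rw [hK']
  refine measure_chart_image_eq_zero_of_isCompact hν hR hp hfin h0 hd ?_
    (fun z hz => (hsub hz).1) fun z hz => (hsub hz).2
  exact (isCompact_closedBall z0 (R / 8)).of_isClosed_subset
    (hKc.isClosed.preimage (continuous_chart 0)) fun z hz => (hsub hz).2

theorem measure_chart_image_eq_zero {ν : Measure P1} [IsProbabilityMeasure ν]
    (hν : IsSobolevBounded ν) (i : Fin 2) {p : ℂ → ℝ≥0∞} {z0 : ℂ} {R : ℝ} (hR : 0 < R)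
    (hp : LowerSemicontinuous p) (hfin : ∫⁻ z, p z ≠ ⊤)
    (h0 : ∀ z ∉ Metric.ball z0 R, p z = 0) (hd : DiscSuper p (Metric.ball z0 R)) :
    ν (chart i '' ({z | p z = ⊤} ∩ Metric.closedBall z0 (R / 8))) = 0 := by
  fin_cases i
  · exact measure_chart_zero_image_eq_zero hν hR hp hfin h0 hd
  · have hmeas := measurable_const_smul_P1 (toPSL swapSL)
    have : IsProbabilityMeasure (ν.map (toPSL swapSL • ·)) :=
      Measure.isProbabilityMeasure_map hmeas.aemeasurable
    have h1 := measure_chart_zero_image_eq_zero (hν.map_smul (toPSL swapSL)) hR hp hfin h0 hd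
    refine measure_mono_null ?_ (le_antisymm
      ((Measure.le_map_apply hmeas.aemeasurable _).trans h1.le) bot_le)
    rintro _ ⟨z, hz, rfl⟩
    exact ⟨z, hz, (swapSL_smul_chart_one z).symm⟩

theorem exists_chart_eq (x : P1) : ∃ i z, chart i z = x := by
  obtain ⟨v, rfl⟩ := isOpenQuotientMap_toP1.surjective x
  by_cases h : v.1 1 = 0
  · have h0 : v.1 0 ≠ 0 := fun h0 => v.2 (by ext j; fin_cases j <;> simp [h, h0])
    refine ⟨1, v.1 1 / v.1 0, ?_⟩
    refine (toP1_eq_iff ⟨chartVec 1 _, chartVec_ne_zero 1 _⟩ v).2 ?_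
    simp [chartVec, h0]
  · refine ⟨0, v.1 0 / v.1 1, ?_⟩
    refine (toP1_eq_iff ⟨chartVec 0 _, chartVec_ne_zero 0 _⟩ v).2 ?_
    simp [chartVec, h]

theorem IsQuasiSubharmonic.exists_discSuper {u : P1 → EReal} (hu : IsQuasiSubharmonic u)
    (i : Fin 2) (z0 : ℂ) :
    ∃ R > 0, ∃ p : ℂ → ℝ≥0∞, LowerSemicontinuous p ∧ DiscSuper p (Metric.ball z0 R) ∧
      (∀ z ∈ Metric.ball z0 R, p z = ⊤ ↔ u (chart i z) = ⊥) := by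
  obtain ⟨U, hU, hz0, s, -, hs⟩ := hu.2 i z0
  obtain ⟨R, hR, -, p, hp, hd, hiff, -⟩ := hs.exists_discSuper hU hz0
  refine ⟨R, hR, p, hp, hd, fun z hz => (hiff z hz).trans ?_⟩
  rw [EReal.add_eq_bot_iff]
  simp

/-- A superharmonic function is either infinite or integrable near a point. -/
theorem DiscSuper.lintegral_ball_quarter_lt_top {p : ℂ → ℝ≥0∞} {z0 : ℂ} {R : ℝ} (hR : 0 < R)
    (hd : DiscSuper p (Metric.ball z0 R)) {w : ℂ} (hw : w ∈ Metric.ball z0 (R / 4))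
    (hpw : p w ≠ ⊤) : ∫⁻ z in Metric.ball z0 (R / 4), p z < ⊤ := by
  rw [Metric.mem_ball] at hw
  refine (lintegral_mono_set (Metric.ball_subset_ball' ?_)).trans_lt
    (hd.lintegral_ball_lt_top (z := w) (r := R / 2) (by positivity)
      (Metric.closedBall_subset_ball' (by linarith)) hpw)
  rw [dist_comm] at hw
  linarith

/-- If p is finite somewhere near a point, it is integrable there and its infinite set contains no
nonempty open set. So near a point of the closure of the interior p is identically infinite: the
interior is clopen, and it is not the whole connected space `P1`. -/
theorem IsQuasiSubharmonic.interior_eq_empty {u : P1 → EReal} (hu : IsQuasiSubharmonic u) :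
    interior {x | u x = ⊥} = ∅ := by
  have hcl : IsClosed (interior {x | u x = ⊥}) := by
    refine isClosed_of_closure_subset fun x hx => ?_
    obtain ⟨i, z0, rfl⟩ := exists_chart_eq x
    obtain ⟨R, hR, p, hp, hd, hiff⟩ := hu.exists_discSuper i z0
    set V := Metric.ball z0 (R / 4) with hV
    have hVR : V ⊆ Metric.ball z0 R := Metric.ball_subset_ball (by linarith)
    have hVo : IsOpen (chart i '' V) := isOpenMap_chart i _ Metric.isOpen_ball
    have hz0 : chart i z0 ∈ chart i '' V :=
      mem_image_of_mem _ (Metric.mem_ball_self (by positivity))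
    have hall : ∀ w ∈ V, p w = ⊤ := by
      by_contra! hcon
      obtain ⟨w, hw, hpw⟩ := hcon
      have hfin := hd.lintegral_ball_quarter_lt_top hR hw hpw
      obtain ⟨y, ⟨w', hw', rfl⟩, hy⟩ := mem_closure_iff.1 hx _ hVo hz0
      set O := V ∩ chart i ⁻¹' interior {x | u x = ⊥} with hO
      have hOo : IsOpen O := Metric.isOpen_ball.inter (isOpen_interior.preimage (continuous_chart i))
      have hOtop : ∀ z ∈ O, p z = ⊤ := fun z hz => (hiff z (hVR hz.1)).2
        (interior_subset (mem_preimage.1 hz.2) : chart i z ∈ {x | u x = ⊥})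
      have h1 : ∫⁻ _ in O, (⊤ : ℝ≥0∞) ≤ ∫⁻ z in V, p z := by
        rw [← setLIntegral_congr_fun hOo.measurableSet hOtop]
        exact lintegral_mono_set inter_subset_left
      rw [setLIntegral_const, ENNReal.top_mul (hOo.measure_pos volume ⟨w', hw', hy⟩).ne'] at h1
      exact absurd hfin (not_lt.2 h1)
    refine mem_interior.2 ⟨_, ?_, hVo, hz0⟩
    rintro _ ⟨w, hw, rfl⟩
    exact (hiff w (hVR hw)).1 (hall w hw)
  rcases isClopen_iff.1 ⟨hcl, isOpen_interior⟩ with h | h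
  · exact h
  · obtain ⟨x, hx⟩ := hu.1
    exact absurd (interior_subset (h ▸ mem_univ x : x ∈ interior {x | u x = ⊥})) hx

/-- Being null is a local property. Near each point p is finite somewhere, as {u = -∞} has empty
interior, hence integrable on a smaller disc, and the capacity estimate applies to its restriction
to that disc. -/
theorem IsSobolevBounded.measure_isPolar {ν : Measure P1} [IsProbabilityMeasure ν]
    (hν : IsSobolevBounded ν) {E : Set P1} (hE : IsPolar E) : ν E = 0 := by
  obtain ⟨u, hu, hEu⟩ := hE
  refine measure_mono_null hEu (measure_null_of_locally_null _ fun x _ => ?_)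
  obtain ⟨i, z0, rfl⟩ := exists_chart_eq x
  obtain ⟨R, hR, p, hp, hd, hiff⟩ := hu.exists_discSuper i z0
  set V := Metric.ball z0 (R / 4) with hV
  have hVR : V ⊆ Metric.ball z0 R := Metric.ball_subset_ball (by linarith)
  obtain ⟨w, hw, hpw⟩ : ∃ w ∈ V, p w ≠ ⊤ := by
    by_contra! hcon
    have h1 : chart i z0 ∈ interior {x | u x = ⊥} := by
      refine mem_interior.2 ⟨chart i '' V, ?_, isOpenMap_chart i _ Metric.isOpen_ball,
        mem_image_of_mem _ (Metric.mem_ball_self (by positivity))⟩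
      rintro _ ⟨w, hw, rfl⟩
      exact (hiff w (hVR hw)).1 (hcon w hw)
    rw [hu.interior_eq_empty] at h1
    exact h1
  have hfin := hd.lintegral_ball_quarter_lt_top hR hw hpw
  set p' : ℂ → ℝ≥0∞ := V.indicator p with hp'
  have hlsc : LowerSemicontinuous p' := by
    intro y a ha
    by_cases hy : y ∈ V
    · replace ha : a < p' y := ha
      rw [hp', indicator_of_mem hy] at ha
      filter_upwards [hp y a ha, Metric.isOpen_ball.mem_nhds hy] with w hw hwV
      change a < p' w
      rw [hp', indicator_of_mem hwV]
      exact hw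
    · replace ha : a < p' y := ha
      rw [hp', indicator_of_notMem hy] at ha
      exact absurd ha not_lt_zero
  have hd' : DiscSuper p' V := by
    intro z r hr hz
    have h1 := hd z r hr (hz.trans hVR)
    rw [hp', indicator_of_mem (hz (Metric.mem_closedBall_self hr.le))]
    refine le_trans (lintegral_mono fun ξ => ?_) h1
    exact indicator_le_self _ _ _
  have hfin' : ∫⁻ z, p' z ≠ ⊤ := by
    rw [hp', lintegral_indicator Metric.isOpen_ball.measurableSet]
    exact hfin.ne
  have hnull := measure_chart_image_eq_zero hν i (by positivity : 0 < R / 4) hlsc hfin'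
    (fun z hz => indicator_of_notMem hz _) hd'
  refine ⟨chart i '' Metric.ball z0 (R / 4 / 8) ∩ {x | u x = ⊥}, ?_, measure_mono_null ?_ hnull⟩
  · exact inter_mem (mem_nhdsWithin_of_mem_nhds ((isOpenMap_chart i _ Metric.isOpen_ball).mem_nhds
      (mem_image_of_mem _ (Metric.mem_ball_self (by positivity))))) self_mem_nhdsWithin
  · rintro _ ⟨⟨z, hz, rfl⟩, hzu⟩
    have hzV : z ∈ V := Metric.ball_subset_ball (by linarith) hz
    refine ⟨z, ⟨?_, Metric.ball_subset_closedBall hz⟩, rfl⟩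
    rw [mem_ofPred_eq, hp', indicator_of_mem hzV]
    exact (hiff z (hVR hzV)).2 hzu


/-! ### Conclusion -/

theorem sobolevNorm_congr {h h' : P1 → ℝ} (e : h =ᵐ[fubiniStudy] h') :
    sobolevNorm h = sobolevNorm h' := by
  rw [sobolevNorm, sobolevNorm, delNorm_congr e, integral_congr_ae e]

theorem isSobolevBounded_of_functional {ν : Measure P1} (L : W12 →ₗ[ℝ] ℝ)
    (hL : ∀ (f : C(P1, ℝ)) (h : W12), h.1 =ᵐ[fubiniStudy] f → L h = ∫ x, f x ∂ν)
    (hb : ∃ A' : ℝ, 0 < A' ∧ ∀ h : W12, |L h| ≤ A' * sobolevNorm h.1) : IsSobolevBounded ν := by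
  obtain ⟨A, hA, H⟩ := hb
  refine ⟨A, hA, fun f hf hW => ?_⟩
  have e : hW.1.toL1 f =ᵐ[fubiniStudy] f := hW.1.coeFn_toL1
  have h1 := H ⟨hW.1.toL1 f, hW.congr e.symm⟩
  rw [sobolevNorm_congr e, hL ⟨f, hf⟩ _ e] at h1
  exact (le_abs_self _).trans h1

end RandomProducts
end

open RandomProducts in
theorem mainTheorem1 [MeasurableSpace PSL(2, ℂ)] [BorelSpace PSL(2, ℂ)]
    (μ : Measure PSL(2, ℂ)) [IsProbabilityMeasure μ]
    (hμ : IsNonElementary μ) (hmom : HasFiniteFirstMoment μ) :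
    ∃ ν : Measure P1, IsProbabilityMeasure ν ∧ IsStationary μ ν ∧
      ∃ L : W12 →ₗ[ℝ] ℝ,
        -- `L` extends the integration against `ν`
        (∀ (f : C(P1, ℝ)) (h : W12), h.1 =ᵐ[fubiniStudy] f → L h = ∫ x, f x ∂ν) ∧
        -- `L` is continuous
        (∃ A' : ℝ, 0 < A' ∧ ∀ h : W12, |L h| ≤ A' * sobolevNorm h.1) ∧
        -- exponential convergence of the transfer operator in the Sobolev norm
        (∃ A lam : ℝ, 0 < A ∧ 0 < lam ∧ lam < 1 ∧ ∀ (n : ℕ) (h : W12),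
          (∀ᵐ x ∂fubiniStudy, Integrable (fun g => h.1 (g • x)) (convPow μ n)) ∧
          MemW12 (fun x => transfer μ n h.1 x - L h) ∧
          sobolevNorm (fun x => transfer μ n h.1 x - L h) ≤ A * delNorm h.1 * lam ^ n) ∧
        -- `ν` has no mass on polar sets
        ∀ E : Set P1, IsPolar E → ν E = 0 := by
  obtain ⟨L, hlim, hbound, hconv⟩ := exists_limit_functional hμ hmom
  obtain ⟨ν, hν, hstat, hνL⟩ := exists_stationary μ
  -- L h is the limit of means that depend only on the class of h, and ν computes that limit for the
  -- continuous representative.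
  have hext : ∀ (f : C(P1, ℝ)) (h : W12), h.1 =ᵐ[fubiniStudy] f → L h = ∫ x, f x ∂ν :=
    fun f h e => hνL f _ ((hlim h).congr fun n => meanAvg_congr _ e)
  exact ⟨ν, hν, hstat, L, hext, hbound, hconv, fun E hE =>
    (isSobolevBounded_of_functional L hext hbound).measure_isPolar hE⟩
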